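/- **Setting.** A discriminant form is a finite abelian group $D$ with a quadratic form $q:D\to\mathbb Q/\mathbb Z$ whose bilinear form $(\beta,\gamma)=q(\beta+\gamma)-q(\beta)-q(\gamma)$ is nondegenerate. Write $e(x)=e^{2\pi i x}$. Let $D=\bigoplus_p D_p$ be a discriminant form of level $N$ (the least positive integer with $Nq=0$) whose $p$-components $D_p$ are as follows. * For every odd prime $p$, $D_p$ is trivial or $D_p=p^{\delta_p}$ with $\delta_p\in\{\pm1\}$, i.e. $D_p$ is cyclic of order $p$ with a generator $\gamma$ such that $q(\gamma)=\frac ap$ and $\left(\frac{2a}{p}\right)=\delta_p$. * $D_2$ is trivial; or $D_2=2^{+2}_t$ with $t\in\{\pm2\}$, i.e. $D_2$ is the orthogonal direct sum of two cyclic groups of order $2$ with generators of norm $q(\gamma_i)=\frac{t_i}{4}$, $t_i$ odd, $t_1+t_2\equiv t \pmod 8$, $\left(\frac{2}{t_1}\right)\left(\frac{2}{t_2}\right)=1$; or $D_2=2^{+1}_{t_1}\oplus4^{\delta_2}_{t_2}$ with $t_1\in\{\pm1\}$, $t_2\in\{\pm1,\pm3\}$, $\delta_2=\left(\frac2{t_2}\right)$,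 i.e. $D_2$ is the orthogonal direct sum of cyclic groups of orders $2$ and $4$ with generators of norm $q(\gamma_1)=\frac{t_1}{4}$, $q(\gamma_2)=\frac{t_2}{8}$. Let $r$ be the signature of $D$ modulo $8$, i.e. $\sum_{\gamma\in D}e(q(\gamma))=\sqrt{|D|}\,e(r/8)$; $r$ is even. Let $k$ be an integer with $k\equiv\frac r2\pmod 2$. Let $\rho_D$ be the Weil representation of $\mathrm{SL}_2(\mathbb Z)$ on $\mathbb C[D]$ (basis $e_\gamma$, $\gamma\in D$), given on $T=\begin{pmatrix}1&1\\0&1\end{pmatrix}$ and $S=\begin{pmatrix}0&-1\\1&0\end{pmatrix}$ by $$\rho_D(T)e_\gamma=e(q(\gamma))e_\gamma,\qquad \rho_D(S)e_\gamma=\frac{i^{-r/2}}{\sqrt{|D|}}\sum_{\beta\in D}e(-(\beta,\gamma))e_\beta .$$ Put $(f|_kM)(\tau)=\det(M)^{k/2}(c\tau+d)^{-k}f(M\tau)$ for $M=\begin{pmatrix}a&b\\c&d\end{pmatrix}\in\mathrm{GL}_2^+(\mathbb R)$, $W(N)=\begin{pmatrix}0&-1\\N&0\end{pmatrix}$ and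 $q=e^{2\pi i\tau}$ in expansions. * $\mathcal A^{\rm inv}(k,\rho_D)$ is the space of functions $F=\sum_\gamma F_\gamma e_\gamma:\mathbb H\to\mathbb C[D]$ with $F|_kM=\rho_D(M)F$ for all $M\in\mathrm{SL}_2(\mathbb Z)$, each $F_\gamma$ holomorphic on $\mathbb H$ with a Fourier expansion at $\infty$ having finitely many negative power terms, and $F$ invariant under the group $\mathrm{Aut}(D)$ of automorphisms of $D$ preserving $q$. * $\chi_D=\prod_{p\mid N}\chi_p$, where $\chi_p=\left(\frac{\cdot}{p}\right)$ for odd $p$, and $\chi_2=\left(\frac{-4}{\cdot}\right)$ if $D_2=2^{+2}_t$, $\chi_2=\left(\frac{-2a}{\cdot}\right)$ with $a=\left(\frac{-1}{t_1t_2}\right)$ if $D_2=2^{+1}_{t_1}\oplus4^{\delta_2}_{t_2}$. * $\epsilon=(\epsilon_p)_{p\mid N}$ with $\epsilon_p=\chi_p(2N/p)\delta_p$ for odd $p$, $\epsilon_2=\chi_2(Nt/8)$ if $D_2=2^{+2}_t$, and $\epsilon_2=\chi_2(t_2N/8)$ if $D_2=2^{+1}_{t_1}\oplus4^{\delta_2}_{t_2}$.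 * $A(N,k,\chi_D)$ is the space of holomorphic functions $f$ on $\mathbb H$ that are meromorphic at all cusps and satisfy $f|_kM=\chi_D(d)f$ for all $M=\begin{pmatrix}a&b\\c&d\end{pmatrix}\in\Gamma_0(N)$; $A^\epsilon(N,k,\chi_D)$ is the subspace of those $f=\sum_na(n)q^n$ with $a(n)=0$ whenever $\chi_p(n)=-\epsilon_p$ for some prime $p\mid N$. Let $\omega(m)$ be the number of distinct prime divisors of $m$, and $s(n)=2^{\omega(\gcd(n,N))}$. Define $$\phi(F)=i^{\frac r2}2^{-\omega(N)}N^{-\frac{k-1}{2}}\,F_0|_kW(N),\qquad \psi(f)=i^{\frac r2}N^{\frac{k-1}{2}}\sum_{M\in\Gamma_0(N)\backslash\mathrm{SL}_2(\mathbb Z)}\bigl(f|_kW(N)|_kM\bigr)\,\rho_D(M^{-1})e_0 .$$ **Theorem.** The map $\phi$ is a linear isomorphism from $\mathcal A^{\rm inv}(k,\rho_D)$ onto $A^\epsilon(N,k,\chi_D)$, and $\psi$ (for any choice of coset representatives) is its inverse. Explicitly, if $f=\sum_na(n)q^n\in A^\epsilon(N,k,\chi_D)$ and $\psi(f)=F=\sum_\gamma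 F_\gamma e_\gamma$, then for every $\gamma\in D$ $$F_\gamma(\tau)=s(Nq(\gamma))\sum_{n\equiv Nq(\gamma)\ (\mathrm{mod}\ N)}a(n)q^{\frac nN}=\sum_{n\equiv Nq(\gamma)\ (\mathrm{mod}\ N)}s(n)a(n)q^{\frac nN}.$$ -/

import Mathlib

namespace WeilForms

open ModularGroup
open scoped MatrixGroups

section Presentation

variable {G : Type*} [Group G]

/-- The elements of the form `s ^ i * w * s ^ j`, with `w` a word in `t` and `s t⁻¹ s⁻¹`. -/
def wordSet (s t : G) : Set G :=
  {h | ∃ (i : ℕ) (w : G) (j : ℕ),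
    w ∈ Submonoid.closure {t, s * t⁻¹ * s⁻¹} ∧ h = s ^ i * w * s ^ j}

theorem S_pow_four : (S : SL(2, ℤ)) ^ 4 = 1 := by decide

theorem STS_eq : (S * T * S : SL(2, ℤ)) = T⁻¹ * S * T⁻¹ := by decide

theorem sq_comm {s t : G} (h : s * t * s = t⁻¹ * s * t⁻¹) : s ^ 2 * t = t * s ^ 2 := by
  have h1 : s * t * s * t * s = t⁻¹ * s ^ 2 := by rw [h, pow_two]; group
  have h2 : s * t * s * t * s = s ^ 2 * t⁻¹ := by
    calc s * t * s * t * s = s * t * (s * t * s) := by group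
      _ = _ := by rw [h, pow_two]; group
  have h3 : t⁻¹ * s ^ 2 = s ^ 2 * t⁻¹ := h1.symm.trans h2
  calc s ^ 2 * t = t * (t⁻¹ * s ^ 2) * t := by group
    _ = _ := by rw [h3]; group

theorem tst_eq {s t : G} (h : s * t * s = t⁻¹ * s * t⁻¹) : t * s * t = s * t⁻¹ * s⁻¹ := by
  calc t * s * t = t * (s * t * s) * s⁻¹ := by group
    _ = s * t⁻¹ * s⁻¹ := by rw [h]; group

theorem mul_mem_wordSet {s t : G} (h : s * t * s = t⁻¹ * s * t⁻¹) {g : G}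
    (hg : g ∈ wordSet s t) : t * g ∈ wordSet s t := by
  obtain ⟨i, w, j, hw, rfl⟩ := hg
  have hz : Commute (s ^ 2) t := sq_comm h
  obtain ⟨m, rfl | rfl⟩ : ∃ m, i = 2 * m ∨ i = 2 * m + 1 := Nat.even_or_odd' i
  · refine ⟨2 * m, t * w, j, mul_mem (Submonoid.subset_closure (by simp)) hw, ?_⟩
    have := (hz.pow_left m).eq
    rw [← pow_mul] at this
    simp only [← mul_assoc, this]
  · have hc : t * s ^ (2 * m + 1) = s ^ (2 * m) * (t * s) := by
      have := (hz.pow_left m).eq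
      rw [← pow_mul] at this
      rw [pow_succ, ← mul_assoc, ← this, mul_assoc]
    have key : ∃ (i' : ℕ) (w' : G) (j' : ℕ),
        w' ∈ Submonoid.closure {t, s * t⁻¹ * s⁻¹} ∧ t * s * w * s ^ j = s ^ i' * w' * s ^ j' := by
      induction hw using Submonoid.closure_induction_left with
      | one =>
        exact ⟨0, t, j + 1, Submonoid.subset_closure (by simp), by simp [pow_succ', mul_assoc]⟩
      | mul_left x hx y hy _ =>
        rcases hx with hx | hx
        · refine ⟨0, s * t⁻¹ * s⁻¹ * y, j, mul_mem (Submonoid.subset_closure (by simp)) hy, ?_⟩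
          rw [hx, ← tst_eq h]; simp [mul_assoc]
        · refine ⟨1, y, j, hy, ?_⟩
          have : t * s * (s * t⁻¹ * s⁻¹) = s := by
            calc t * s * (s * t⁻¹ * s⁻¹) = t * s ^ 2 * t⁻¹ * s⁻¹ := by rw [pow_two]; group
              _ = s := by rw [← hz.eq, pow_two]; group
          rw [Set.mem_singleton_iff.mp hx, ← mul_assoc, this, pow_one]
    obtain ⟨i', w', j', hw', e⟩ := key
    refine ⟨2 * m + i', w', j', hw', ?_⟩
    rw [← mul_assoc, ← mul_assoc, hc, pow_add]
    simp only [mul_assoc] at e ⊢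
    rw [e]

theorem mem_wordSet_of_mem_closure {s t : G} (h : s * t * s = t⁻¹ * s * t⁻¹) (h4 : s ^ 4 = 1)
    {g : G} (hg : g ∈ Subgroup.closure {s, t}) : g ∈ wordSet s t := by
  have hS : ∀ g ∈ wordSet s t, s * g ∈ wordSet s t := by
    rintro g ⟨i, w, j, hw, rfl⟩
    exact ⟨i + 1, w, j, hw, by simp only [pow_succ', mul_assoc]⟩
  have hT : ∀ g ∈ wordSet s t, t * g ∈ wordSet s t := fun g => mul_mem_wordSet h
  have hSi : s⁻¹ = s ^ 3 := by
    rw [inv_eq_iff_mul_eq_one, ← pow_succ']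
    exact h4
  induction hg using Subgroup.closure_induction_left with
  | one => exact ⟨0, 1, 0, one_mem _, by simp⟩
  | mul_left x hx y _ ih =>
    rcases hx with rfl | rfl
    · exact hS _ ih
    · exact hT _ ih
  | inv_mul_cancel x hx y _ ih =>
    rcases hx with rfl | rfl
    · rw [hSi]
      simp only [pow_succ, pow_zero, one_mul, mul_assoc]
      exact hS _ (hS _ (hS _ ih))
    · have : x⁻¹ = s * x * s * x * s⁻¹ := by
        rw [h]; group
      rw [this, hSi]
      simp only [pow_succ, pow_zero, one_mul, mul_assoc]
      exact hS _ (hT _ (hS _ (hT _ (hS _ (hS _ (hS _ ih))))))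

/-- Words in `T` and `S T⁻¹ S⁻¹` have nonnegative entries, and only the empty word has entries
summing to at most `2`. -/
theorem word_nonneg {s t : G} {w : SL(2, ℤ) × G} (hw : w ∈ Submonoid.closure
      {((T, t) : SL(2, ℤ) × G), ((S, s) : SL(2, ℤ) × G) * (T, t)⁻¹ * (S, s)⁻¹}) :
    (∀ i j, 0 ≤ w.1 i j) ∧ (w = 1 ∨ 2 < w.1 0 0 + w.1 0 1 + w.1 1 0 + w.1 1 1) := by
  have hT : ∀ M : SL(2, ℤ), (T * M) 0 0 = M 0 0 + M 1 0 ∧ (T * M) 0 1 = M 0 1 + M 1 1 ∧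
      (T * M) 1 0 = M 1 0 ∧ (T * M) 1 1 = M 1 1 := by
    intro M
    simp [coe_T, Matrix.mul_apply, Fin.sum_univ_two]
  have hLe : ((S * T⁻¹ * S⁻¹ : SL(2, ℤ)) : Matrix (Fin 2) (Fin 2) ℤ) = !![1, 0; 1, 1] := by decide
  have hL : ∀ M : SL(2, ℤ), (S * T⁻¹ * S⁻¹ * M) 0 0 = M 0 0 ∧ (S * T⁻¹ * S⁻¹ * M) 0 1 = M 0 1 ∧
      (S * T⁻¹ * S⁻¹ * M) 1 0 = M 0 0 + M 1 0 ∧ (S * T⁻¹ * S⁻¹ * M) 1 1 = M 0 1 + M 1 1 := by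
    generalize S * T⁻¹ * S⁻¹ = X at hLe
    intro M
    simp [hLe, Matrix.mul_apply, Fin.sum_univ_two]
  induction hw using Submonoid.closure_induction_left with
  | one => exact ⟨fun i j => by fin_cases i <;> fin_cases j <;> simp, Or.inl rfl⟩
  | mul_left x hx y _ ih =>
    obtain ⟨h0, h1⟩ := ih
    have hsum : 2 ≤ y.1 0 0 + y.1 0 1 + y.1 1 0 + y.1 1 1 := by
      rcases h1 with rfl | h1
      · simp
      · exact h1.le
    have hdet := y.1.det_coe
    rw [Matrix.det_fin_two] at hdet
    have a := h0 0 0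
    have b := h0 0 1
    have c := h0 1 0
    have d := h0 1 1
    have r0 : 0 < y.1 0 0 + y.1 0 1 := by
      rcases eq_or_lt_of_le a with h | h <;> rcases eq_or_lt_of_le b with h' | h' <;>
        first | linarith | (rw [← h, ← h'] at hdet; simp at hdet)
    have r1 : 0 < y.1 1 0 + y.1 1 1 := by
      rcases eq_or_lt_of_le c with h | h <;> rcases eq_or_lt_of_le d with h' | h' <;>
        first | linarith | (rw [← h, ← h'] at hdet; simp at hdet)
    obtain ⟨e1, e2, e3, e4⟩ | ⟨e1, e2, e3, e4⟩ :
      ((x * y).1 0 0 = y.1 0 0 + y.1 1 0 ∧ (x * y).1 0 1 = y.1 0 1 + y.1 1 1 ∧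
        (x * y).1 1 0 = y.1 1 0 ∧ (x * y).1 1 1 = y.1 1 1) ∨
      ((x * y).1 0 0 = y.1 0 0 ∧ (x * y).1 0 1 = y.1 0 1 ∧
        (x * y).1 1 0 = y.1 0 0 + y.1 1 0 ∧ (x * y).1 1 1 = y.1 0 1 + y.1 1 1) := by
      rcases hx with rfl | hx
      · exact Or.inl (hT y.1)
      · rw [Set.mem_singleton_iff.mp hx]
        exact Or.inr (hL y.1)
    all_goals
      refine ⟨fun i j => ?_, Or.inr (by rw [e1, e2, e3, e4]; linarith)⟩
      fin_cases i <;> fin_cases j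
      · exact e1.symm ▸ (by linarith)
      · exact e2.symm ▸ (by linarith)
      · exact e3.symm ▸ (by linarith)
      · exact e4.symm ▸ (by linarith)

theorem eq_one_of_mem_closure {s t : G} (h : s * t * s = t⁻¹ * s * t⁻¹) (h4 : s ^ 4 = 1)
    {g : SL(2, ℤ) × G} (hg : g ∈ Subgroup.closure {((S, s) : SL(2, ℤ) × G), (T, t)})
    (h1 : g.1 = 1) : g = 1 := by
  have hσ : ((S, s) : SL(2, ℤ) × G) ^ 4 = 1 := Prod.ext S_pow_four h4
  obtain ⟨i, w, j, hw, rfl⟩ := mem_wordSet_of_mem_closure (Prod.ext STS_eq h) hσ hg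
  obtain ⟨h0, hw1⟩ := word_nonneg hw
  have hwS : w.1 * S ^ (i + j) = 1 := by
    have h1' : S ^ i * w.1 * S ^ j = 1 := h1
    calc w.1 * S ^ (i + j) = (S ^ i)⁻¹ * (S ^ i * w.1 * S ^ j) * S ^ i := by
          rw [add_comm, pow_add]; group
      _ = 1 := by rw [h1']; group
  have hmod : ∀ n : ℕ, ((S, s) : SL(2, ℤ) × G) ^ n = (S, s) ^ (n % 4) := fun n =>
    pow_eq_pow_mod n hσ
  have hSmod : (S : SL(2, ℤ)) ^ (i + j) = S ^ ((i + j) % 4) := pow_eq_pow_mod _ S_pow_four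
  rw [hSmod] at hwS
  have hlt : (i + j) % 4 < 4 := Nat.mod_lt _ (by norm_num)
  have hmain : (i + j) % 4 = 0 := by
    have hw' : w.1 = (S ^ ((i + j) % 4))⁻¹ := eq_inv_of_mul_eq_one_left hwS
    have n00 := h0 0 0
    have n01 := h0 0 1
    have n10 := h0 1 0
    rw [hw'] at n00 n01 n10
    clear hw' hwS hSmod hmod
    generalize (i + j) % 4 = m at *
    interval_cases m
    · rfl
    · exfalso; revert n10; decide
    · exfalso; revert n00; decide
    · exfalso; revert n01; decide
  rw [hmain, pow_zero, mul_one] at hwS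
  have hwone : w = 1 := by
    rcases hw1 with h | h
    · exact h
    · rw [hwS] at h; simp at h
  rw [hwone, mul_one, ← pow_add, hmod, hmain, pow_zero]

theorem fst_bijective {s t : G} (h : s * t * s = t⁻¹ * s * t⁻¹) (h4 : s ^ 4 = 1) :
    Function.Bijective ((MonoidHom.fst (SL(2, ℤ)) G).comp
      (Subgroup.closure {((S, s) : SL(2, ℤ) × G), (T, t)}).subtype) := by
  constructor
  · rw [injective_iff_map_eq_one]
    intro g hg
    exact Subtype.ext (eq_one_of_mem_closure h h4 g.2 hg)
  · rw [← MonoidHom.range_eq_top, eq_top_iff, ← _root_.SpecialLinearGroup.SL2Z_generators,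
      Subgroup.closure_le]
    rintro x (rfl | rfl)
    · exact ⟨⟨(S, s), Subgroup.subset_closure (by simp)⟩, rfl⟩
    · exact ⟨⟨(T, t), Subgroup.subset_closure (by simp)⟩, rfl⟩

/-- The homomorphism from `SL₂(ℤ)` with prescribed values `s` at `S` and `t` at `T`, for `s` and `t`
satisfying the defining relations of `SL₂(ℤ)`. -/
noncomputable def homOfRel (s t : G) (h : s * t * s = t⁻¹ * s * t⁻¹) (h4 : s ^ 4 = 1) :
    SL(2, ℤ) →* G :=
  ((MonoidHom.snd (SL(2, ℤ)) G).comp (Subgroup.subtype _)).comp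
    (MulEquiv.ofBijective _ (fst_bijective h h4)).symm.toMonoidHom

theorem homOfRel_apply {s t : G} (h : s * t * s = t⁻¹ * s * t⁻¹) (h4 : s ^ 4 = 1)
    {M : SL(2, ℤ)} {g : G} (hM : (M, g) ∈ Subgroup.closure {((S, s) : SL(2, ℤ) × G), (T, t)}) :
    homOfRel s t h h4 M = g := by
  have : (MulEquiv.ofBijective _ (fst_bijective h h4)).symm M = ⟨(M, g), hM⟩ := by
    rw [MulEquiv.symm_apply_eq]; rfl
  simp [homOfRel, this]

theorem homOfRel_S {s t : G} (h : s * t * s = t⁻¹ * s * t⁻¹) (h4 : s ^ 4 = 1) :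
    homOfRel s t h h4 S = s :=
  homOfRel_apply h h4 (Subgroup.subset_closure (by simp))

theorem homOfRel_T {s t : G} (h : s * t * s = t⁻¹ * s * t⁻¹) (h4 : s ^ 4 = 1) :
    homOfRel s t h h4 T = t :=
  homOfRel_apply h h4 (Subgroup.subset_closure (by simp))

end Presentation
section DiscriminantForms

/-- The character `x ↦ exp (2 π i x)` of `ℚ/ℤ`. -/
noncomputable def e : AddCircle (1 : ℚ) → ℂ :=
  Function.Periodic.lift (f := fun x : ℚ => Complex.exp (2 * Real.pi * Complex.I * x)) (c := 1)
    fun x => by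
      push_cast
      rw [mul_add, mul_one, Complex.exp_add, Complex.exp_two_pi_mul_I, mul_one]

theorem e_coe (x : ℚ) : e (x : AddCircle (1 : ℚ)) = Complex.exp (2 * Real.pi * Complex.I * x) := rfl

theorem e_zero : e 0 = 1 := by
  have := e_coe 0
  simpa using this

theorem e_add (x y : AddCircle (1 : ℚ)) : e (x + y) = e x * e y := by
  induction x using QuotientAddGroup.induction_on with | _ x
  induction y using QuotientAddGroup.induction_on with | _ y
  have := e_coe (x + y)
  rw [e_coe, e_coe, ← Complex.exp_add, ← mul_add, ← Rat.cast_add]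
  exact this

theorem e_eq_one {x : AddCircle (1 : ℚ)} (h : e x = 1) : x = 0 := by
  induction x using QuotientAddGroup.induction_on with | _ x
  rw [e_coe, Complex.exp_eq_one_iff] at h
  obtain ⟨n, hn⟩ := h
  have hx : (x : ℂ) = (n : ℚ) := by
    apply mul_left_cancel₀ Complex.two_pi_I_ne_zero
    rw [hn]; push_cast; ring
  have hx' : x = (n : ℚ) := by exact_mod_cast hx
  rw [hx']
  exact (AddCircle.coe_eq_zero_iff (1 : ℚ)).mpr ⟨n, by simp⟩

theorem sqrt_card_ne_zero {D : Type*} [Fintype D] [Nonempty D] : ((Real.sqrt (Fintype.card D) : ℝ) : ℂ) ≠ 0 := by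
  have : (0 : ℝ) < Fintype.card D := by exact_mod_cast Fintype.card_pos
  exact_mod_cast (Real.sqrt_pos.mpr this).ne'

theorem sqrt_card_sq {D : Type*} [Fintype D] :
    ((Real.sqrt (Fintype.card D) : ℝ) : ℂ) * (Real.sqrt (Fintype.card D) : ℝ) = Fintype.card D := by
  rw [← Complex.ofReal_mul, Real.mul_self_sqrt (Nat.cast_nonneg _)]; simp

/-- A discriminant form on a (finite) abelian group `D`: a quadratic form with values in `ℚ/ℤ` whose
bilinear form `(β, γ) = q (β + γ) - q β - q γ` is nondegenerate. -/
structure DiscriminantForm (D : Type*) [AddCommGroup D] where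
  q : QuadraticMap ℤ D (AddCircle (1 : ℚ))
  nondeg : Function.Bijective (fun γ : D => (q.polarBilin γ : D →ₗ[ℤ] AddCircle (1 : ℚ)))

namespace DiscriminantForm

variable {D : Type*} [AddCommGroup D] (𝔇 : DiscriminantForm D)

/-- The bilinear form `(β, γ)`. -/
def b (β γ : D) : AddCircle (1 : ℚ) := QuadraticMap.polar 𝔇.q β γ

/-- The smallest positive integer `N` with `N q(γ) = 0` for all `γ`. -/
noncomputable def level : ℕ := sInf {n : ℕ | 0 < n ∧ ∀ γ, n • 𝔇.q γ = 0}

/-- The automorphisms of the group `D` that preserve the quadratic form. -/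
def IsAut (σ : D ≃+ D) : Prop := ∀ γ, 𝔇.q (σ γ) = 𝔇.q γ

theorem b_add_right (x y z : D) : 𝔇.b x (y + z) = 𝔇.b x y + 𝔇.b x z :=
  QuadraticMap.polar_add_right _ _ _ _

theorem b_comm (x y : D) : 𝔇.b x y = 𝔇.b y x := QuadraticMap.polar_comm _ _ _

theorem b_add_left (x y z : D) : 𝔇.b (x + y) z = 𝔇.b x z + 𝔇.b y z :=
  QuadraticMap.polar_add_left _ _ _ _

theorem q_add (x y : D) : 𝔇.q (x + y) = 𝔇.q x + 𝔇.q y + 𝔇.b x y := by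
  simp [b, QuadraticMap.polar]

/-- The operator by which `T` acts. -/
noncomputable def opT : Module.End ℂ (D → ℂ) where
  toFun F γ := e (𝔇.q γ) * F γ
  map_add' F G := by ext; simp [mul_add]
  map_smul' c F := by ext; simp; ring

/-- The inverse of `opT`. -/
noncomputable def opTInv : Module.End ℂ (D → ℂ) where
  toFun F γ := e (-𝔇.q γ) * F γ
  map_add' F G := by ext; simp [mul_add]
  map_smul' c F := by ext; simp; ring

theorem opT_mul_inv : 𝔇.opT * 𝔇.opTInv = 1 := by
  ext1 F
  funext γ
  simp only [Module.End.mul_apply, opT, opTInv, LinearMap.coe_mk, AddHom.coe_mk,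
    Module.End.one_apply]
  rw [← mul_assoc, ← e_add, add_neg_cancel, e_zero, one_mul]

theorem opT_inv_mul : 𝔇.opTInv * 𝔇.opT = 1 := by
  ext1 F
  funext γ
  simp only [Module.End.mul_apply, opT, opTInv, LinearMap.coe_mk, AddHom.coe_mk,
    Module.End.one_apply]
  rw [← mul_assoc, ← e_add, neg_add_cancel, e_zero, one_mul]

variable [Fintype D]

/-- `r` is a signature of `D` (it is determined modulo `8`): the normalized Gauss sum of the
quadratic form is `e (r / 8)`. By Milgram's formula this says that `r` is, modulo `8`, the signature of
any even lattice with discriminant form `D`. -/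
def HasSignature (r : ℤ) : Prop :=
  ∑ γ : D, e (𝔇.q γ) = Real.sqrt (Fintype.card D) * Complex.exp (2 * Real.pi * Complex.I * (r / 8))

/-- The operator by which `S` acts, for signature `r`. -/
noncomputable def opS (r : ℤ) : Module.End ℂ (D → ℂ) where
  toFun F β := Complex.I ^ (-(r / 2)) / Real.sqrt (Fintype.card D) * ∑ γ, e (-𝔇.b β γ) * F γ
  map_add' F G := by ext; simp [mul_add, Finset.sum_add_distrib]
  map_smul' c F := by
    ext; simp only [Pi.smul_apply, smul_eq_mul, RingHom.id_apply, Finset.mul_sum]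
    exact Finset.sum_congr rfl fun _ _ => by ring

open Classical in
theorem sum_e_b (x : D) : ∑ γ, e (-𝔇.b γ x) = if x = 0 then (Fintype.card D : ℂ) else 0 := by
  split_ifs with hx
  · subst hx
    have : ∀ γ, 𝔇.b γ 0 = 0 := fun γ => QuadraticMap.polar_zero_right _ _
    simp [this, e_zero]
  · obtain ⟨γ₀, h0⟩ : ∃ γ₀, 𝔇.b γ₀ x ≠ 0 := by
      by_contra! h
      apply hx
      apply 𝔇.nondeg.1
      ext γ
      have := h γ
      rw [b_comm] at this
      simpa [b] using this
    have hne : e (-𝔇.b γ₀ x) ≠ 1 := fun h => h0 (neg_eq_zero.mp (e_eq_one h))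
    have hs : ∑ γ, e (-𝔇.b γ x) = e (-𝔇.b γ₀ x) * ∑ γ, e (-𝔇.b γ x) := by
      rw [Finset.mul_sum, ← Equiv.sum_comp (Equiv.addLeft γ₀)]
      refine Finset.sum_congr rfl fun γ _ => ?_
      rw [Equiv.coe_addLeft, b_add_left, neg_add, e_add]
    by_contra h
    exact hne (mul_right_cancel₀ h (by rw [one_mul]; exact hs.symm))

open Classical in
theorem opS_sq_apply (r : ℤ) (F : D → ℂ) (β : D) :
    (𝔇.opS r * 𝔇.opS r) F β = Complex.I ^ (-(r / 2)) * Complex.I ^ (-(r / 2)) * F (-β) := by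
  have h1 : ∑ γ, ∑ δ, e (-𝔇.b β γ) * (e (-𝔇.b γ δ) * F δ) = Fintype.card D * F (-β) := by
    rw [Finset.sum_comm]
    have : ∀ δ, ∑ γ, e (-𝔇.b β γ) * (e (-𝔇.b γ δ) * F δ) =
        if δ = -β then Fintype.card D * F (-β) else 0 := by
      intro δ
      have h2 : ∑ γ, e (-𝔇.b β γ) * (e (-𝔇.b γ δ) * F δ) = (∑ γ, e (-𝔇.b γ (β + δ))) * F δ := by
        rw [Finset.sum_mul]
        refine Finset.sum_congr rfl fun γ _ => ?_
        rw [b_add_right, neg_add, e_add, 𝔇.b_comm β γ, mul_assoc]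
      rw [h2, sum_e_b]
      have h3 : β + δ = 0 ↔ δ = -β := by rw [add_comm, add_eq_zero_iff_eq_neg]
      simp only [h3]
      split_ifs with h
      · rw [h]
      · simp
    simp [this]
  have h4 : (𝔇.opS r * 𝔇.opS r) F β = (Complex.I ^ (-(r / 2)) / Real.sqrt (Fintype.card D)) *
      (Complex.I ^ (-(r / 2)) / Real.sqrt (Fintype.card D)) *
        ∑ γ, ∑ δ, e (-𝔇.b β γ) * (e (-𝔇.b γ δ) * F δ) := by
    simp only [Module.End.mul_apply, opS, LinearMap.coe_mk, AddHom.coe_mk, Finset.mul_sum]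
    refine Finset.sum_congr rfl fun γ _ => Finset.sum_congr rfl fun δ _ => by ring
  rw [h4, h1, ← sqrt_card_sq]
  have := sqrt_card_ne_zero (D := D)
  field_simp

theorem opS_pow_four (r : ℤ) : 𝔇.opS r ^ 4 = 1 := by
  have : 𝔇.opS r ^ 4 = (𝔇.opS r * 𝔇.opS r) * (𝔇.opS r * 𝔇.opS r) := by
    rw [← pow_two, ← pow_two, ← pow_mul]
  rw [this]
  ext1 F
  funext β
  rw [Module.End.mul_apply, opS_sq_apply, opS_sq_apply, neg_neg, Module.End.one_apply]
  have hI : Complex.I ^ (-(r / 2)) * Complex.I ^ (-(r / 2)) *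
      (Complex.I ^ (-(r / 2)) * Complex.I ^ (-(r / 2))) = 1 := by
    rw [← zpow_add₀ Complex.I_ne_zero, ← zpow_add₀ Complex.I_ne_zero,
      show -(r / 2) + -(r / 2) + (-(r / 2) + -(r / 2)) = 4 * (-(r / 2)) by ring, zpow_mul]
    have : Complex.I ^ (4 : ℤ) = 1 := by exact_mod_cast Complex.I_pow_four
    rw [this, one_zpow]
  rw [← mul_assoc, hI, one_mul]

theorem opS_rel {r : ℤ} (hr : 𝔇.HasSignature r) (hr2 : Even r) :
    𝔇.opS r * 𝔇.opT * 𝔇.opS r = 𝔇.opTInv * 𝔇.opS r * 𝔇.opTInv := by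
  ext1 F
  funext β
  set c : ℂ := Complex.I ^ (-(r / 2)) / Real.sqrt (Fintype.card D) with hc
  have hcG : c * ∑ γ : D, e (𝔇.q γ) = 1 := by
    obtain ⟨h, rfl⟩ := hr2
    have hh : (h + h) / 2 = h := by omega
    rw [hr, hc, hh]
    have h1 : Complex.I ^ (-h) * Complex.exp (2 * Real.pi * Complex.I * (((h + h : ℤ) : ℂ) / 8)) = 1 := by
      have : Complex.I = Complex.exp (Real.pi / 2 * Complex.I) := by
        rw [Complex.exp_pi_div_two_mul_I]
      conv_lhs => enter [1]; rw [this]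
      rw [← Complex.exp_int_mul, ← Complex.exp_add]
      convert Complex.exp_zero using 2
      push_cast; ring
    have := sqrt_card_ne_zero (D := D)
    rw [div_mul_eq_mul_div, div_eq_one_iff_eq this]
    linear_combination (Real.sqrt (Fintype.card D) : ℂ) * h1
  have hL : (𝔇.opS r * 𝔇.opT * 𝔇.opS r) F β =
      c * ∑ δ, (c * ∑ γ, e (-𝔇.b β γ) * e (𝔇.q γ) * e (-𝔇.b γ δ)) * F δ := by
    simp only [Module.End.mul_apply, opS, opT, LinearMap.coe_mk, AddHom.coe_mk, ← hc]
    congr 1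
    simp only [Finset.mul_sum, Finset.sum_mul]
    rw [Finset.sum_comm]
    refine Finset.sum_congr rfl fun γ _ => Finset.sum_congr rfl fun δ _ => by ring
  have hR : (𝔇.opTInv * 𝔇.opS r * 𝔇.opTInv) F β =
      c * ∑ δ, (e (-𝔇.q β) * e (-𝔇.b β δ) * e (-𝔇.q δ)) * F δ := by
    simp only [Module.End.mul_apply, opS, opTInv, LinearMap.coe_mk, AddHom.coe_mk, ← hc]
    simp only [Finset.mul_sum]
    refine Finset.sum_congr rfl fun γ _ => by ring
  rw [hL, hR]
  congr 1
  refine Finset.sum_congr rfl fun δ _ => ?_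
  congr 1
  have key : ∑ γ, e (-𝔇.b β γ) * e (𝔇.q γ) * e (-𝔇.b γ δ) =
      (∑ γ, e (𝔇.q γ)) * (e (-𝔇.q β) * e (-𝔇.b β δ) * e (-𝔇.q δ)) := by
    rw [← Equiv.sum_comp (Equiv.addRight (β + δ)), Finset.sum_mul]
    refine Finset.sum_congr rfl fun γ _ => ?_
    simp only [← e_add, Equiv.coe_addRight]
    congr 1
    have hbb : ∀ x, 𝔇.b x x = 𝔇.q x + 𝔇.q x := by
      intro x
      have := QuadraticMap.polar_self 𝔇.q x
      rw [two_smul] at this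
      exact this
    simp only [q_add, b_add_left, b_add_right, hbb, 𝔇.b_comm β γ]
    abel
  rw [key, ← mul_assoc, hcG, one_mul]

/-- The operator of `S` as an invertible operator. -/
noncomputable def unitS (r : ℤ) : (Module.End ℂ (D → ℂ))ˣ where
  val := 𝔇.opS r
  inv := 𝔇.opS r ^ 3
  val_inv := by rw [← pow_succ', opS_pow_four]
  inv_val := by rw [← pow_succ, opS_pow_four]

/-- The operator of `T` as an invertible operator. -/
noncomputable def unitT : (Module.End ℂ (D → ℂ))ˣ where
  val := 𝔇.opT
  inv := 𝔇.opTInv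
  val_inv := 𝔇.opT_mul_inv
  inv_val := 𝔇.opT_inv_mul

/-- The Weil representation of `SL₂(ℤ)` on `ℂ[D]`, realized as the space of functions `D → ℂ` with
standard basis `e_γ = Pi.single γ 1`. It is the representation with the values at the generators `S`
and `T` computed in `weilRep_S` and `weilRep_T`. -/
noncomputable def weilRep {r : ℤ} (hr : 𝔇.HasSignature r) (hr2 : Even r) :
    Representation ℂ SL(2, ℤ) (D → ℂ) :=
  (Units.coeHom _).comp (homOfRel (𝔇.unitS r) 𝔇.unitT (Units.ext (𝔇.opS_rel hr hr2))
    (Units.ext (𝔇.opS_pow_four r)))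

open Classical in
theorem weilRep_T {r : ℤ} (hr : 𝔇.HasSignature r) (hr2 : Even r) (γ : D) :
    𝔇.weilRep hr hr2 T (Pi.single γ 1) = e (𝔇.q γ) • Pi.single γ 1 := by
  have : 𝔇.weilRep hr hr2 T = 𝔇.opT := by simp [weilRep, homOfRel_T, unitT]
  rw [this]
  funext β
  rcases eq_or_ne β γ with rfl | h <;> simp_all [opT]

open Classical in
theorem weilRep_S {r : ℤ} (hr : 𝔇.HasSignature r) (hr2 : Even r) (γ : D) :
    𝔇.weilRep hr hr2 S (Pi.single γ 1) =
      (Complex.I ^ (-(r / 2)) / (Real.sqrt (Fintype.card D) : ℂ)) •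
        ∑ β, e (-𝔇.b β γ) • (Pi.single β 1 : D → ℂ) := by
  have : 𝔇.weilRep hr hr2 S = 𝔇.opS r := by simp [weilRep, homOfRel_S, unitS]
  rw [this]
  funext β
  simp [opS, Pi.single_apply]

end DiscriminantForm

end DiscriminantForms

section JordanComponents

/-- The possible types of the `2`-part: trivial, `2^{+2}_t`, or `2^{+1}_{t₁} ⊕ 4^{δ₂}_{t₂}`, where
`δ₂ = (2 / t₂)` is determined by `t₂`. -/
inductive TwoPart where
  | triv : TwoPart
  | twoTwo (t : ℤ) : TwoPart
  | twoFour (t₁ t₂ : ℤ) : TwoPart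

namespace DiscriminantForm

variable {D : Type*} [AddCommGroup D] (𝔇 : DiscriminantForm D)

/-- The `p`-component of `D` is `p^δ`: it is cyclic of order `p` with a generator `γ` such that
`q(γ) = a / p` with `(2a / p) = δ`. -/
def IsOddJordan (p : ℕ) (δ : ℤ) : Prop :=
  (δ = 1 ∨ δ = -1) ∧ ∃ γ : D, AddSubgroup.zmultiples γ = AddCommGroup.primaryComponent D p ∧
    addOrderOf γ = p ∧ ∃ a : ℤ, 𝔇.q γ = ((a / p : ℚ) : AddCircle (1 : ℚ)) ∧
      jacobiSym (2 * a) p = δ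

/-- The `2`-component of `D` is the orthogonal direct sum of the cyclic groups of order `q₁` and `q₂`
generated by elements with `q(γ₁) = t₁ / (2 q₁)` and `q(γ₂) = t₂ / (2 q₂)`. -/
def IsTwoJordanSum (q₁ : ℕ) (t₁ : ℤ) (q₂ : ℕ) (t₂ : ℤ) : Prop :=
  ∃ γ₁ γ₂ : D, addOrderOf γ₁ = q₁ ∧ addOrderOf γ₂ = q₂ ∧
    𝔇.q γ₁ = ((t₁ / (2 * q₁) : ℚ) : AddCircle (1 : ℚ)) ∧
    𝔇.q γ₂ = ((t₂ / (2 * q₂) : ℚ) : AddCircle (1 : ℚ)) ∧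
    𝔇.b γ₁ γ₂ = 0 ∧
    AddSubgroup.zmultiples γ₁ ⊓ AddSubgroup.zmultiples γ₂ = ⊥ ∧
    AddSubgroup.zmultiples γ₁ ⊔ AddSubgroup.zmultiples γ₂ = AddCommGroup.primaryComponent D 2

/-- The `2`-component of `D` is of the given type. The symbol `2^{+2}_t` denotes the sums of
`2^{±1}_{t₁}` and `2^{±1}_{t₂}` with `t₁ + t₂ = t` modulo `8` and `(2 / t₁) (2 / t₂) = 1`. -/
def IsTwoJordan : TwoPart → Prop
  | .triv => AddCommGroup.primaryComponent D 2 = ⊥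
  | .twoTwo t => (t = 2 ∨ t = -2) ∧ ∃ t₁ t₂ : ℤ, Odd t₁ ∧ Odd t₂ ∧ t₁ + t₂ ≡ t [ZMOD 8] ∧
      ZMod.χ₈ t₁ * ZMod.χ₈ t₂ = 1 ∧ 𝔇.IsTwoJordanSum 2 t₁ 2 t₂
  | .twoFour t₁ t₂ => (t₁ = 1 ∨ t₁ = -1) ∧ (t₂ = 1 ∨ t₂ = -1 ∨ t₂ = 3 ∨ t₂ = -3) ∧
      𝔇.IsTwoJordanSum 2 t₁ 4 t₂

/-- `D` is the orthogonal sum of its `p`-components, each of which, for odd `p`, is trivial or of the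
form `p^{δ p}`, and whose `2`-component is of the type `two`. -/
def HasJordanType (δ : ℕ → ℤ) (two : TwoPart) : Prop :=
  (∀ p : ℕ, p.Prime → p ≠ 2 →
    AddCommGroup.primaryComponent D p = ⊥ ∨ 𝔇.IsOddJordan p (δ p)) ∧ 𝔇.IsTwoJordan two

end DiscriminantForm

/-- The character `χ₂`: it is `1`, `(-4 / ·)` or `(-2a / ·)` with `a = (-1 / (t₁ t₂))`. -/
def TwoPart.chi : TwoPart → ℤ → ℤ
  | .triv, _ => 1
  | .twoTwo _, n => ZMod.χ₄ n
  | .twoFour t₁ t₂, n => if ZMod.χ₄ ((t₁ * t₂ : ℤ) : ZMod 4) = 1 then ZMod.χ₈' n else ZMod.χ₈ n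

/-- The `p`-component `χ_p` of the character `χ_D`, for a prime `p ∣ N`. -/
def chiAt (two : TwoPart) (p : ℕ) (n : ℤ) : ℤ :=
  if p = 2 then two.chi n else jacobiSym n p

/-- The character `χ = ∏ χ_p` modulo `N` with components `χ_p`, for the primes `p ∣ N`. -/
def prodChi (χp : ℕ → ℤ → ℤ) (N : ℕ) (n : ℤ) : ℤ := ∏ p ∈ N.primeFactors, χp p n

/-- The sign vector `ε` attached to `D`. -/
def eps (δ : ℕ → ℤ) (two : TwoPart) (N p : ℕ) : ℤ :=
  if p = 2 then
    match two with
    | .triv => 1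
    | .twoTwo t => two.chi (N * t / 8)
    | .twoFour _ t₂ => two.chi (t₂ * N / 8)
  else chiAt two p (2 * N / p) * δ p

end JordanComponents

section ModularForms

open UpperHalfPlane
open scoped ModularForm Manifold

/-- The slash operator of `GL₂⁺(ℝ)` with the normalization `det ^ (k / 2)`. On `SL₂(ℤ)` it is the slash
operator `f ∣[k] M` of Mathlib. -/
noncomputable def slashGL (k : ℤ) (f : ℍ → ℂ) (g : GL (Fin 2) ℝ) : ℍ → ℂ := fun τ =>
  ((g.det.val ^ ((k : ℝ) / 2) : ℝ) : ℂ) * denom g τ ^ (-k) * f (g • τ)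

/-- The matrix `W(N)` with rows `(0, -1)` and `(N, 0)`. -/
noncomputable def matW (N : ℕ) [NeZero N] : GL (Fin 2) ℝ :=
  Matrix.GeneralLinearGroup.mkOfDetNeZero !![0, -1; (N : ℝ), 0] (by
    simp [Matrix.det_fin_two, NeZero.ne N])

/-- `g = ∑ a(n) q ^ (n / h)`, with at most finitely many negative powers. -/
def HasQExp (h : ℕ) (g : ℍ → ℂ) (a : ℤ → ℂ) : Prop :=
  (∃ m : ℤ, ∀ n < m, a n = 0) ∧
    ∀ τ : ℍ, HasSum (fun n : ℤ => a n * Complex.exp (2 * Real.pi * Complex.I * (n / h) * τ)) (g τ)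

theorem HasQExp.zero (h : ℕ) : HasQExp h 0 0 :=
  ⟨⟨0, fun _ _ => rfl⟩, fun τ => by simp⟩

theorem HasQExp.add {h : ℕ} {f g : ℍ → ℂ} {a b : ℤ → ℂ} (hf : HasQExp h f a) (hg : HasQExp h g b) :
    HasQExp h (f + g) (a + b) := by
  obtain ⟨⟨m, hm⟩, hf⟩ := hf
  obtain ⟨⟨n, hn⟩, hg⟩ := hg
  refine ⟨⟨min m n, fun i hi => ?_⟩, fun τ => ?_⟩
  · simp [hm i (lt_of_lt_of_le hi (min_le_left _ _)), hn i (lt_of_lt_of_le hi (min_le_right _ _))]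
  · simpa [add_mul] using (hf τ).add (hg τ)

theorem HasQExp.smul {h : ℕ} {f : ℍ → ℂ} {a : ℤ → ℂ} (c : ℂ) (hf : HasQExp h f a) :
    HasQExp h (c • f) (c • a) := by
  obtain ⟨⟨m, hm⟩, hf⟩ := hf
  refine ⟨⟨m, fun i hi => by simp [hm i hi]⟩, fun τ => ?_⟩
  simpa [mul_assoc] using (hf τ).mul_left c

/-- The space `A(N, k, χ)` of weakly holomorphic modular forms, for a character `χ` modulo `N`. The
width of every cusp divides `N`, so that meromorphy at the cusps is the existence of an expansion in
powers of `q ^ (1 / N)` for all `f ∣[k] M`. -/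
def weakForms (N : ℕ) (k : ℤ) (χ : ℤ → ℤ) : Submodule ℂ (ℍ → ℂ) where
  carrier := {f | MDiff f ∧
    (∀ M ∈ CongruenceSubgroup.Gamma0 N, f ∣[k] M = (χ (M 1 1) : ℂ) • f) ∧
    ∀ M : SL(2, ℤ), ∃ a, HasQExp N (f ∣[k] M) a}
  zero_mem' := ⟨mdifferentiable_const, fun M _ => by simp, fun M => ⟨0, by
    simpa using HasQExp.zero N⟩⟩
  add_mem' := by
    rintro f g ⟨hf, hf', hf''⟩ ⟨hg, hg', hg''⟩
    refine ⟨hf.add hg, fun M hM => by rw [SlashAction.add_slash, hf' M hM, hg' M hM, smul_add],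
      fun M => ?_⟩
    obtain ⟨a, ha⟩ := hf'' M
    obtain ⟨b, hb⟩ := hg'' M
    exact ⟨a + b, by rw [SlashAction.add_slash]; exact ha.add hb⟩
  smul_mem' := by
    rintro c f ⟨hf, hf', hf''⟩
    refine ⟨hf.const_smul c, fun M hM => by
      rw [ModularForm.SL_smul_slash, hf' M hM, smul_comm], fun M => ?_⟩
    obtain ⟨a, ha⟩ := hf'' M
    exact ⟨c • a, by rw [ModularForm.SL_smul_slash]; exact ha.smul c⟩

/-- The subspace of the forms `f = ∑ a(n) q ^ n` in `A(N, k, χ)` with `a(n) = 0` whenever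
`χ_p(n) = -ε_p` for some prime `p ∣ N`. Here `χ = ∏ χ_p`. -/
def epsForms (N : ℕ) (k : ℤ) (χp : ℕ → ℤ → ℤ) (ε : ℕ → ℤ) : Submodule ℂ (ℍ → ℂ) where
  carrier := {f | f ∈ weakForms N k (prodChi χp N) ∧
    ∃ a, HasQExp 1 f a ∧ ∀ p ∈ N.primeFactors, ∀ n : ℤ, χp p n = -ε p → a n = 0}
  zero_mem' := ⟨zero_mem _, 0, HasQExp.zero 1, fun _ _ _ _ => rfl⟩
  add_mem' := by
    rintro f g ⟨hf, a, ha, ha'⟩ ⟨hg, b, hb, hb'⟩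
    exact ⟨add_mem hf hg, a + b, ha.add hb, fun p hp n h => by simp [ha' p hp n h, hb' p hp n h]⟩
  smul_mem' := by
    rintro c f ⟨hf, a, ha, ha'⟩
    exact ⟨Submodule.smul_mem _ c hf, c • a, ha.smul c, fun p hp n h => by simp [ha' p hp n h]⟩

variable {D : Type*} [AddCommGroup D] [Fintype D] (𝔇 : DiscriminantForm D)

/-- The space `𝒜(k, ρ)` of weakly holomorphic vector-valued modular forms for a representation `ρ` on
`ℂ[D]`; `F τ γ` is the component `F_γ(τ)`. For `ρ` the Weil representation, `F_γ` is invariant under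
`τ ↦ τ + N`, with `N` the level, so that its expansion is in powers of `q ^ (1 / N)`. -/
def vvForms (k : ℤ) (ρ : Representation ℂ SL(2, ℤ) (D → ℂ)) : Submodule ℂ (ℍ → D → ℂ) where
  carrier := {F | (∀ (M : SL(2, ℤ)) (τ : ℍ), (fun γ => ((fun z => F z γ) ∣[k] M) τ) = ρ M (F τ)) ∧
    ∀ γ, MDiff (fun z => F z γ) ∧ ∃ a, HasQExp 𝔇.level (fun z => F z γ) a}
  zero_mem' := by
    refine ⟨fun M τ => ?_, fun γ => ⟨mdifferentiable_const, 0, HasQExp.zero _⟩⟩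
    funext γ
    have : ((fun _ => 0 : ℍ → ℂ) ∣[k] M) = 0 := SlashAction.zero_slash k M
    simp [this]
  add_mem' := by
    rintro F G ⟨hF, hF'⟩ ⟨hG, hG'⟩
    refine ⟨fun M τ => ?_, fun γ => ⟨(hF' γ).1.add (hG' γ).1, ?_⟩⟩
    · rw [Pi.add_apply, map_add, ← hF, ← hG]
      funext γ
      exact congrFun (SlashAction.add_slash k M (fun z => F z γ) (fun z => G z γ)) τ
    · obtain ⟨a, ha⟩ := (hF' γ).2
      obtain ⟨b, hb⟩ := (hG' γ).2
      exact ⟨a + b, ha.add hb⟩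
  smul_mem' := by
    rintro c F ⟨hF, hF'⟩
    refine ⟨fun M τ => ?_, fun γ => ⟨(hF' γ).1.const_smul c, ?_⟩⟩
    · rw [Pi.smul_apply, map_smul, ← hF]
      funext γ
      exact congrFun (ModularForm.SL_smul_slash k M (fun z => F z γ) c) τ
    · obtain ⟨a, ha⟩ := (hF' γ).2
      exact ⟨c • a, ha.smul c⟩

/-- The subspace of the forms in `𝒜(k, ρ)` that are invariant under `Aut(D)`. -/
def vvFormsInv (k : ℤ) (ρ : Representation ℂ SL(2, ℤ) (D → ℂ)) : Submodule ℂ (ℍ → D → ℂ) where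
  carrier := {F | F ∈ vvForms 𝔇 k ρ ∧
    ∀ σ : D ≃+ D, 𝔇.IsAut σ → ∀ (τ : ℍ) (γ : D), F τ (σ γ) = F τ γ}
  zero_mem' := ⟨zero_mem _, fun _ _ _ _ => rfl⟩
  add_mem' := by
    rintro F G ⟨hF, hF'⟩ ⟨hG, hG'⟩
    exact ⟨add_mem hF hG, fun σ hσ τ γ => by simp [hF' σ hσ τ γ, hG' σ hσ τ γ]⟩
  smul_mem' := by
    rintro c F ⟨hF, hF'⟩
    exact ⟨Submodule.smul_mem _ c hF, fun σ hσ τ γ => by simp [hF' σ hσ τ γ]⟩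

/-- `φ(F) = i ^ (r / 2) 2 ^ (-ω(N)) N ^ (-(k - 1) / 2) F₀ | W(N)`. -/
noncomputable def phi (N : ℕ) [NeZero N] (r k : ℤ) (F : ℍ → D → ℂ) : ℍ → ℂ :=
  (Complex.I ^ (r / 2) * 2 ^ (-(N.primeFactors.card : ℤ)) *
    (((N : ℝ) ^ (-(((k : ℝ) - 1) / 2)) : ℝ) : ℂ)) • slashGL k (fun z => F z 0) (matW N)

open Classical in
/-- `ψ(f) = i ^ (r / 2) N ^ ((k - 1) / 2) ∑ (f | W(N) | M) ρ(M⁻¹) e₀`, the sum over a system `R` of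
representatives `M` of `Γ₀(N) \ SL₂(ℤ)`. -/
noncomputable def psi (N : ℕ) [NeZero N] (r k : ℤ) (ρ : Representation ℂ SL(2, ℤ) (D → ℂ))
    (R : Finset SL(2, ℤ)) (f : ℍ → ℂ) : ℍ → D → ℂ := fun τ =>
  (Complex.I ^ (r / 2) * (((N : ℝ) ^ (((k : ℝ) - 1) / 2) : ℝ) : ℂ)) •
    ∑ M ∈ R, (slashGL k f (matW N) ∣[k] M) τ • ρ M⁻¹ (Pi.single 0 1)

/-- `s(n) = 2 ^ ω((n, N))`. -/
def sCoeff (N : ℕ) (n : ℤ) : ℕ := 2 ^ (Int.gcd n N).primeFactors.card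

end ModularForms

end WeilForms

open WeilForms UpperHalfPlane
open scoped MatrixGroups

/-! The statement is local. For a prime p dividing |D|, the p-component of D carries a quadratic
form Q with values in ℤ/n, where n is p, 4 or 8. The number of x with Q(x) = m is 1 + ηχ(m), with η
a sign and χ a primitive quadratic character modulo n, and elements of equal norm are conjugate
under isometries. These facts are collected in `LocalForm`; the global argument uses nothing else
about the components. The level N is the product of the moduli n.

Injectivity and the explicit formula. Since F₀|S = (ρ(S)F)₀ is a multiple of ∑ F_γ, and W(N) acts as
τ ↦ Nτ followed by S, one finds φ(F)(τ) = 2^(-ω(N)) ∑ F_γ(Nτ) (`phi_apply`). The coefficient of φ(F)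
at n vanishes if χ_p(n) = -ε_p, because then no element of D has norm n/N. By invariance F_γ depends
only on q(γ), and a norm n/N that occurs is taken 2^ω(N) / s(n) times (`sCoeff_mul_card`). So the
part of φ(F) with exponents in one residue class modulo N determines F_γ (`hasSum_component`).

Surjectivity follows from φψ = 1 (`phi_psi`). The vector ρ(A⁻¹)e₀ is a product of explicit local
vectors that depend only on the bottom row (c, d) of A modulo the n (`weilRep_inv_single`). The sum
of the entries of a local vector is [d = 0] s χ(c) + χ(d), with s the local Gauss sum (`sum_vec`).
The summands of φψ(f) do not change when a row is scaled by units, so the sum over cosets can be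
replaced by one over all primitive rows and evaluated one prime at a time. Write Z(c, d) for
f|W(N)|A as a function of the row at one prime. Up to the number of units modulo n, the rows with d
= 0 contribute s Z(1, 0) and the rows with d a unit contribute ∑ Z(j, 1).

The heart of the proof is the relation ∑ Z(j, 1) = s Z(1, 0) (`sum_row_eq`), in which the condition
defined by ε enters. As f|W(N)|S is a multiple of f(τ/N), the vanishing of the coefficients in one
class m with χ(m) = -η reads ∑ e(-jm/n) Z(1, j) = 0. Moving this by S and by powers of T, averaging,
and evaluating a Gauss sum gives the relation. Each prime then contributes 2s, the product of the s
is the Gauss sum of D, and the constants cancel by the parity condition on k. -/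

namespace WeilForms

/-! ### Additive characters of ℤ/n -/

section AdditiveCharacter

/-- The embedding `j ↦ j / n` of `ℤ/n` into `ℚ/ℤ`. -/
noncomputable def toQZ (n : ℕ) [NeZero n] : ZMod n →+ AddCircle (1 : ℚ) :=
  ZMod.lift n ⟨(zmultiplesHom _) (((n : ℚ)⁻¹ : ℚ) : AddCircle (1 : ℚ)), by
    have hn : (n : ℚ) ≠ 0 := NeZero.ne _
    rw [zmultiplesHom_apply, natCast_zsmul, ← AddCircle.coe_nsmul, nsmul_eq_mul,
      mul_inv_cancel₀ hn]
    exact AddCircle.coe_period (1 : ℚ)⟩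

theorem toQZ_intCast (n : ℕ) [NeZero n] (m : ℤ) :
    toQZ n m = ((m / n : ℚ) : AddCircle (1 : ℚ)) := by
  rw [toQZ, ZMod.lift_coe]
  simp only [zmultiplesHom_apply]
  rw [← AddCircle.coe_zsmul, zsmul_eq_mul, div_eq_mul_inv]

theorem toQZ_injective (n : ℕ) [NeZero n] : Function.Injective (toQZ n) := by
  rw [injective_iff_map_eq_zero]
  intro a ha
  obtain ⟨m, rfl⟩ := ZMod.intCast_surjective a
  rw [toQZ_intCast, AddCircle.coe_eq_zero_iff] at ha
  obtain ⟨z, hz⟩ := ha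
  have hn : (n : ℚ) ≠ 0 := NeZero.ne _
  have : (m : ℚ) = z * n := by
    rw [zsmul_eq_mul, mul_one] at hz
    rw [hz]; field_simp
  have h2 : m = z * n := by exact_mod_cast this
  rw [h2]; simp

/-- The additive character `j ↦ exp (2 π i j / n)` of `ℤ/n`. -/
noncomputable def addPsi (n : ℕ) [NeZero n] : AddChar (ZMod n) ℂ where
  toFun j := e (toQZ n j)
  map_zero_eq_one' := by rw [map_zero, e_zero]
  map_add_eq_mul' x y := by rw [map_add, e_add]

theorem addPsi_apply (n : ℕ) [NeZero n] (j : ZMod n) : addPsi n j = e (toQZ n j) := rfl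

theorem addPsi_intCast (n : ℕ) [NeZero n] (m : ℤ) :
    addPsi n m = Complex.exp (2 * Real.pi * Complex.I * (m / n)) := by
  rw [addPsi_apply, toQZ_intCast, e_coe]
  push_cast
  rfl

theorem addPsi_eq_one {n : ℕ} [NeZero n] {j : ZMod n} (h : addPsi n j = 1) : j = 0 := by
  have := e_eq_one (x := toQZ n j) h
  rwa [map_eq_zero_iff _ (toQZ_injective n)] at this

theorem sum_addPsi_mul (n : ℕ) [NeZero n] (m : ZMod n) :
    ∑ j, addPsi n (j * m) = if m = 0 then (n : ℂ) else 0 := by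
  have hp : (addPsi n).IsPrimitive :=
    AddChar.zmod_char_primitive_of_eq_one_only_at_zero n _ fun a ha => addPsi_eq_one ha
  rw [AddChar.sum_mulShift m hp]
  simp

end AdditiveCharacter

/-! ### Local quadratic forms and their Gauss sums -/

/-- A quadratic form `Q` with values in `ℤ/n` on a finite abelian group, for a power `n` of a prime
`p`, whose representation numbers are `1 + η χ(m)` for a sign `η` and a primitive quadratic
character `χ`, and whose isometry group is transitive on the elements of given norm. -/
structure LocalForm (p n : ℕ) (M : Type*) [AddCommGroup M] [Fintype M] where
  prime : p.Prime
  eq_pow : ∃ k, n = p ^ (k + 1)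
  Q : M → ZMod n
  χ : MulChar (ZMod n) ℤ
  η : ℤ
  chi_unit : ∀ u, IsUnit u → χ u = 1 ∨ χ u = -1
  eta_eq : η = 1 ∨ η = -1
  polar_add : ∀ x y z, Q (x + (y + z)) - Q x - Q (y + z) =
    (Q (x + y) - Q x - Q y) + (Q (x + z) - Q x - Q z)
  map_neg : ∀ x, Q (-x) = Q x
  nondeg : ∀ x ≠ 0, ∃ y, Q (x + y) - Q x - Q y ≠ 0
  card_fiber : ∀ m, (Nat.card {x // Q x = m} : ℤ) = 1 + η * χ m
  primitive : ∀ j ≠ 0, ¬ IsUnit j → ∃ a, a * j * j = 0 ∧ χ (1 + a * j) = -1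
  exists_neg : ∃ m, χ m = -1
  exists_isometry : ∀ x y, Q x = Q y → ∃ σ : M ≃+ M, (∀ z, Q (σ z) = Q z) ∧ σ x = y

namespace LocalForm

variable {p n : ℕ} [NeZero n] {M : Type*} [AddCommGroup M] [Fintype M] (L : LocalForm p n M)

/-- The polar form of `Q`. -/
def B (x y : M) : ZMod n := L.Q (x + y) - L.Q x - L.Q y

theorem B_add_right (x y z : M) : L.B x (y + z) = L.B x y + L.B x z := L.polar_add x y z

theorem B_comm (x y : M) : L.B x y = L.B y x := by
  simp only [B, add_comm x y]; ring

theorem B_add_left (x y z : M) : L.B (x + y) z = L.B x z + L.B y z := by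
  rw [L.B_comm, B_add_right, L.B_comm z, L.B_comm z]

theorem Q_add (x y : M) : L.Q (x + y) = L.Q x + L.Q y + L.B x y := by
  simp only [B]; ring

theorem Q_zero : L.Q 0 = 0 := by
  have := L.polar_add 0 0 0
  simp only [add_zero] at this
  linear_combination this

theorem B_zero_right (x : M) : L.B x 0 = 0 := by
  simp [B, Q_zero]

theorem B_neg_right (x y : M) : L.B x (-y) = -L.B x y := by
  have := L.B_add_right x y (-y)
  rw [add_neg_cancel, B_zero_right] at this
  linear_combination -this

/-- Evenness of Q, applied to x + (-x) = 0, replaces the homogeneity axiom of a quadratic form;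
Q(mx) = m²Q(x) then follows by induction. -/
theorem B_self (x : M) : L.B x x = 2 * L.Q x := by
  have h := L.B_neg_right x x
  simp only [B, add_neg_cancel, Q_zero, L.map_neg] at h ⊢
  linear_combination h

theorem B_nsmul_right (x y : M) (m : ℕ) : L.B x (m • y) = m * L.B x y := by
  induction m with
  | zero => simp [B_zero_right]
  | succ m ih => rw [succ_nsmul, B_add_right, ih]; push_cast; ring

theorem Q_nsmul (x : M) (m : ℕ) : L.Q (m • x) = m ^ 2 * L.Q x := by
  induction m with
  | zero => simp [Q_zero]
  | succ m ih =>
    rw [succ_nsmul, Q_add, ih, L.B_comm, B_nsmul_right, B_self]; push_cast; ring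

open Classical in
theorem sum_psi_B (x : M) : ∑ y, addPsi n (L.B x y) = if x = 0 then (Fintype.card M : ℂ) else 0 := by
  split_ifs with hx
  · subst hx
    simp [L.B_comm 0, B_zero_right]
  · obtain ⟨y₀, h0⟩ := L.nondeg x hx
    have hne : addPsi n (L.B x y₀) ≠ 1 := fun h => h0 (addPsi_eq_one h)
    have hs : ∑ y, addPsi n (L.B x y) = addPsi n (L.B x y₀) * ∑ y, addPsi n (L.B x y) := by
      rw [Finset.mul_sum, ← Equiv.sum_comp (Equiv.addLeft y₀)]
      refine Finset.sum_congr rfl fun y _ => ?_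
      rw [Equiv.coe_addLeft, B_add_right, AddChar.map_add_eq_mul]
    by_contra h
    exact hne (mul_right_cancel₀ h (by rw [one_mul]; exact hs.symm))

/-- The Gauss sum of `Q`. -/
noncomputable def s : ℂ := ∑ x, addPsi n (L.Q x)

theorem chi_mul_self {u : ZMod n} (hu : IsUnit u) : (L.χ u : ℂ) * L.χ u = 1 := by
  rcases L.chi_unit u hu with h | h <;> simp [h]

theorem chi_nonunit {u : ZMod n} (hu : ¬ IsUnit u) : L.χ u = 0 := L.χ.map_nonunit hu

theorem chi_inv {u : ZMod n} (hu : IsUnit u) : L.χ u⁻¹ = L.χ u := by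
  have h := congrArg L.χ (ZMod.mul_inv_of_unit u hu)
  rw [map_mul, map_one] at h
  rcases L.chi_unit u hu with h' | h' <;> rw [h'] at h ⊢ <;> linarith

theorem isUnit_inv {u : ZMod n} (hu : IsUnit u) : IsUnit u⁻¹ :=
  IsUnit.of_mul_eq_one u (ZMod.inv_mul_of_unit u hu)

/-- Grouping by norm turns sums over M into character sums over ℤ/n, since the representation
numbers are 1 + ηχ. -/
theorem sum_fiber (g : ZMod n → ℂ) : ∑ x, g (L.Q x) = ∑ m, (1 + L.η * L.χ m : ℂ) * g m := by
  classical
  rw [← Finset.sum_fiberwise_of_maps_to (s := Finset.univ) (t := Finset.univ) (g := L.Q)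
    fun _ _ => Finset.mem_univ _]
  refine Finset.sum_congr rfl fun m _ => ?_
  have h1 : ∑ x with L.Q x = m, g (L.Q x) = ∑ x with L.Q x = m, g m :=
    Finset.sum_congr rfl fun x hx => by rw [(Finset.mem_filter.mp hx).2]
  have h2 := L.card_fiber m
  rw [Nat.card_eq_fintype_card, Fintype.card_subtype] at h2
  have h3 : ((Finset.univ.filter fun x => L.Q x = m).card : ℂ) = 1 + L.η * L.χ m := by
    exact_mod_cast h2
  rw [h1, Finset.sum_const, nsmul_eq_mul, h3]

theorem sum_chi : ∑ m, (L.χ m : ℂ) = 0 := by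
  obtain ⟨m, hm⟩ := L.exists_neg
  have hu : IsUnit m := by
    by_contra h
    rw [L.chi_nonunit h] at hm
    norm_num at hm
  have : ∑ j, (L.χ j : ℂ) = -∑ j, (L.χ j : ℂ) := by
    conv_lhs => rw [← Equiv.sum_comp hu.unit.mulLeft]
    rw [← Finset.sum_neg_distrib]
    refine Finset.sum_congr rfl fun j _ => ?_
    simp [map_mul, hm]
  linear_combination this / 2

/-- The representation numbers add up to n because χ is nontrivial and sums to zero. -/
theorem card_eq (L : LocalForm p n M) : (Fintype.card M : ℂ) = n := by
  have := L.sum_fiber fun _ => 1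
  simp only [mul_one, Finset.sum_add_distrib, ← Finset.mul_sum, L.sum_chi, mul_zero,
    Finset.sum_const, Finset.card_univ, nsmul_eq_mul, ZMod.card, add_zero] at this
  exact this

/-- The Gauss sum of `χ`. -/
noncomputable def g : ℂ := ∑ m, (L.χ m : ℂ) * addPsi n m

theorem sum_chi_psi_unit {u : ZMod n} (hu : IsUnit u) :
    ∑ m, (L.χ m : ℂ) * addPsi n (u * m) = L.χ u * L.g := by
  rw [g]
  conv_rhs => rw [← Equiv.sum_comp hu.unit.mulLeft, Finset.mul_sum]
  refine Finset.sum_congr rfl fun j _ => ?_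
  simp only [Units.mulLeft_apply, IsUnit.unit_spec, map_mul]
  push_cast
  linear_combination -(L.χ j : ℂ) * addPsi n (u * j) * L.chi_mul_self hu

/-- Primitivity provides a unit 1 + au that fixes u under multiplication and has χ(1 + au) = -1.
Substituting m ↦ (1 + au)m changes the sign of the sum. -/
theorem sum_chi_psi_nonunit {u : ZMod n} (hu : ¬ IsUnit u) :
    ∑ m, (L.χ m : ℂ) * addPsi n (u * m) = 0 := by
  by_cases h0 : u = 0
  · simp [h0, L.sum_chi]
  · obtain ⟨a, ha, hχ⟩ := L.primitive u h0 hu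
    have hl : IsUnit (1 + a * u) := by
      by_contra h
      rw [L.chi_nonunit h] at hχ
      norm_num at hχ
    have : ∑ m, (L.χ m : ℂ) * addPsi n (u * m) = -∑ m, (L.χ m : ℂ) * addPsi n (u * m) := by
      conv_lhs => rw [← Equiv.sum_comp hl.unit.mulLeft]
      rw [← Finset.sum_neg_distrib]
      refine Finset.sum_congr rfl fun j _ => ?_
      have : u * ((1 + a * u) * j) = u * j := by linear_combination j * ha
      simp only [Units.mulLeft_apply, IsUnit.unit_spec, map_mul, hχ, this]
      push_cast; ring
    linear_combination this / 2

theorem s_eq : L.s = L.η * L.g := by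
  have := L.sum_fiber (addPsi n)
  have h1 := sum_addPsi_mul n 1
  rw [s, this, g]
  simp only [add_mul, one_mul, Finset.sum_add_distrib, Finset.mul_sum, mul_assoc]
  simp only [mul_one] at h1
  have hne : (1 : ZMod n) ≠ 0 := by
    obtain ⟨k, hk⟩ := L.eq_pow
    have : 1 < n := hk ▸ Nat.one_lt_pow (by omega) L.prime.one_lt
    have : Fact (1 < n) := ⟨this⟩
    exact one_ne_zero
  rw [h1, if_neg hne, zero_add]

theorem sum_psi_mul_Q (u : ZMod n) :
    ∑ x, addPsi n (u * L.Q x) = (if u = 0 then (n : ℂ) else 0) + L.χ u * L.s := by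
  rw [L.sum_fiber fun m => addPsi n (u * m)]
  have h1 := sum_addPsi_mul n u
  simp only [add_mul, one_mul, Finset.sum_add_distrib, mul_assoc, ← Finset.mul_sum]
  simp only [mul_comm _ u] at h1
  rw [h1]
  congr 1
  by_cases hu : IsUnit u
  · rw [L.sum_chi_psi_unit hu, s_eq]; ring
  · rw [L.sum_chi_psi_nonunit hu, L.chi_nonunit hu]; simp

theorem one_lt (L : LocalForm p n M) : 1 < n := by
  obtain ⟨k, hk⟩ := L.eq_pow
  exact hk ▸ Nat.one_lt_pow (by omega) L.prime.one_lt

theorem ne_zero_of_isUnit (L : LocalForm p n M) {u : ZMod n} (hu : IsUnit u) : u ≠ 0 := by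
  have : Fact (1 < n) := ⟨L.one_lt⟩
  exact hu.ne_zero

theorem sum_psi_unit_mul_Q {u : ZMod n} (hu : IsUnit u) :
    ∑ x, addPsi n (u * L.Q x) = L.χ u * L.s := by
  rw [L.sum_psi_mul_Q, if_neg (L.ne_zero_of_isUnit hu), zero_add]

theorem isUnit_intCast (L : LocalForm p n M) (m : ℤ) : IsUnit (m : ZMod n) ↔ ¬ (p : ℤ) ∣ m := by
  obtain ⟨k, hk⟩ := L.eq_pow
  rw [ZMod.coe_int_isUnit_iff_isCoprime, hk]
  push_cast
  rw [IsCoprime.pow_left_iff (by omega), (Nat.prime_iff_prime_int.mp L.prime).coprime_iff_not_dvd]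

/-- As n is a power of a prime, ℤ/n is a local ring, whose nonunits form an ideal. -/
theorem isUnit_add (L : LocalForm p n M) {c d : ZMod n} (hc : ¬ IsUnit c) (hd : IsUnit d) : IsUnit (c + d) := by
  obtain ⟨c, rfl⟩ := ZMod.intCast_surjective c
  obtain ⟨d, rfl⟩ := ZMod.intCast_surjective d
  rw [L.isUnit_intCast, not_not] at hc
  rw [L.isUnit_intCast] at hd
  rw [← Int.cast_add, L.isUnit_intCast]
  exact fun h => hd ((dvd_add_right hc).mp h)

/-- Completing the square. -/
theorem sum_psi_complete {u : ZMod n} (hu : IsUnit u) (w : ZMod n) (y : M) :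
    ∑ x, addPsi n (u * L.Q x + u * w * L.B x y) = L.χ u * L.s * addPsi n (-(u * w ^ 2 * L.Q y)) := by
  rw [← L.sum_psi_unit_mul_Q hu, Finset.sum_mul,
    ← Equiv.sum_comp (Equiv.addRight (w.val • y)) fun x => addPsi n (u * L.Q x) * _]
  refine Finset.sum_congr rfl fun x _ => ?_
  rw [Equiv.coe_addRight, Q_add, Q_nsmul, B_nsmul_right, ZMod.natCast_zmod_val,
    ← AddChar.map_add_eq_mul]
  congr 1; ring

theorem isUnit_neg_one : IsUnit (-1 : ZMod n) := isUnit_one.neg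

/-- The sum for -Q equals χ(-1)s. Its product with s is n: after x ↦ x + y, the sum over y is an
orthogonality relation that retains only the zero element. -/
theorem s_mul_self : L.s * L.s = L.χ (-1) * n := by
  have h1 := L.sum_psi_unit_mul_Q (isUnit_neg_one (n := n))
  have h2 : L.s * ∑ x, addPsi n (-1 * L.Q x) = n := by
    classical
    rw [s, Finset.sum_mul_sum, Finset.sum_comm]
    have : ∀ y, ∑ x, addPsi n (L.Q x) * addPsi n (-1 * L.Q y) = ∑ z, addPsi n (L.Q z) * addPsi n (L.B z y) := by
      intro y
      rw [← Equiv.sum_comp (Equiv.addRight y)]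
      refine Finset.sum_congr rfl fun x _ => ?_
      rw [Equiv.coe_addRight, ← AddChar.map_add_eq_mul, ← AddChar.map_add_eq_mul, Q_add]
      congr 1; ring
    simp only [this]
    rw [Finset.sum_comm]
    simp only [← Finset.mul_sum, sum_psi_B]
    simp [Q_zero, L.card_eq]
  rw [h1] at h2
  linear_combination L.χ (-1) * h2 - L.s * L.s * L.chi_mul_self (isUnit_neg_one (n := n))

theorem n_ne_zero : (n : ℂ) ≠ 0 := by exact_mod_cast NeZero.ne n

theorem s_ne_zero : L.s ≠ 0 := by
  intro h
  have := L.s_mul_self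
  rw [h, zero_mul] at this
  have h1 := L.chi_mul_self (isUnit_neg_one (n := n))
  rcases mul_eq_zero.mp this.symm with h' | h'
  · rw [h'] at h1; simp at h1
  · exact n_ne_zero h'

/-! ### The local components of ρ(A⁻¹)e₀ -/

open Classical in
/-- The image of `e₀` under the inverse of a matrix with bottom row `(c, d)`. -/
noncomputable def vec (c d : ZMod n) (x : M) : ℂ :=
  if IsUnit c then L.s / n * L.χ c * addPsi n (-(d * c⁻¹ * L.Q x))
  else (n : ℂ)⁻¹ * L.χ d * ∑ z, addPsi n (c * d⁻¹ * L.Q z - L.B z x)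

/-- For a unit c this is an identity of exponents. Otherwise d and c + d are units; with u = c/d and
v = 1/(1 + u) one has c/(c + d) = 1 - v. The factor ψ(-vQ(z)) is expanded as a sum over y, and the
resulting sum over z is again a completed square. -/
theorem vec_T {c d : ZMod n} (h : IsUnit c ∨ IsUnit d) (x : M) :
    addPsi n (L.Q x) * L.vec c (c + d) x = L.vec c d x := by
  by_cases hc : IsUnit c
  · simp only [vec, if_pos hc]
    rw [mul_left_comm, ← AddChar.map_add_eq_mul]
    congr 2
    linear_combination -L.Q x * ZMod.mul_inv_of_unit c hc
  · have hd := h.resolve_left hc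
    have hcd := L.isUnit_add hc hd
    simp only [vec, if_neg hc]
    set u := c * d⁻¹ with hu
    have hdd := ZMod.mul_inv_of_unit d hd
    have e1 : 1 + u = (c + d) * d⁻¹ := by rw [hu]; linear_combination -hdd
    have hu1 : IsUnit (1 + u) := e1 ▸ hcd.mul (isUnit_inv hd)
    have hv := ZMod.mul_inv_of_unit _ hu1
    set v := (1 + u)⁻¹
    have hχ : L.χ (c + d) = L.χ (1 + u) * L.χ d := by
      rw [← map_mul, e1]
      congr 1
      linear_combination -(c + d) * hdd
    have e2 : c * (c + d)⁻¹ = 1 - v := by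
      have h3 := ZMod.mul_inv_of_unit _ hcd
      have : (1 + u) * (c * (c + d)⁻¹) = (1 + u) * (1 - v) := by
        rw [mul_sub, hv, hu]
        linear_combination (c * d⁻¹) * h3 - c * (c + d)⁻¹ * hdd
      exact hu1.mul_left_cancel this
    rw [e2, hχ]
    -- expand the second factor by completing the square
    have key : ∀ z, addPsi n (-(v * L.Q z)) * (L.χ (1 + u) * L.s) =
        ∑ y, addPsi n ((1 + u) * L.Q y - L.B y z) := by
      intro z
      have := L.sum_psi_complete hu1 (-v) z
      have h4 : (1 + u) * -v = -1 := by rw [mul_neg, hv]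
      have h5 : (1 + u) * (-v) ^ 2 = v := by linear_combination v * hv
      simp only [h4, h5, neg_mul, one_mul, ← sub_eq_add_neg] at this
      rw [this]; ring
    have h6 : addPsi n (L.Q x) * (∑ z, addPsi n ((1 - v) * L.Q z - L.B z x)) * (L.χ (1 + u) * L.s) =
        L.s * ∑ y, addPsi n (u * L.Q y - L.B y x) := by
      have : ∀ z, addPsi n (L.Q x) * addPsi n ((1 - v) * L.Q z - L.B z x) * (L.χ (1 + u) * L.s) =
          ∑ y, addPsi n (L.Q x + L.Q z - L.B z x + ((1 + u) * L.Q y - L.B y z)) := by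
        intro z
        simp only [AddChar.map_add_eq_mul _ (L.Q x + L.Q z - L.B z x)]
        rw [← Finset.mul_sum, ← key, ← mul_assoc (addPsi n _) (addPsi n _),
          ← AddChar.map_add_eq_mul, ← AddChar.map_add_eq_mul]
        congr 2; ring
      rw [Finset.mul_sum, Finset.sum_mul, Finset.sum_congr rfl fun z _ => this z, Finset.sum_comm,
        Finset.mul_sum]
      refine Finset.sum_congr rfl fun y _ => ?_
      have h7 := L.sum_psi_complete isUnit_one (-1) y
      have : ∀ z', L.Q x + L.Q (z' + x) - L.B (z' + x) x + ((1 + u) * L.Q y - L.B y (z' + x)) =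
          (1 * L.Q z' + 1 * -1 * L.B z' y) + ((1 + u) * L.Q y - L.B y x) := by
        intro z'
        rw [Q_add, B_add_left, B_self, B_add_right, L.B_comm y z']
        ring
      rw [← Equiv.sum_comp (Equiv.addRight x)]
      simp only [Equiv.coe_addRight, this, AddChar.map_add_eq_mul _ _ ((1 + u) * L.Q y - L.B y x)]
      rw [← Finset.sum_mul, h7, map_one, mul_assoc, ← AddChar.map_add_eq_mul]
      push_cast
      rw [one_mul]
      congr 2; ring
    apply mul_right_cancel₀ L.s_ne_zero
    push_cast
    linear_combination (n : ℂ)⁻¹ * L.χ d * h6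

theorem vec_neg {c d : ZMod n} (hc : IsUnit c) (x : M) :
    L.vec (-c) (-d) x = L.χ (-1) * L.vec c d x := by
  have h1 : (-c)⁻¹ = -c⁻¹ := hc.neg.mul_left_cancel <| by
    rw [ZMod.mul_inv_of_unit _ hc.neg, neg_mul_neg, ZMod.mul_inv_of_unit _ hc]
  simp only [vec, if_pos hc, if_pos hc.neg, h1]
  rw [← neg_one_mul c, map_mul]
  push_cast
  rw [neg_mul_neg]
  ring

/-- The left side is a Fourier transform. For c a nonunit it is the definition of `vec`; for c and d
units it is computed by completing the square; for d a nonunit it follows by Fourier inversion, with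
s² = χ(-1)n. -/
theorem vec_S {c d : ZMod n} (h : IsUnit c ∨ IsUnit d) (x : M) :
    ∑ z, addPsi n (-L.B x z) * L.vec d (-c) z = L.s * L.vec c d x := by
  have hn := n_ne_zero (n := n)
  have hS : ∀ {c d : ZMod n}, ¬ IsUnit c → IsUnit d → ∀ x,
      ∑ z, addPsi n (-L.B x z) * L.vec d (-c) z = L.s * L.vec c d x := by
    intro c d hc hd x
    simp only [vec, if_neg hc, if_pos hd, Finset.mul_sum]
    refine Finset.sum_congr rfl fun z _ => ?_
    have : c * d⁻¹ * L.Q z - L.B z x = -L.B x z + -(-c * d⁻¹ * L.Q z) := by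
      rw [L.B_comm x z]; ring
    rw [this, AddChar.map_add_eq_mul]
    ring
  by_cases hc : IsUnit c
  · by_cases hd : IsUnit d
    · have hdd := ZMod.mul_inv_of_unit d hd
      have hcc := ZMod.mul_inv_of_unit c hc
      simp only [vec, if_pos hc, if_pos hd]
      have h1 := L.sum_psi_complete (hc.mul (isUnit_inv hd)) (-(d * c⁻¹)) x
      have h2 : c * d⁻¹ * -(d * c⁻¹) = -1 := by
        linear_combination -c * c⁻¹ * hdd - hcc
      have h3 : c * d⁻¹ * (-(d * c⁻¹)) ^ 2 = d * c⁻¹ := by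
        linear_combination c * c⁻¹ ^ 2 * d * hdd + c⁻¹ * d * hcc
      rw [h2, h3] at h1
      have : ∀ z, addPsi n (-L.B x z) * (L.s / n * L.χ d * addPsi n (-(-c * d⁻¹ * L.Q z))) =
          L.s / n * L.χ d * addPsi n (c * d⁻¹ * L.Q z + -1 * L.B z x) := by
        intro z
        rw [AddChar.map_add_eq_mul, L.B_comm x z]
        ring_nf
      simp only [this, ← Finset.mul_sum, h1]
      rw [map_mul, L.chi_inv hd]
      push_cast
      linear_combination L.s * (L.s / n) * L.χ c * addPsi n (-(d * c⁻¹ * L.Q x)) * L.chi_mul_self hd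
    · -- apply the inverse transform to the case treated above
      classical
      have h1 : ∀ z, L.vec d (-c) z = L.s⁻¹ * (L.χ (-1) * ∑ y, addPsi n (-L.B z y) * L.vec c d y) := by
        intro z
        have := hS hd hc.neg z
        simp only [L.vec_neg hc] at this
        rw [eq_inv_mul_iff_mul_eq₀ L.s_ne_zero, ← this, Finset.mul_sum]
        exact Finset.sum_congr rfl fun y _ => by ring
      have h2 : ∑ z, addPsi n (-L.B x z) * (∑ y, addPsi n (-L.B z y) * L.vec c d y) =
          n * L.vec c d (-x) := by
        simp only [Finset.mul_sum]
        rw [Finset.sum_comm]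
        have : ∀ y, ∑ z, addPsi n (-L.B x z) * (addPsi n (-L.B z y) * L.vec c d y) =
            if y = -x then n * L.vec c d (-x) else 0 := by
          intro y
          have h3 : ∀ z, addPsi n (-L.B x z) * (addPsi n (-L.B z y) * L.vec c d y) =
              addPsi n (L.B (-(x + y)) z) * L.vec c d y := by
            intro z
            rw [← mul_assoc, ← AddChar.map_add_eq_mul, L.B_comm (-(x + y)) z,
              B_neg_right, B_add_right, L.B_comm x z]
            congr 2; ring
          simp only [h3, ← Finset.sum_mul, sum_psi_B, neg_eq_zero, L.card_eq]
          have h4 : x + y = 0 ↔ y = -x := by rw [add_comm, add_eq_zero_iff_eq_neg]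
          simp only [h4]
          split_ifs with h
          · rw [h]
          · simp
        simp [this]
      simp only [h1]
      have h5 : ∀ z, addPsi n (-L.B x z) * (L.s⁻¹ * (L.χ (-1) * ∑ y, addPsi n (-L.B z y) * L.vec c d y)) =
          L.s⁻¹ * L.χ (-1) * (addPsi n (-L.B x z) * ∑ y, addPsi n (-L.B z y) * L.vec c d y) := by
        intro z; ring
      simp only [h5, ← Finset.mul_sum, h2]
      have h6 : L.vec c d (-x) = L.vec c d x := by simp only [vec, if_pos hc, L.map_neg]
      rw [h6, mul_assoc, inv_mul_eq_iff_eq_mul₀ L.s_ne_zero]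
      linear_combination -L.vec c d x * L.s_mul_self
  · exact hS hc (h.resolve_left hc) x

theorem vec_smul {c d l : ZMod n} (hl : IsUnit l) (h : IsUnit c ∨ IsUnit d) (x : M) :
    L.vec (l * c) (l * d) x = L.χ l * L.vec c d x := by
  have hinv : ∀ c : ZMod n, IsUnit c → l * (l * c)⁻¹ = c⁻¹ := by
    intro c hc
    apply hc.mul_left_cancel
    rw [ZMod.mul_inv_of_unit c hc]
    linear_combination ZMod.mul_inv_of_unit _ (hl.mul hc)
  have hiff : IsUnit (l * c) ↔ IsUnit c := by
    rw [mul_comm, hl.mul_right_iff]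
  simp only [vec, hiff]
  split_ifs with hc
  · rw [map_mul, mul_assoc l d, mul_left_comm l d, hinv c hc]
    push_cast; ring
  · rw [map_mul, mul_assoc l c, mul_left_comm l c, hinv d (h.resolve_left hc)]
    push_cast; ring

open Classical in
theorem vec_zero_left {d : ZMod n} (x : M) :
    L.vec 0 d x = if x = 0 then (L.χ d : ℂ) else 0 := by
  have h0 : ¬ IsUnit (0 : ZMod n) := fun h => L.ne_zero_of_isUnit h rfl
  have : ∀ z, (0 : ZMod n) * d⁻¹ * L.Q z - L.B z x = L.B (-x) z := by
    intro z
    rw [L.B_comm (-x), B_neg_right]; ring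
  simp only [vec, if_neg h0, this, sum_psi_B, neg_eq_zero, L.card_eq]
  have := n_ne_zero (n := n)
  split_ifs
  · field_simp
  · simp

/-- These are the weights with which the functions f|W(N)|A enter φψ(f). For a unit c the sum is a
Gauss sum with multiplier -d/c, whose degenerate value n at d = 0 gives the first term; for a
nonunit c orthogonality leaves z = 0. -/
theorem sum_vec {c d : ZMod n} (h : IsUnit c ∨ IsUnit d) :
    ∑ x, L.vec c d x = (if d = 0 then L.s * L.χ c else 0) + L.χ d := by
  classical
  have hn := n_ne_zero (n := n)
  by_cases hc : IsUnit c
  · simp only [vec, if_pos hc, ← Finset.mul_sum]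
    have h1 := L.sum_psi_mul_Q (-(d * c⁻¹))
    simp only [neg_mul] at h1
    have h2 : -(d * c⁻¹) = 0 ↔ d = 0 := by
      rw [neg_eq_zero]
      refine ⟨fun h => ?_, fun h => by rw [h, zero_mul]⟩
      have := ZMod.mul_inv_of_unit c hc
      linear_combination c * h - d * this
    have h3 : L.χ (-(d * c⁻¹)) = L.χ (-1) * L.χ d * L.χ c := by
      rw [← L.chi_inv hc, ← map_mul, ← map_mul]; congr 1; ring
    rw [h1, h3]
    simp only [h2]
    push_cast
    have h4 : L.s / n * L.χ c * (L.χ (-1) * L.χ d * L.χ c * L.s) = L.χ d := by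
      have := L.chi_mul_self (isUnit_neg_one (n := n))
      field_simp
      linear_combination (L.χ c : ℂ) ^ 2 * L.χ (-1) * L.χ d * L.s_mul_self +
        n * L.χ d * L.χ (-1) ^ 2 * L.chi_mul_self hc + n * L.χ d * this
    rw [mul_add, h4]
    split_ifs
    · field_simp
    · simp
  · have hd := h.resolve_left hc
    simp only [vec, if_neg hc, if_neg (L.ne_zero_of_isUnit hd), zero_add, ← Finset.mul_sum]
    rw [Finset.sum_comm]
    have : ∀ z, ∑ x, addPsi n (c * d⁻¹ * L.Q z - L.B z x) = if z = 0 then (n : ℂ) else 0 := by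
      intro z
      have h1 : ∀ x, c * d⁻¹ * L.Q z - L.B z x = c * d⁻¹ * L.Q z + L.B (-z) x := by
        intro x; rw [L.B_comm (-z), B_neg_right, L.B_comm z]; ring
      simp only [h1, AddChar.map_add_eq_mul, ← Finset.mul_sum, sum_psi_B, neg_eq_zero, L.card_eq]
      split_ifs with h
      · simp [h, Q_zero]
      · simp
    simp only [this, Finset.sum_ite_eq', Finset.mem_univ, if_true]
    field_simp

end LocalForm

end WeilForms

/-! ### The linear relation at one prime -/

namespace WeilForms.LocalForm

variable {p n : ℕ} [NeZero n] {M : Type*} [AddCommGroup M] [Fintype M] (L : LocalForm p n M)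
  {V : Type*} [AddCommGroup V] [Module ℂ V]

/-- For a unit j, (j, ij - 1) = j(1, i - 1/j), and i - 1/j runs through all classes. For a nonzero
nonunit j, shifting i by the a of primitivity amounts to scaling the row by a unit of character -1,
so the sum is its own negative. For j = 0 all n terms agree. -/
theorem sum_orbit_eq (Z : ZMod n → ZMod n → V)
    (hl : ∀ l c d, IsUnit l → (IsUnit c ∨ IsUnit d) → Z (l * c) (l * d) = (L.χ l : ℂ) • Z c d)
    (j : ZMod n) : ∑ i, Z j (i * j - 1) =
      (L.χ j : ℂ) • ∑ i, Z 1 i + if j = 0 then (n : ℂ) • Z 0 (-1) else 0 := by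
  by_cases hj : IsUnit j
  · rw [if_neg (L.ne_zero_of_isUnit hj), add_zero, Finset.smul_sum,
      ← Equiv.sum_comp (Equiv.subRight j⁻¹) fun i => (L.χ j : ℂ) • Z 1 i]
    refine Finset.sum_congr rfl fun i _ => ?_
    rw [Equiv.subRight_apply, ← hl j _ _ hj (Or.inl isUnit_one), mul_one, mul_sub,
      ZMod.mul_inv_of_unit _ hj, mul_comm]
  · rw [L.chi_nonunit hj, Int.cast_zero, zero_smul, zero_add]
    split_ifs with h0
    · subst h0
      simp [← Nat.cast_smul_eq_nsmul ℂ]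
    · obtain ⟨a, ha, hχ⟩ := L.primitive j h0 hj
      have hu : IsUnit (1 + a * j) := by
        by_contra h
        rw [L.chi_nonunit h] at hχ
        norm_num at hχ
      have : ∑ i, Z j (i * j - 1) = -∑ i, Z j (i * j - 1) := by
        conv_rhs => rw [← Equiv.sum_comp (Equiv.addLeft a)]
        rw [← Finset.sum_neg_distrib]
        refine Finset.sum_congr rfl fun i _ => ?_
        have hp : IsUnit j ∨ IsUnit ((a + i) * j - 1) := by
          refine Or.inr ?_
          have h1 : ¬ IsUnit ((a + i) * j) := fun h => hj (isUnit_of_mul_isUnit_right h)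
          rw [sub_eq_add_neg]
          exact L.isUnit_add h1 isUnit_neg_one
        have h2 := hl (1 + a * j) j ((a + i) * j - 1) hu hp
        rw [hχ, show (1 + a * j) * j = j by linear_combination ha,
          show (1 + a * j) * ((a + i) * j - 1) = i * j - 1 by linear_combination (a + i) * ha] at h2
        rw [h2]
        simp
      have h2 : (2 : ℂ) • ∑ i, Z j (i * j - 1) = 0 := by
        rw [two_smul]; exact add_eq_zero_iff_eq_neg.mpr this
      exact (smul_eq_zero.mp h2).resolve_left two_ne_zero

/-- Here σ and τ model the actions of S and T on rows. One vanishing Fourier component in the class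
m is carried around by them, and averaging leaves a relation with only the two sums in question. -/
theorem sum_row_eq (Z : ZMod n → ZMod n → V) (σ τ : V →ₗ[ℂ] V)
    (hσ : ∀ c d, (IsUnit c ∨ IsUnit d) → Z d (-c) = σ (Z c d))
    (hτ : ∀ c d, (IsUnit c ∨ IsUnit d) → Z c (c + d) = τ (Z c d))
    (hl : ∀ l c d, IsUnit l → (IsUnit c ∨ IsUnit d) → Z (l * c) (l * d) = (L.χ l : ℂ) • Z c d)
    {m : ZMod n} (hm : L.χ m = -L.η) (h0 : ∑ j, addPsi n (-(j * m)) • Z 1 j = 0) :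
    ∑ j, Z j 1 = L.s • Z 1 0 := by
  have hn := n_ne_zero (n := n)
  have hc := L.chi_mul_self (isUnit_neg_one (n := n))
  -- σ takes the row (1, j) to (j, -1).
  have h1 : ∑ j, addPsi n (-(j * m)) • Z j (-1) = 0 := by
    have := congrArg σ h0
    rw [map_sum, map_zero] at this
    rw [← this]
    refine Finset.sum_congr rfl fun j _ => ?_
    rw [map_smul, ← hσ _ _ (Or.inl isUnit_one)]
  -- τ adds the first entry to the second; it is applied i times.
  have h2 : ∀ i : ℕ, ∑ j, addPsi n (-(j * m)) • Z j (i * j - 1) = 0 := by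
    intro i
    induction i with
    | zero => simpa using h1
    | succ i ih =>
      have := congrArg τ ih
      rw [map_sum, map_zero] at this
      rw [← this]
      refine Finset.sum_congr rfl fun j _ => ?_
      rw [map_smul, ← hτ]
      · congr 2; push_cast; ring
      · by_cases hj : IsUnit j
        · exact Or.inl hj
        · rw [sub_eq_add_neg]
          refine Or.inr (L.isUnit_add (fun h => hj (isUnit_of_mul_isUnit_right h)) isUnit_neg_one)
  -- Summation over i brings the relation into the form evaluated by `sum_orbit_eq`.
  have h3 : ∑ j, addPsi n (-(j * m)) • ∑ i, Z j (i * j - 1) = 0 := by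
    simp only [Finset.smul_sum]
    rw [Finset.sum_comm]
    refine Finset.sum_eq_zero fun i _ => ?_
    have := h2 i.val
    rwa [ZMod.natCast_zmod_val] at this
  -- The sum is χ(-m) times the Gauss sum of χ. The choice χ(m) = -η turns it into -χ(-1)s; m is a
  -- unit because χ(m) is nonzero.
  have h4 : ∑ j, addPsi n (-(j * m)) * (L.χ j : ℂ) = -(L.χ (-1) * L.s) := by
    by_cases hu : IsUnit m
    · have := L.sum_chi_psi_unit hu.neg
      have e1 : L.χ (-m) = -(L.χ (-1) * L.η) := by
        rw [← neg_one_mul, map_mul, hm]; ring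
      rw [e1] at this
      rw [L.s_eq]
      push_cast at this
      rw [show -(L.χ (-1) * (L.η * L.g)) = -(L.χ (-1) * L.η) * L.g by ring, ← this]
      refine Finset.sum_congr rfl fun j _ => ?_
      rw [mul_comm, neg_mul, mul_comm j]
    · rw [L.chi_nonunit hu] at hm
      rcases L.eta_eq with h | h <;> rw [h] at hm <;> norm_num at hm
  simp only [L.sum_orbit_eq Z hl, smul_add, Finset.sum_add_distrib, smul_smul] at h3
  rw [← Finset.sum_smul, h4] at h3
  simp only [smul_ite, smul_zero, Finset.sum_ite_eq', Finset.mem_univ, if_true, zero_mul, neg_zero,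
    AddChar.map_zero_eq_one, one_smul] at h3
  have h5 : Z 0 (-1) = (L.χ (-1) : ℂ) • Z 0 1 := by
    rw [← hl _ _ _ isUnit_neg_one (Or.inr isUnit_one)]; simp
  rw [h5, smul_smul] at h3
  have h6 : (n : ℂ) • Z 0 1 = L.s • ∑ i, Z 1 i := by
    have := congrArg ((L.χ (-1) : ℂ) • ·) h3
    simp only [smul_add, smul_smul, smul_zero] at this
    rw [show (L.χ (-1) : ℂ) * (n * L.χ (-1)) = n by linear_combination n * hc,
      show (L.χ (-1) : ℂ) * -(L.χ (-1) * L.s) = -L.s by linear_combination -L.s * hc,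
      _root_.neg_smul, neg_add_eq_zero] at this
    exact this.symm
  -- A second application of σ takes (0, 1) to (1, 0) and (1, i) to (i, -1), which is (-i, 1) up to
  -- the scalar -1.
  have h7 := congrArg σ h6
  rw [map_smul, map_smul, map_sum, ← hσ _ _ (Or.inr isUnit_one), neg_zero] at h7
  have h8 : ∑ i, σ (Z 1 i) = (L.χ (-1) : ℂ) • ∑ i, Z i 1 := by
    rw [Finset.smul_sum, ← Equiv.sum_comp (Equiv.neg _)]
    refine Finset.sum_congr rfl fun i _ => ?_
    rw [← hσ _ _ (Or.inl isUnit_one), ← hl _ _ _ isUnit_neg_one (Or.inr isUnit_one)]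
    simp
  rw [h8, smul_smul] at h7
  -- Multiplication by s produces s²χ(-1) = n on the right, and n cancels.
  have h9 := congrArg (L.s • ·) h7
  simp only [smul_smul] at h9
  rw [show L.s * (L.s * L.χ (-1)) = n by
    linear_combination (L.χ (-1) : ℂ) * L.s_mul_self + n * hc, mul_comm L.s, ← smul_smul] at h9
  exact (smul_right_injective V hn h9).symm

open Classical in
/-- The sum over all pairs with a unit among their entries, weighted by the sums of `vec`. -/
theorem sum_vec_smul (Z : ZMod n → ZMod n → V)
    (hl : ∀ l c d, IsUnit l → (IsUnit c ∨ IsUnit d) → Z (l * c) (l * d) = (L.χ l : ℂ) • Z c d)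
    (hZ : ∑ j, Z j 1 = L.s • Z 1 0) :
    ∑ x : ZMod n × ZMod n with IsUnit x.1 ∨ IsUnit x.2, (∑ y, L.vec x.1 x.2 y) • Z x.1 x.2 =
      (2 * Fintype.card (ZMod n)ˣ * L.s) • Z 1 0 := by
  have hcard : (Finset.univ.filter fun c : ZMod n => IsUnit c).card = Fintype.card (ZMod n)ˣ := by
    rw [← Finset.card_univ, ← Finset.card_map ⟨_, Units.val_injective⟩]
    congr 1
    ext c
    simp only [Finset.mem_filter, Finset.mem_univ, true_and, Finset.mem_map,
      Function.Embedding.coeFn_mk]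
    rfl
  have h1 : ∑ x : ZMod n × ZMod n with IsUnit x.1 ∨ IsUnit x.2,
      (∑ y, L.vec x.1 x.2 y) • Z x.1 x.2 = ∑ x : ZMod n × ZMod n,
      ((if x.2 = 0 then L.s * L.χ x.1 else 0) + L.χ x.2) • Z x.1 x.2 := by
    rw [Finset.sum_filter]
    refine Finset.sum_congr rfl fun x _ => ?_
    split_ifs with h h' h'
    · rw [L.sum_vec h, if_pos h']
    · rw [L.sum_vec h, if_neg h']
    · rw [not_or] at h
      simp [L.chi_nonunit h.1, L.chi_nonunit h.2]
    · rw [not_or] at h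
      simp [L.chi_nonunit h.2]
  have h2 : ∀ c, (L.s * L.χ c) • Z c 0 = if IsUnit c then L.s • Z 1 0 else 0 := by
    intro c
    split_ifs with h
    · have := hl c 1 0 h (Or.inl isUnit_one)
      rw [mul_one, mul_zero] at this
      rw [this, smul_smul, mul_assoc, L.chi_mul_self h, mul_one]
    · simp [L.chi_nonunit h]
  have h3 : ∀ d, ∑ c, (L.χ d : ℂ) • Z c d = if IsUnit d then L.s • Z 1 0 else 0 := by
    intro d
    split_ifs with h
    · rw [← hZ, ← Equiv.sum_comp h.unit.mulLeft]
      refine Finset.sum_congr rfl fun c _ => ?_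
      have := hl d c 1 h (Or.inr isUnit_one)
      rw [mul_one] at this
      rw [Units.mulLeft_apply, IsUnit.unit_spec, this, smul_smul, L.chi_mul_self h, one_smul]
    · simp [L.chi_nonunit h]
  have h4 : ∀ v : V, ∑ c : ZMod n, (if IsUnit c then v else 0) =
      (Fintype.card (ZMod n)ˣ : ℂ) • v := by
    intro v
    rw [← Finset.sum_filter, Finset.sum_const, hcard, Nat.cast_smul_eq_nsmul]
  rw [h1]
  simp only [add_smul, Finset.sum_add_distrib]
  rw [Fintype.sum_prod_type, Fintype.sum_prod_type_right]
  simp only [h3, ite_smul, zero_smul, Finset.sum_ite_eq', Finset.mem_univ, if_true, h2, h4]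
  rw [smul_smul, ← add_smul]
  congr 1; ring

end WeilForms.LocalForm

/-! ### Orthogonal sums of local forms and the Weil representation -/

namespace WeilForms

open ModularGroup

theorem e_sum {ι : Type*} (s : Finset ι) (f : ι → AddCircle (1 : ℚ)) :
    e (∑ i ∈ s, f i) = ∏ i ∈ s, e (f i) := by
  classical
  induction s using Finset.induction_on with
  | empty => simp [e_zero]
  | insert i s hi ih => rw [Finset.sum_insert hi, Finset.prod_insert hi, e_add, ih]

/-- The isomorphism of a discriminant form with an orthogonal sum of local forms. -/
structure LocalDecomp {D : Type*} [AddCommGroup D] (𝔇 : DiscriminantForm D) (N : ℕ) {ι : Type}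
    [Fintype ι] (p n : ι → ℕ) [∀ i, NeZero (n i)] (M : ι → Type*) [∀ i, AddCommGroup (M i)]
    [∀ i, Fintype (M i)] where
  L : ∀ i, LocalForm (p i) (n i) (M i)
  Φ : D ≃+ ∀ i, M i
  q_eq : ∀ x, 𝔇.q x = ∑ i, toQZ (n i) ((L i).Q (Φ x i))
  coprime : Pairwise (Function.onFun Nat.Coprime n)
  prod_eq : ∏ i, n i = N

namespace DiscriminantForm

section

variable {D : Type*} [AddCommGroup D] [Fintype D] (𝔇 : DiscriminantForm D) {r : ℤ}
  (hr : 𝔇.HasSignature r) (hr2 : Even r)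

theorem weilRep_S_eq : 𝔇.weilRep hr hr2 S = 𝔇.opS r := by simp [weilRep, homOfRel_S, unitS]

theorem weilRep_T_eq : 𝔇.weilRep hr hr2 T = 𝔇.opT := by simp [weilRep, homOfRel_T, unitT]

theorem opS_const_mul_gauss {r : ℤ} (hr : 𝔇.HasSignature r) (hr2 : Even r) :
    Complex.I ^ (-(r / 2)) / Real.sqrt (Fintype.card D) * ∑ γ : D, e (𝔇.q γ) = 1 := by
  obtain ⟨h, rfl⟩ := hr2
  have hh : (h + h) / 2 = h := by omega
  rw [hr, hh]
  have h1 : Complex.I ^ (-h) * Complex.exp (2 * Real.pi * Complex.I * (((h + h : ℤ) : ℂ) / 8)) = 1 := by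
    have : Complex.I = Complex.exp (Real.pi / 2 * Complex.I) := by
      rw [Complex.exp_pi_div_two_mul_I]
    conv_lhs => enter [1]; rw [this]
    rw [← Complex.exp_int_mul, ← Complex.exp_add]
    convert Complex.exp_zero using 2
    push_cast; ring
  have := sqrt_card_ne_zero (D := D)
  rw [div_mul_eq_mul_div, div_eq_one_iff_eq this]
  linear_combination (Real.sqrt (Fintype.card D) : ℂ) * h1

/-- The antiautomorphism of `SL₂(ℤ)` that fixes `S` and `T`. -/
def dag (A : SL(2, ℤ)) : SL(2, ℤ) :=
  ⟨!![A 1 1, A 0 1; A 1 0, A 0 0], by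
    have := A.det_coe
    rw [Matrix.det_fin_two] at this ⊢
    simp
    linarith⟩

theorem dag_mul (A B : SL(2, ℤ)) : dag (A * B) = dag B * dag A := by
  ext i j
  rw [Matrix.SpecialLinearGroup.coe_mul (dag B)]
  fin_cases i <;> fin_cases j <;> simp [dag, Matrix.mul_apply, Fin.sum_univ_two] <;> ring

theorem dag_S : dag S = S := by
  ext i j; fin_cases i <;> fin_cases j <;> simp [dag, S]

theorem dag_T : dag T = T := by
  ext i j; fin_cases i <;> fin_cases j <;> simp [dag, T]

theorem dag_one : dag 1 = 1 := by
  ext i j; fin_cases i <;> fin_cases j <;> simp [dag]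

theorem dag_inv (A : SL(2, ℤ)) : dag A⁻¹ = (dag A)⁻¹ := by
  rw [eq_inv_iff_mul_eq_one, ← dag_mul, mul_inv_cancel, dag_one]

/-- S⁻¹ is a power of S, but T has infinite order, so T⁻¹ needs a case of its own. -/
theorem sl2z_induction {P : SL(2, ℤ) → Prop} (h1 : P 1) (hS : ∀ A, P A → P (A * S))
    (hT : ∀ A, P A → P (A * T)) (hTi : ∀ A, P A → P (A * T⁻¹)) (A : SL(2, ℤ)) : P A := by
  have hA : A ∈ Subgroup.closure {S, T} := by
    rw [_root_.SpecialLinearGroup.SL2Z_generators]; trivial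
  have hSi : (S : SL(2, ℤ))⁻¹ = S * S * S := by decide
  induction hA using Subgroup.closure_induction_right with
  | one => exact h1
  | mul_right x _ y hy ih =>
    rcases hy with rfl | rfl
    · exact hS _ ih
    · exact hT _ ih
  | mul_inv_cancel x _ y hy ih =>
    rcases hy with rfl | rfl
    · rw [hSi, ← mul_assoc, ← mul_assoc]
      exact hS _ (hS _ (hS _ ih))
    · exact hTi _ ih

/-- The operators of S and T have symmetric matrices, so transposition corresponds to the
antiautomorphism that fixes S and T. In this way the zero component of ρ(A)F is read off from the
action on e₀. -/
theorem weilRep_transpose (A : SL(2, ℤ)) (F G : D → ℂ) :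
    ∑ γ, 𝔇.weilRep hr hr2 A F γ * G γ = ∑ γ, F γ * 𝔇.weilRep hr hr2 (dag A) G γ := by
  have key : ∀ B : SL(2, ℤ), dag B = B →
      (∀ F G, ∑ γ, 𝔇.weilRep hr hr2 B F γ * G γ = ∑ γ, F γ * 𝔇.weilRep hr hr2 B G γ) →
      ∀ A : SL(2, ℤ), (∀ F G, ∑ γ, 𝔇.weilRep hr hr2 A F γ * G γ =
        ∑ γ, F γ * 𝔇.weilRep hr hr2 (dag A) G γ) → ∀ F G,
      ∑ γ, 𝔇.weilRep hr hr2 (A * B) F γ * G γ =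
        ∑ γ, F γ * 𝔇.weilRep hr hr2 (dag (A * B)) G γ := by
    intro B hB hB' A hA F G
    rw [map_mul, Module.End.mul_apply, hA, hB', dag_mul, map_mul, Module.End.mul_apply, hB]
  have hT : ∀ F G, ∑ γ, 𝔇.weilRep hr hr2 T F γ * G γ = ∑ γ, F γ * 𝔇.weilRep hr hr2 T G γ := by
    intro F G
    rw [weilRep_T_eq]
    simp only [opT, LinearMap.coe_mk, AddHom.coe_mk]
    exact Finset.sum_congr rfl fun γ _ => by ring
  induction A using sl2z_induction generalizing F G with
  | h1 => simp [dag_one]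
  | hS A ih =>
    refine key S dag_S (fun F G => ?_) A ih F G
    rw [weilRep_S_eq]
    simp only [opS, LinearMap.coe_mk, AddHom.coe_mk, Finset.mul_sum, Finset.sum_mul]
    rw [Finset.sum_comm]
    refine Finset.sum_congr rfl fun γ _ => Finset.sum_congr rfl fun β _ => ?_
    rw [𝔇.b_comm]; ring
  | hT A ih => exact key T dag_T hT A ih F G
  | hTi A ih =>
    refine key T⁻¹ (by rw [dag_inv, dag_T]) (fun F G => ?_) A ih F G
    have := hT (𝔇.weilRep hr hr2 T⁻¹ F) (𝔇.weilRep hr hr2 T⁻¹ G)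
    simp only [← Module.End.mul_apply, ← map_mul, mul_inv_cancel, map_one,
      Module.End.one_apply] at this
    exact this.symm

theorem weilRep_comp_aut {σ : D ≃+ D} (hσ : 𝔇.IsAut σ) (A : SL(2, ℤ)) (F : D → ℂ) :
    𝔇.weilRep hr hr2 A (F ∘ σ) = 𝔇.weilRep hr hr2 A F ∘ σ := by
  have hb : ∀ x y, 𝔇.b (σ x) (σ y) = 𝔇.b x y := by
    intro x y
    simp only [b, QuadraticMap.polar, ← map_add]
    rw [hσ, hσ, hσ]
  have hT : ∀ F : D → ℂ, 𝔇.weilRep hr hr2 T (F ∘ σ) = 𝔇.weilRep hr hr2 T F ∘ σ := by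
    intro F
    rw [weilRep_T_eq]
    funext γ
    simp [opT, hσ γ]
  induction A using sl2z_induction generalizing F with
  | h1 => simp
  | hS A ih =>
    rw [map_mul, Module.End.mul_apply, Module.End.mul_apply, ← ih, weilRep_S_eq]
    congr 1
    funext γ
    simp only [opS, LinearMap.coe_mk, AddHom.coe_mk, Function.comp_apply]
    rw [← Equiv.sum_comp σ.toEquiv fun β => e (-𝔇.b (σ γ) β) * F β]
    simp [hb]
  | hT A ih => rw [map_mul, Module.End.mul_apply, Module.End.mul_apply, ← ih, hT]
  | hTi A ih =>
    rw [map_mul, Module.End.mul_apply, Module.End.mul_apply, ← ih]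
    congr 1
    have h1 : ∀ G, 𝔇.weilRep hr hr2 T⁻¹ (𝔇.weilRep hr hr2 T G) = G := by
      intro G
      rw [← Module.End.mul_apply, ← map_mul, inv_mul_cancel, map_one, Module.End.one_apply]
    have h2 : ∀ G, 𝔇.weilRep hr hr2 T (𝔇.weilRep hr hr2 T⁻¹ G) = G := by
      intro G
      rw [← Module.End.mul_apply, ← map_mul, mul_inv_cancel, map_one, Module.End.one_apply]
    have := hT (𝔇.weilRep hr hr2 T⁻¹ F)
    rw [h2] at this
    rw [← this, h1]

end

end DiscriminantForm

namespace LocalDecomp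

variable {D : Type*} [AddCommGroup D] {𝔇 : DiscriminantForm D} {N : ℕ} {ι : Type}
    [Fintype ι] {p n : ι → ℕ} [∀ i, NeZero (n i)] {M : ι → Type*} [∀ i, AddCommGroup (M i)]
    [∀ i, Fintype (M i)] (𝒟 : LocalDecomp 𝔇 N p n M)

theorem b_eq (x y : D) : 𝔇.b x y = ∑ i, toQZ (n i) ((𝒟.L i).B (𝒟.Φ x i) (𝒟.Φ y i)) := by
  simp only [DiscriminantForm.b, QuadraticMap.polar, 𝒟.q_eq, LocalForm.B, map_sub,
    Finset.sum_sub_distrib, map_add, Pi.add_apply]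

theorem sum_prod [Fintype D] (f : ∀ i, M i → ℂ) :
    ∑ γ : D, ∏ i, f i (𝒟.Φ γ i) = ∏ i, ∑ x, f i x := by
  classical
  rw [Finset.prod_univ_sum, Fintype.piFinset_univ, ← Equiv.sum_comp 𝒟.Φ.toEquiv]
  rfl

theorem card_eq [Fintype D] (𝒟 : LocalDecomp 𝔇 N p n M) : Fintype.card D = N := by
  have h : (Fintype.card D : ℂ) = N := by
    classical
    rw [← 𝒟.prod_eq, Nat.cast_prod, ← Finset.prod_congr rfl fun i _ => (𝒟.L i).card_eq,
      Fintype.card_congr 𝒟.Φ.toEquiv, Fintype.card_pi, Nat.cast_prod]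
  exact_mod_cast h

theorem gauss_eq [Fintype D] : ∑ γ, e (𝔇.q γ) = ∏ i, (𝒟.L i).s := by
  simp only [𝒟.q_eq, e_sum]
  exact 𝒟.sum_prod fun i x => addPsi (n i) ((𝒟.L i).Q x)

/-- The type of families of pairs modulo `n i`. -/
abbrev Rows (n : ι → ℕ) : Type := ∀ i, ZMod (n i) × ZMod (n i)

/-- The bottom row of a matrix, modulo the `n i`. -/
def row (n : ι → ℕ) (A : SL(2, ℤ)) : Rows n := fun i => (A 1 0, A 1 1)

/-- Each pair contains a unit. -/
def IsPrim (x : Rows n) : Prop := ∀ i, IsUnit (x i).1 ∨ IsUnit (x i).2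

/-- The action of `SL₂(ℤ)` from the right. -/
def act (x : Rows n) (A : SL(2, ℤ)) : Rows n :=
  fun i => ((x i).1 * A 0 0 + (x i).2 * A 1 0, (x i).1 * A 0 1 + (x i).2 * A 1 1)

theorem row_mul (A B : SL(2, ℤ)) : row n (A * B) = act (row n A) B := by
  funext i
  simp [row, act, Matrix.mul_apply, Fin.sum_univ_two]

theorem isPrim_row (𝒟 : LocalDecomp 𝔇 N p n M) (A : SL(2, ℤ)) : IsPrim (row n A) := by
  intro i
  have hd := A.det_coe
  rw [Matrix.det_fin_two] at hd
  simp only [row, (𝒟.L i).isUnit_intCast]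
  by_contra! h
  have h1 : ((p i : ℕ) : ℤ) ∣ 1 := by
    rw [← hd]
    exact dvd_sub (h.2.mul_left _) (h.1.mul_left _)
  exact (Nat.prime_iff_prime_int.mp (𝒟.L i).prime).not_dvd_one h1

/-- The product of the local vectors. -/
noncomputable def vecs (x : Rows n) (γ : D) : ℂ := ∏ i, (𝒟.L i).vec (x i).1 (x i).2 (𝒟.Φ γ i)

theorem act_S (x : Rows n) : act x S = fun i => ((x i).2, -(x i).1) := by
  funext i; simp [act, S]

theorem act_T (x : Rows n) : act x T = fun i => ((x i).1, (x i).1 + (x i).2) := by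
  funext i; simp [act, T]

theorem opT_vecs {x : Rows n} (hx : IsPrim x) : 𝔇.opT (𝒟.vecs (act x T)) = 𝒟.vecs x := by
  funext γ
  simp only [DiscriminantForm.opT, LinearMap.coe_mk, AddHom.coe_mk, act_T, vecs, 𝒟.q_eq, e_sum]
  rw [← Finset.prod_mul_distrib]
  exact Finset.prod_congr rfl fun i _ => (𝒟.L i).vec_T (hx i) _

/-- The local transforms produce the product of the local Gauss sums. This is the Gauss sum of D,
which the normalizing factor of ρ(S) cancels. -/
theorem opS_vecs [Fintype D] {r : ℤ} (hr : 𝔇.HasSignature r) (hr2 : Even r) {x : Rows n}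
    (hx : IsPrim x) : 𝔇.opS r (𝒟.vecs (act x S)) = 𝒟.vecs x := by
  funext γ
  simp only [DiscriminantForm.opS, LinearMap.coe_mk, AddHom.coe_mk, act_S, vecs, 𝒟.b_eq,
    ← Finset.sum_neg_distrib, e_sum, ← Finset.prod_mul_distrib, ← map_neg]
  have h1 := 𝒟.sum_prod fun i z => addPsi (n i) (-(𝒟.L i).B (𝒟.Φ γ i) z) *
    (𝒟.L i).vec (x i).2 (-(x i).1) z
  simp only [addPsi_apply] at h1
  rw [h1]
  have h2 : ∀ i, ∑ z, e (toQZ (n i) (-(𝒟.L i).B (𝒟.Φ γ i) z)) * (𝒟.L i).vec (x i).2 (-(x i).1) z =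
    (𝒟.L i).s * (𝒟.L i).vec (x i).1 (x i).2 (𝒟.Φ γ i) := fun i => (𝒟.L i).vec_S (hx i) _
  simp only [h2, Finset.prod_mul_distrib]
  rw [← mul_assoc, ← 𝒟.gauss_eq, 𝔇.opS_const_mul_gauss hr hr2, one_mul]

open Classical in
theorem vecs_row_one : 𝒟.vecs (row n 1) = Pi.single 0 1 := by
  funext γ
  simp only [vecs, row, Matrix.SpecialLinearGroup.coe_one, Matrix.one_apply, Int.cast_zero,
    Fin.reduceEq, if_false, if_true, LocalForm.vec_zero_left, Int.cast_one, map_one]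
  rw [Pi.single_apply]
  split_ifs with h
  · subst h; simp
  · have : ∃ i, 𝒟.Φ γ i ≠ 0 := by
      by_contra! h'
      exact h ((AddEquiv.map_eq_zero_iff 𝒟.Φ).mp (funext h'))
    obtain ⟨i, hi⟩ := this
    exact Finset.prod_eq_zero (Finset.mem_univ i) (by simp [hi])

open Classical in
-- Both sides obey the same recursion under right multiplication of A by S and T, by `opS_vecs` and
-- `opT_vecs`, and agree at A = 1. In particular ρ(A⁻¹)e₀ depends only on the bottom row of A modulo
-- the n i.
theorem weilRep_inv_single [Fintype D] {r : ℤ} (hr : 𝔇.HasSignature r) (hr2 : Even r)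
    (A : SL(2, ℤ)) : 𝔇.weilRep hr hr2 A⁻¹ (Pi.single 0 1) = 𝒟.vecs (row n A) := by
  have hinv : ∀ (B : SL(2, ℤ)) (F : D → ℂ),
      𝔇.weilRep hr hr2 B⁻¹ (𝔇.weilRep hr hr2 B F) = F := by
    intro B F
    rw [← Module.End.mul_apply, ← map_mul, inv_mul_cancel, map_one, Module.End.one_apply]
  induction A using DiscriminantForm.sl2z_induction with
  | h1 => rw [inv_one, map_one, Module.End.one_apply, vecs_row_one]
  | hS A ih =>
    rw [mul_inv_rev, map_mul, Module.End.mul_apply, ih, row_mul,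
      ← 𝒟.opS_vecs hr hr2 (𝒟.isPrim_row A), ← 𝔇.weilRep_S_eq hr hr2, hinv]
  | hT A ih =>
    rw [mul_inv_rev, map_mul, Module.End.mul_apply, ih, row_mul,
      ← 𝒟.opT_vecs (𝒟.isPrim_row A), ← 𝔇.weilRep_T_eq hr hr2, hinv]
  | hTi A ih =>
    rw [mul_inv_rev, map_mul, Module.End.mul_apply, ih, inv_inv, 𝔇.weilRep_T_eq,
      ← 𝒟.opT_vecs (𝒟.isPrim_row (A * T⁻¹)), ← row_mul, inv_mul_cancel_right]

/-- The product of the local characters. -/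
noncomputable def chi (m : ℤ) : ℤ := ∏ i, (𝒟.L i).χ (m : ZMod (n i))

end LocalDecomp

end WeilForms

/-! ### Norms, representation numbers and automorphisms of D -/

namespace WeilForms.LocalDecomp

open DiscriminantForm

variable {D : Type*} [AddCommGroup D] {𝔇 : DiscriminantForm D} {N : ℕ} {ι : Type}
    [Fintype ι] {p n : ι → ℕ} [∀ i, NeZero (n i)] {M : ι → Type*} [∀ i, AddCommGroup (M i)]
    [∀ i, Fintype (M i)]

theorem exists_intCast (𝒟 : LocalDecomp 𝔇 N p n M) (x : ∀ i, ZMod (n i)) :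
    ∃ z : ℤ, ∀ i, (z : ZMod (n i)) = x i := by
  obtain ⟨z, hz⟩ := ZMod.intCast_surjective ((ZMod.prodEquivPi n 𝒟.coprime).symm x)
  refine ⟨z, fun i => ?_⟩
  have := congrFun (congrArg (ZMod.prodEquivPi n 𝒟.coprime) hz) i
  rw [ZMod.prodEquivPi_apply, map_intCast, RingEquiv.apply_symm_apply] at this
  exact this

theorem intCast_dvd_iff (𝒟 : LocalDecomp 𝔇 N p n M) (m : ℤ) :
    (N : ℤ) ∣ m ↔ ∀ i, (m : ZMod (n i)) = 0 := by
  simp only [ZMod.intCast_zmod_eq_zero_iff_dvd]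
  rw [← 𝒟.prod_eq]
  push_cast
  refine ⟨fun h i => (Finset.dvd_prod_of_mem _ (Finset.mem_univ i)).trans h, fun h => ?_⟩
  refine Finset.prod_dvd_of_coprime (fun i _ j _ hij => ?_) fun i _ => h i
  exact (Nat.isCoprime_iff_coprime.mpr (𝒟.coprime hij))

theorem vecs_smul (𝒟 : LocalDecomp 𝔇 N p n M) {x : Rows n} (hx : IsPrim x)
    (l : ∀ i, (ZMod (n i))ˣ) (γ : D) :
    𝒟.vecs (fun i => (l i * (x i).1, l i * (x i).2)) γ =
      (∏ i, ((𝒟.L i).χ (l i) : ℂ)) * 𝒟.vecs x γ := by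
  rw [vecs, vecs, ← Finset.prod_mul_distrib]
  exact Finset.prod_congr rfl fun i _ => (𝒟.L i).vec_smul (l i).isUnit (hx i) _

open Classical in
-- Modulo N the bottom row of an element of Γ₀(N) is (0, d), a unit multiple of the bottom row of
-- the identity.
theorem weilRep_inv_single_of_mem [Fintype D] (𝒟 : LocalDecomp 𝔇 N p n M) {r : ℤ}
    (hr : 𝔇.HasSignature r) (hr2 : Even r) {A : SL(2, ℤ)} (hA : A ∈ CongruenceSubgroup.Gamma0 N) :
    𝔇.weilRep hr hr2 A⁻¹ (Pi.single 0 1) = (𝒟.chi (A 1 1) : ℂ) • Pi.single 0 1 := by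
  rw [𝒟.weilRep_inv_single, ← 𝒟.vecs_row_one]
  rw [CongruenceSubgroup.Gamma0_mem, ZMod.intCast_zmod_eq_zero_iff_dvd, 𝒟.intCast_dvd_iff] at hA
  have hd : ∀ i, IsUnit ((A 1 1 : ℤ) : ZMod (n i)) := by
    intro i
    refine (𝒟.isPrim_row A i).resolve_left fun h => ?_
    simp only [row, hA i] at h
    exact (𝒟.L i).ne_zero_of_isUnit h rfl
  funext γ
  have := 𝒟.vecs_smul (𝒟.isPrim_row 1) (fun i => (hd i).unit) γ
  simp only [IsUnit.unit_spec] at this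
  rw [Pi.smul_apply, smul_eq_mul, chi]
  push_cast
  rw [← this]
  congr 1
  funext i
  simp [row, hA i]

/-- By transposition the question concerns ρ(`dag A`)e₀, and the inverse of `dag A` lies in Γ₀(N)
with the same lower right entry as A. -/
theorem weilRep_apply_zero [Fintype D] (𝒟 : LocalDecomp 𝔇 N p n M) {r : ℤ}
    (hr : 𝔇.HasSignature r) (hr2 : Even r) {A : SL(2, ℤ)} (hA : A ∈ CongruenceSubgroup.Gamma0 N)
    (F : D → ℂ) : 𝔇.weilRep hr hr2 A F 0 = 𝒟.chi (A 1 1) * F 0 := by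
  classical
  have h1 := 𝔇.weilRep_transpose hr hr2 A F (Pi.single 0 1)
  have h2 : (dag A)⁻¹ ∈ CongruenceSubgroup.Gamma0 N := by
    rw [CongruenceSubgroup.Gamma0_mem] at hA ⊢
    rw [Matrix.SpecialLinearGroup.SL2_inv_expl]
    simp [dag, hA]
  have h3 := 𝒟.weilRep_inv_single_of_mem hr hr2 h2
  rw [inv_inv] at h3
  have h4 : (dag A)⁻¹ 1 1 = A 1 1 := by
    rw [Matrix.SpecialLinearGroup.SL2_inv_expl]
    simp [dag]
  rw [h3, h4] at h1
  simp only [Pi.single_apply, Pi.smul_apply, smul_eq_mul, mul_ite, mul_one, mul_zero,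
    Finset.sum_ite_eq', Finset.mem_univ, if_true] at h1
  rw [h1, mul_comm]

/-- The product of the moduli different from `n i`. -/
def cof [DecidableEq ι] (n : ι → ℕ) (i : ι) : ℕ := ∏ j ∈ Finset.univ.erase i, n j

variable [DecidableEq ι]

theorem mul_cof (𝒟 : LocalDecomp 𝔇 N p n M) (i : ι) : n i * cof n i = N := by
  rw [cof, Finset.mul_prod_erase _ _ (Finset.mem_univ i), 𝒟.prod_eq]

theorem cof_eq_zero {i j : ι} (h : j ≠ i) : (cof n i : ZMod (n j)) = 0 := by
  rw [ZMod.natCast_eq_zero_iff]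
  exact Finset.dvd_prod_of_mem _ (Finset.mem_erase.mpr ⟨h, Finset.mem_univ _⟩)

theorem isUnit_cof (𝒟 : LocalDecomp 𝔇 N p n M) (i : ι) : IsUnit (cof n i : ZMod (n i)) := by
  rw [ZMod.isUnit_iff_coprime]
  exact Nat.Coprime.prod_left fun j hj => 𝒟.coprime (Finset.mem_erase.mp hj).1

/-- The inverse of the product of the other moduli. -/
def cofInv (n : ι → ℕ) (i : ι) : ZMod (n i) := (cof n i : ZMod (n i))⁻¹

theorem cof_mul_cofInv (𝒟 : LocalDecomp 𝔇 N p n M) (i : ι) :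
    (cof n i : ZMod (n i)) * cofInv n i = 1 := ZMod.mul_inv_of_unit _ (𝒟.isUnit_cof i)

/-- Partial fractions. -/
theorem coe_div_eq (𝒟 : LocalDecomp 𝔇 N p n M) (m : ℤ) :
    ((m / N : ℚ) : AddCircle (1 : ℚ)) = ∑ i, toQZ (n i) (m * cofInv n i) := by
  choose a ha using fun i => ZMod.intCast_surjective (cofInv n i)
  have hN : ∀ i, ((n i : ℕ) : ℚ) * cof n i = N := fun i => by exact_mod_cast 𝒟.mul_cof i
  have hn : ∀ i, ((n i : ℕ) : ℚ) ≠ 0 := fun i => Nat.cast_ne_zero.mpr (NeZero.ne _)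
  have hN0 : (N : ℚ) ≠ 0 := by
    rw [← 𝒟.prod_eq]; push_cast
    exact Finset.prod_ne_zero_iff.mpr fun i _ => hn i
  have h1 : (N : ℤ) ∣ m - ∑ i, m * a i * cof n i := by
    rw [𝒟.intCast_dvd_iff]
    intro j
    push_cast
    rw [Finset.sum_eq_single j (fun i _ hij => by rw [cof_eq_zero hij.symm, mul_zero])
      (fun h => absurd (Finset.mem_univ j) h), ha, mul_assoc, mul_comm (cofInv n j),
      𝒟.cof_mul_cofInv]
    ring
  obtain ⟨z, hz⟩ := h1
  have h2 : ∀ i, toQZ (n i) (m * cofInv n i) = ((m * a i / n i : ℚ) : AddCircle (1 : ℚ)) := by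
    intro i
    rw [← ha, ← Int.cast_mul, toQZ_intCast]
    push_cast; rfl
  simp only [h2]
  have h3 : (m / N : ℚ) = ∑ i, (m * a i / n i : ℚ) + z := by
    have : (m : ℚ) - ∑ i, (m * a i * cof n i : ℚ) = N * z := by exact_mod_cast hz
    have h4 : ∀ i, (m * a i / n i : ℚ) = m * a i * cof n i / N := by
      intro i
      rw [← hN i]
      have h5 : (cof n i : ℚ) ≠ 0 := fun h => hN0 (by rw [← hN i, h, mul_zero])
      have := hn i
      field_simp
    simp only [h4, ← Finset.sum_div]
    field_simp
    linear_combination this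
  rw [h3, AddCircle.coe_add]
  have h5 : ((z : ℚ) : AddCircle (1 : ℚ)) = 0 :=
    (AddCircle.coe_eq_zero_iff (1 : ℚ)).mpr ⟨z, by simp⟩
  rw [h5, add_zero]
  exact map_sum (QuotientAddGroup.mk' (AddSubgroup.zmultiples (1 : ℚ))) _ _

/-- Multiplication by the cofactor of n j kills every summand except the j-th and is injective on
that one. -/
theorem sum_toQZ_inj (𝒟 : LocalDecomp 𝔇 N p n M) {a b : ∀ i, ZMod (n i)}
    (h : ∑ i, toQZ (n i) (a i) = ∑ i, toQZ (n i) (b i)) : a = b := by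
  funext j
  have h1 : ∀ c : ∀ i, ZMod (n i),
      cof n j • ∑ i, toQZ (n i) (c i) = toQZ (n j) (cof n j * c j) := by
    intro c
    rw [Finset.smul_sum, Finset.sum_eq_single j]
    · rw [← map_nsmul, nsmul_eq_mul]
    · intro i _ hij
      rw [← map_nsmul, nsmul_eq_mul, cof_eq_zero hij, zero_mul, map_zero]
    · exact fun h => absurd (Finset.mem_univ j) h
  have h2 := congrArg (cof n j • ·) h
  simp only [h1] at h2
  exact (𝒟.isUnit_cof j).mul_left_cancel (toQZ_injective _ h2)

theorem q_eq_iff (𝒟 : LocalDecomp 𝔇 N p n M) (m : ℤ) (γ : D) :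
    𝔇.q γ = ((m / N : ℚ) : AddCircle (1 : ℚ)) ↔
      ∀ i, (𝒟.L i).Q (𝒟.Φ γ i) = m * cofInv n i := by
  rw [𝒟.q_eq, 𝒟.coe_div_eq]
  refine ⟨fun h => congrFun (𝒟.sum_toQZ_inj h), fun h => ?_⟩
  simp only [h]

theorem card_norm_eq (𝒟 : LocalDecomp 𝔇 N p n M) (m : ℤ) :
    (Nat.card {γ // 𝔇.q γ = ((m / N : ℚ) : AddCircle (1 : ℚ))} : ℤ) =
      ∏ i, (1 + (𝒟.L i).η * (𝒟.L i).χ (m * cofInv n i)) := by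
  have e1 : {γ // 𝔇.q γ = ((m / N : ℚ) : AddCircle (1 : ℚ))} ≃
      ∀ i, {x // (𝒟.L i).Q x = m * cofInv n i} :=
    (Equiv.subtypeEquiv 𝒟.Φ.toEquiv (q := fun x => ∀ i, (𝒟.L i).Q (x i) = m * cofInv n i)
      (𝒟.q_eq_iff m)).trans
    (Equiv.subtypePiEquivPi (p := fun {i} x => (𝒟.L i).Q x = m * cofInv n i))
  rw [Nat.card_congr e1, Nat.card_pi]
  push_cast
  exact Finset.prod_congr rfl fun i _ => (𝒟.L i).card_fiber _

theorem exists_int_norm (𝒟 : LocalDecomp 𝔇 N p n M) (γ : D) :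
    ∃ m : ℤ, 𝔇.q γ = ((m / N : ℚ) : AddCircle (1 : ℚ)) := by
  obtain ⟨m, hm⟩ := 𝒟.exists_intCast fun i => (𝒟.L i).Q (𝒟.Φ γ i) * cof n i
  refine ⟨m, (𝒟.q_eq_iff m γ).mpr fun i => ?_⟩
  rw [hm, mul_assoc, 𝒟.cof_mul_cofInv, mul_one]

theorem exists_isAut (𝒟 : LocalDecomp 𝔇 N p n M) {β γ : D} (h : 𝔇.q β = 𝔇.q γ) :
    ∃ σ : D ≃+ D, 𝔇.IsAut σ ∧ σ β = γ := by
  have h1 : ∀ i, (𝒟.L i).Q (𝒟.Φ β i) = (𝒟.L i).Q (𝒟.Φ γ i) := by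
    rw [𝒟.q_eq, 𝒟.q_eq] at h
    exact congrFun (𝒟.sum_toQZ_inj h)
  choose σ hσ hσ' using fun i => (𝒟.L i).exists_isometry _ _ (h1 i)
  refine ⟨(𝒟.Φ.trans (AddEquiv.piCongrRight σ)).trans 𝒟.Φ.symm, fun x => ?_, ?_⟩
  · rw [𝒟.q_eq, 𝒟.q_eq]
    refine Finset.sum_congr rfl fun i _ => ?_
    simp [hσ]
  · simp only [AddEquiv.trans_apply, AddEquiv.symm_apply_eq]
    funext i
    simp [hσ']

end WeilForms.LocalDecomp

/-! ### Fourier expansions -/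

namespace WeilForms

open ModularGroup
open scoped ModularForm Manifold

section QExpansions

theorem coe_T_zpow_smul (j : ℤ) (τ : ℍ) : ((T ^ j • τ : ℍ) : ℂ) = τ + j := by
  rw [modular_T_zpow_smul, coe_vadd]
  push_cast
  ring

theorem slash_T_zpow_apply (k j : ℤ) (f : ℍ → ℂ) (τ : ℍ) : (f ∣[k] (T ^ j)) τ = f (T ^ j • τ) := by
  rw [ModularForm.SL_slash_apply]
  have : denom ((T ^ j : SL(2, ℤ)) : GL (Fin 2) ℝ) τ = 1 := by
    rw [ModularGroup.denom_apply, coe_T_zpow]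
    simp
  rw [this, one_zpow, mul_one]

/-- Multiplication by a positive real number. -/
noncomputable def dilate (c : ℝ) (hc : 0 < c) (τ : ℍ) : ℍ :=
  ⟨c * τ, by simpa using mul_pos hc τ.im_pos⟩

theorem coe_dilate (c : ℝ) (hc : 0 < c) (τ : ℍ) : (dilate c hc τ : ℂ) = c * τ := rfl

theorem exists_hasQExp_sum {ι : Type*} (h : ℕ) (s : Finset ι) {g : ι → ℍ → ℂ}
    (hg : ∀ i ∈ s, ∃ a, HasQExp h (g i) a) : ∃ a, HasQExp h (∑ i ∈ s, g i) a := by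
  classical
  induction s using Finset.induction_on with
  | empty => exact ⟨0, by simpa using HasQExp.zero h⟩
  | insert i s hi ih =>
    obtain ⟨a, ha⟩ := hg i (Finset.mem_insert_self _ _)
    obtain ⟨b, hb⟩ := ih fun j hj => hg j (Finset.mem_insert_of_mem hj)
    exact ⟨a + b, by rw [Finset.sum_insert hi]; exact ha.add hb⟩

theorem exists_hasQExp_comp {h δ : ℕ} (hh : h ≠ 0) (hδ : δ ≠ 0) {α : ℕ} (hα : α ≠ 0) (β : ℤ)
    {g g' : ℍ → ℂ} {a : ℤ → ℂ} (hg : HasQExp h g a)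
    (hg' : ∀ τ : ℍ, ∃ τ' : ℍ, (τ' : ℂ) = (α * (τ : ℂ) + β) / δ ∧ g' τ = g τ') :
    ∃ a', HasQExp (h * δ) g' a' := by
  obtain ⟨⟨m, hm⟩, hg⟩ := hg
  have hα' : (0 : ℤ) < α := by positivity
  have hinj : Function.Injective fun n : ℤ => (α : ℤ) * n := fun x y hxy =>
    mul_left_cancel₀ hα'.ne' hxy
  let b : ℤ → ℂ := fun n => a n * Complex.exp (2 * Real.pi * Complex.I * (n * β / (h * δ)))
  refine ⟨Function.extend (fun n : ℤ => (α : ℤ) * n) b 0, ⟨min 0 (α * m), fun n hn => ?_⟩,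
    fun τ => ?_⟩
  · by_cases h' : ∃ l, (α : ℤ) * l = n
    · obtain ⟨l, rfl⟩ := h'
      rw [hinj.extend_apply]
      have : l < m := by
        have := lt_of_lt_of_le hn (min_le_right _ _)
        exact lt_of_mul_lt_mul_left this hα'.le
      simp [b, hm l this]
    · rw [Function.extend_apply' _ _ _ h']; rfl
  · obtain ⟨τ', h1, h2⟩ := hg' τ
    rw [h2, ← Function.Injective.hasSum_iff hinj]
    · convert hg τ' using 2 with n
      simp only [Function.comp_apply, hinj.extend_apply, b]
      rw [mul_assoc, ← Complex.exp_add, h1]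
      congr 2
      have : (h : ℂ) ≠ 0 := by exact_mod_cast hh
      have : (δ : ℂ) ≠ 0 := by exact_mod_cast hδ
      push_cast
      field_simp
      ring
    · intro n hn
      rw [Function.extend_apply' _ _ _ (by simpa using hn)]
      simp

/-- Extraction of the terms of a Fourier expansion in a residue class, by averaging over
translations. -/
theorem hasSum_average {h : ℕ} (d : ℕ) [NeZero d] {g : ℍ → ℂ} {a : ℤ → ℂ}
    (hg : ∀ τ : ℍ,
      HasSum (fun n : ℤ => a n * Complex.exp (2 * Real.pi * Complex.I * (n / h) * τ)) (g τ))
    (E : ℤ) (u : ℤ → ZMod d)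
    (hu : ∀ n : ℤ, Complex.exp (2 * Real.pi * Complex.I * (n * E / h)) = addPsi d (u n))
    (m : ZMod d) (τ : ℍ) :
    HasSum (fun n : ℤ => if u n = m then
        d * (a n * Complex.exp (2 * Real.pi * Complex.I * (n / h) * τ)) else 0)
      (∑ j : ZMod d, addPsi d (-(j * m)) * g (T ^ (E * j.val) • τ)) := by
  have h1 : ∀ j : ZMod d, HasSum (fun n : ℤ => addPsi d (-(j * m)) * (addPsi d (j * u n) *
      (a n * Complex.exp (2 * Real.pi * Complex.I * (n / h) * τ))))
      (addPsi d (-(j * m)) * g (T ^ (E * j.val) • τ)) := by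
    intro j
    refine HasSum.mul_left _ ?_
    refine (hg (T ^ (E * j.val) • τ)).congr_fun fun n => ?_
    have h2 : addPsi d (j * u n) = addPsi d (u n) ^ j.val := by
      rw [← AddChar.map_nsmul_eq_pow, nsmul_eq_mul, ZMod.natCast_zmod_val]
    rw [h2, ← hu, ← Complex.exp_nat_mul, coe_T_zpow_smul, mul_left_comm, ← Complex.exp_add]
    congr 2
    push_cast
    ring
  refine (hasSum_sum (s := Finset.univ) fun j _ => h1 j).congr_fun fun n => ?_
  have h3 : ∀ j, addPsi d (-(j * m)) * (addPsi d (j * u n) *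
      (a n * Complex.exp (2 * Real.pi * Complex.I * (n / h) * τ))) =
      addPsi d (j * (u n - m)) * (a n * Complex.exp (2 * Real.pi * Complex.I * (n / h) * τ)) := by
    intro j
    rw [← mul_assoc, ← AddChar.map_add_eq_mul]
    congr 2; ring
  simp only [h3, ← Finset.sum_mul, sum_addPsi_mul, sub_eq_zero]
  split_ifs <;> simp

/-- Averaging over the δ translations by multiples of N fixes g and removes the exponents that are
not divisible by δ. -/
theorem exists_hasQExp_of_periodic {N δ : ℕ} [NeZero N] [NeZero δ] {g : ℍ → ℂ} {a : ℤ → ℂ}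
    (hg : HasQExp (N * δ) g a) (hper : ∀ τ, g (T ^ (N : ℤ) • τ) = g τ) :
    ∃ a', HasQExp N g a' := by
  have hN : (N : ℂ) ≠ 0 := by exact_mod_cast NeZero.ne N
  have hδ : (δ : ℂ) ≠ 0 := by exact_mod_cast NeZero.ne δ
  have hδ' : (0 : ℤ) < δ := by exact_mod_cast Nat.pos_of_ne_zero (NeZero.ne δ)
  obtain ⟨⟨m, hm⟩, hg⟩ := hg
  have hper' : ∀ (j : ℕ) τ, g (T ^ ((N : ℤ) * j) • τ) = g τ := by
    intro j
    induction j with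
    | zero => simp
    | succ j ih =>
      intro τ
      rw [Nat.cast_succ, mul_add, mul_one, zpow_add, mul_smul, ih, hper]
  have hinj : Function.Injective fun n : ℤ => n * (δ : ℤ) := fun x y hxy =>
    mul_right_cancel₀ hδ'.ne' hxy
  -- The minimum with 0 ensures n < 0, whence nδ ≤ n < m.
  refine ⟨fun n => a (n * δ), ⟨min m 0, fun n hn => hm _ ?_⟩, fun τ => ?_⟩
  · have h1 := lt_of_lt_of_le hn (min_le_left _ _)
    have h2 := lt_of_lt_of_le hn (min_le_right _ _)
    nlinarith
  · have := hasSum_average δ hg N (fun n => (n : ZMod δ)) (fun n => by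
      rw [addPsi_intCast]
      congr 1
      push_cast
      field_simp) 0 τ
    simp only [mul_zero, neg_zero, AddChar.map_zero_eq_one, one_mul, hper', Finset.sum_const,
      Finset.card_univ, ZMod.card, nsmul_eq_mul] at this
    have h2 := this.mul_left (δ : ℂ)⁻¹
    rw [inv_mul_cancel_left₀ hδ, ← hinj.hasSum_iff] at h2
    · refine h2.congr_fun fun n => ?_
      simp only [Function.comp_apply, Int.cast_mul, Int.cast_natCast, ZMod.natCast_self, mul_zero,
        if_true]
      rw [inv_mul_cancel_left₀ hδ]
      congr 2
      push_cast
      field_simp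
    · intro n hn
      rw [if_neg, mul_zero]
      rw [ZMod.intCast_zmod_eq_zero_iff_dvd]
      rintro ⟨l, rfl⟩
      exact hn ⟨l, mul_comm _ _⟩

end QExpansions

/-! ### The slash operator of W(N) -/

section Slash

theorem slashGL_eq (k : ℤ) (f : ℍ → ℂ) {g : GL (Fin 2) ℝ} (hg : 0 < g.det.val) :
    slashGL k f g = ((g.det.val ^ ((k : ℝ) / 2 - (k - 1)) : ℝ) : ℂ) • (f ∣[k] g) := by
  funext τ
  rw [Pi.smul_apply, ModularForm.slash_apply, slashGL, σ, if_pos hg, abs_of_pos hg,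
    Real.rpow_sub hg]
  have h1 : (g.det.val : ℝ) ^ ((k : ℝ) - 1) = g.det.val ^ (k - 1) := by
    rw [← Real.rpow_intCast]; push_cast; rfl
  rw [h1]
  have h2 : ((g.det.val ^ (k - 1) : ℝ) : ℂ) ≠ 0 := by
    exact_mod_cast (zpow_pos hg _).ne'
  push_cast at h2 ⊢
  simp only [smul_eq_mul, ContinuousAlgEquiv.refl_apply]
  field_simp

variable (N : ℕ) [NeZero N]

theorem det_matW : (matW N).det.val = N := by
  simp [matW, Matrix.det_fin_two]

theorem det_matW_pos : 0 < (matW N).det.val := by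
  rw [det_matW]
  exact_mod_cast Nat.pos_of_ne_zero (NeZero.ne N)

theorem natCast_pos : (0 : ℝ) < N := by exact_mod_cast Nat.pos_of_ne_zero (NeZero.ne N)

theorem matW_smul (τ : ℍ) : matW N • τ = S • dilate N (natCast_pos N) τ := by
  ext1
  rw [coe_smul_of_det_pos (det_matW_pos N), modular_S_smul]
  simp [num, denom, matW, coe_dilate, neg_div]

theorem slashGL_matW_apply (k : ℤ) (f : ℍ → ℂ) (τ : ℍ) :
    slashGL k f (matW N) τ =
      (((N : ℝ) ^ ((k : ℝ) / 2) : ℝ) : ℂ) * (f ∣[k] S) (dilate N (natCast_pos N) τ) := by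
  rw [slashGL, ModularForm.SL_slash_apply, matW_smul, det_matW, denom_S, coe_dilate]
  simp [denom, matW]
  ring

/-- The product W(N)S is diagonal with entries -1 and -N, so f|W(N)|S is f(τ/N) up to a constant. -/
theorem slashGL_matW_slash_S (k : ℤ) (f : ℍ → ℂ) (τ : ℍ) :
    (slashGL k f (matW N) ∣[k] S) (dilate N (natCast_pos N) τ) =
      (-1) ^ k * (((N : ℝ) ^ (-((k : ℝ) / 2)) : ℝ) : ℂ) * f τ := by
  have hN := natCast_pos N
  have hN' : (N : ℂ) ≠ 0 := by exact_mod_cast NeZero.ne N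
  have hτ : (τ : ℂ) ≠ 0 := τ.ne_zero
  rw [ModularForm.SL_slash_apply, slashGL_matW_apply, ModularForm.SL_slash_apply]
  have h1 : S • dilate N hN (S • dilate N hN τ) = τ := by
    ext1
    rw [modular_S_smul, modular_S_smul]
    simp only [coe_dilate]
    simp
    field_simp
  have h2 : (dilate N hN (S • dilate N hN τ) : ℂ) = -1 / τ := by
    rw [coe_dilate, modular_S_smul]
    simp only [coe_dilate]
    simp
    field_simp
  rw [h1, denom_S, denom_S, h2, coe_dilate]
  have h3 : (((N : ℝ) ^ (-((k : ℝ) / 2)) : ℝ) : ℂ) =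
      (((N : ℝ) ^ ((k : ℝ) / 2) : ℝ) : ℂ) * (N : ℂ) ^ (-k) := by
    rw [show -((k : ℝ) / 2) = (k : ℝ) / 2 + ((-k : ℤ) : ℝ) by push_cast; ring,
      Real.rpow_add hN, Real.rpow_intCast]
    push_cast; rfl
  rw [h3]
  have h4 : (-1 / (τ : ℂ)) ^ (-k) * (((N : ℝ) : ℂ) * τ) ^ (-k) = (-1) ^ k * (N : ℂ) ^ (-k) := by
    rw [← mul_zpow, show (-1 / (τ : ℂ)) * (((N : ℝ) : ℂ) * τ) = (-1) * N by
      push_cast; field_simp, mul_zpow]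
    congr 1
    rw [zpow_neg, ← inv_zpow]; norm_num
  linear_combination (((N : ℝ) ^ ((k : ℝ) / 2) : ℝ) : ℂ) * f τ * h4

/-- This is a Hermite normal form of W(N)A, used to reduce the behaviour of g|W(N) at a cusp to that
of g at another one. -/
theorem exists_matW_mul_eq (A : SL(2, ℤ)) : ∃ (B : SL(2, ℤ)) (α δ : ℕ) (β : ℤ), α * δ = N ∧
    (!![0, -1; (N : ℤ), 0] * (A : Matrix (Fin 2) (Fin 2) ℤ)) =
      (B : Matrix (Fin 2) (Fin 2) ℤ) * !![(α : ℤ), β; 0, (δ : ℤ)] := by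
  have hN : (0 : ℤ) < N := by exact_mod_cast Nat.pos_of_ne_zero (NeZero.ne N)
  have hdet := A.det_coe
  rw [Matrix.det_fin_two] at hdet
  set a := A 0 0
  set b := A 0 1
  set c := A 1 0
  set d := A 1 1
  -- The first column of W(N)A is (-c, Na). Divided by its gcd g it becomes the first column (x, y)
  -- of B, which a Bézout relation completes; α = g, and β and δ come from applying B⁻¹ to the
  -- second column (-d, Nb).
  have hg0 : 0 < Int.gcd (-c) (N * a) := by
    apply Nat.pos_of_ne_zero
    intro h
    rw [Int.gcd_eq_zero_iff] at h
    have hc : c = 0 := by linarith [h.1]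
    have ha : a = 0 := (mul_eq_zero.mp h.2).resolve_left hN.ne'
    rw [hc, ha] at hdet
    simp at hdet
  obtain ⟨x, y, hcop, hx, hy⟩ := Int.exists_gcd_one hg0
  set g := Int.gcd (-c) (N * a)
  have hg : (0 : ℤ) < g := by exact_mod_cast hg0
  obtain ⟨v, u, huv⟩ := Int.isCoprime_iff_gcd_eq_one.mpr hcop
  have hδ : (g : ℤ) * (y * d + x * N * b) = N := by
    linear_combination -d * hy - N * b * hx + N * hdet
  have hδ0 : 0 ≤ y * d + x * N * b := by
    by_contra! h
    nlinarith
  obtain ⟨δ, hδ'⟩ := Int.eq_ofNat_of_zero_le hδ0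
  refine ⟨⟨!![x, -u; y, v], by rw [Matrix.det_fin_two_of]; linarith⟩, g, δ, -v * d + u * N * b,
    ?_, ?_⟩
  · rw [hδ'] at hδ
    exact_mod_cast hδ
  · ext i j
    fin_cases i <;> fin_cases j
    · simp [Matrix.mul_apply, Fin.sum_univ_two]
      linear_combination hx
    · simp [Matrix.mul_apply, Fin.sum_univ_two]
      rw [← hδ']
      linear_combination d * huv
    · simp [Matrix.mul_apply, Fin.sum_univ_two]
      linear_combination hy
    · simp [Matrix.mul_apply, Fin.sum_univ_two]
      rw [← hδ']
      linear_combination -N * b * huv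

/-- Writing W(N)A = BU with U upper triangular, the function is g|B at (ατ + β)/δ up to a constant.
This has an expansion in powers of q^(1/(Nδ)), and periodicity under τ ↦ τ + N removes the extra
denominator. -/
theorem exists_hasQExp_slash_matW {k : ℤ} {g : ℍ → ℂ}
    (hg : ∀ A : SL(2, ℤ), ∃ a, HasQExp N (g ∣[k] A) a) (A : SL(2, ℤ))
    (hper : ∀ τ, (slashGL k g (matW N) ∣[k] A) (T ^ (N : ℤ) • τ) =
      (slashGL k g (matW N) ∣[k] A) τ) :
    ∃ a, HasQExp N (slashGL k g (matW N) ∣[k] A) a := by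
  obtain ⟨B, α, δ, β, hαδ, hmat⟩ := exists_matW_mul_eq N A
  have hα : α ≠ 0 := fun h => NeZero.ne N (by rw [← hαδ, h, zero_mul])
  have hδ : δ ≠ 0 := fun h => NeZero.ne N (by rw [← hαδ, h, mul_zero])
  have : NeZero δ := ⟨hδ⟩
  obtain ⟨a, ha⟩ := hg B
  let U : GL (Fin 2) ℝ := Matrix.GeneralLinearGroup.mkOfDetNeZero !![(α : ℝ), β; 0, δ] (by
    rw [Matrix.det_fin_two_of]; simp [hα, hδ])
  have hUdet : U.det.val = N := by
    simp [U, Matrix.det_fin_two, ← hαδ]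
  have hUpos : 0 < U.det.val := by rw [hUdet]; exact natCast_pos N
  have hWA : matW N * (A : GL (Fin 2) ℝ) = (B : GL (Fin 2) ℝ) * U := by
    ext i j
    have := congrArg (fun X : Matrix (Fin 2) (Fin 2) ℤ => ((X i j : ℤ) : ℝ)) hmat
    simp only [Matrix.mul_apply, Fin.sum_univ_two] at this
    push_cast at this
    fin_cases i <;> fin_cases j <;>
      simpa [matW, U, Matrix.mul_apply, Fin.sum_univ_two] using this
  have h1 : ∀ τ : ℍ, ∃ τ' : ℍ, (τ' : ℂ) = (α * (τ : ℂ) + β) / δ ∧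
      (slashGL k g (matW N) ∣[k] A) τ =
        (((N : ℝ) ^ ((k : ℝ) / 2) * (δ : ℝ) ^ (-k) : ℝ) : ℂ) * (g ∣[k] B) τ' := by
    intro τ
    refine ⟨U • τ, ?_, ?_⟩
    · rw [coe_smul_of_det_pos hUpos]
      simp [num, denom, U]
    · have h2 : slashGL k g (matW N) ∣[k] A = slashGL k (g ∣[k] B) U := by
        rw [slashGL_eq k g (det_matW_pos N), slashGL_eq k (g ∣[k] B) hUpos, hUdet, det_matW,
          ModularForm.SL_smul_slash, ModularForm.SL_slash, ModularForm.SL_slash,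
          ← SlashAction.slash_mul, ← SlashAction.slash_mul, hWA]
      rw [h2, slashGL, hUdet]
      have : denom U τ = δ := by simp [denom, U]
      rw [this]
      push_cast
      ring
  obtain ⟨a', ha'⟩ := exists_hasQExp_comp (NeZero.ne N) hδ hα β
    (ha.smul (((N : ℝ) ^ ((k : ℝ) / 2) * (δ : ℝ) ^ (-k) : ℝ) : ℂ)) (g' := slashGL k g (matW N) ∣[k] A)
    fun τ => by
      obtain ⟨τ', h2, h3⟩ := h1 τ
      exact ⟨τ', h2, h3⟩
  exact exists_hasQExp_of_periodic ha' hper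

/-- W(N) normalizes Γ₀(N) and interchanges the diagonal entries. The hypothesis `hχ` says that χ
agrees on inverse classes, so the character is unchanged. -/
theorem slashGL_matW_slash_of_mem {k : ℤ} {g : ℍ → ℂ} {χ : ℤ → ℂ}
    (hχ : ∀ a d : ℤ, (N : ℤ) ∣ a * d - 1 → χ a = χ d)
    (hg : ∀ A ∈ CongruenceSubgroup.Gamma0 N, g ∣[k] A = χ (A 1 1) • g) {A : SL(2, ℤ)}
    (hA : A ∈ CongruenceSubgroup.Gamma0 N) :
    slashGL k g (matW N) ∣[k] A = χ (A 1 1) • slashGL k g (matW N) := by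
  have hA' := hA
  rw [CongruenceSubgroup.Gamma0_mem, ZMod.intCast_zmod_eq_zero_iff_dvd] at hA
  obtain ⟨c, hc⟩ := hA
  have hdet := A.det_coe
  rw [Matrix.det_fin_two] at hdet
  -- B is W(N) A W(N)⁻¹.
  obtain ⟨B, h00, h01, h10, h11⟩ : ∃ B : SL(2, ℤ), B 0 0 = A 1 1 ∧ B 0 1 = -c ∧
      B 1 0 = -(N * A 0 1) ∧ B 1 1 = A 0 0 :=
    ⟨⟨!![A 1 1, -c; -(N * A 0 1), A 0 0], by
      rw [Matrix.det_fin_two_of]; rw [hc] at hdet; linear_combination hdet⟩, rfl, rfl, rfl, rfl⟩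
  have hB : B ∈ CongruenceSubgroup.Gamma0 N := by
    rw [CongruenceSubgroup.Gamma0_mem, h10]
    simp
  have hWA : matW N * (A : GL (Fin 2) ℝ) = (B : GL (Fin 2) ℝ) * matW N := by
    have hc' : ((A 1 0 : ℤ) : ℝ) = N * c := by exact_mod_cast hc
    ext i j
    fin_cases i <;> fin_cases j <;>
      simp [matW, h00, h01, h10, h11, Matrix.mul_apply, Fin.sum_univ_two, hc', mul_comm]
  have h1 : χ (A 0 0) = χ (A 1 1) := hχ _ _ ⟨A 0 1 * c, by rw [hc] at hdet; linear_combination hdet⟩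
  rw [slashGL_eq k g (det_matW_pos N), ModularForm.SL_smul_slash, ModularForm.SL_slash,
    ← SlashAction.slash_mul, hWA, SlashAction.slash_mul, ← ModularForm.SL_slash, hg B hB, h11, h1,
    ModularForm.smul_slash, σ, if_pos (det_matW_pos N), smul_comm]
  rfl

end Slash

end WeilForms

/-! ### Rows modulo N and the functions g|A indexed by them -/

namespace WeilForms.LocalDecomp

open ModularGroup DiscriminantForm
open scoped ModularForm Manifold

variable {D : Type*} [AddCommGroup D] {𝔇 : DiscriminantForm D} {N : ℕ} {ι : Type}
    [Fintype ι] {p n : ι → ℕ} [∀ i, NeZero (n i)] {M : ι → Type*} [∀ i, AddCommGroup (M i)]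
    [∀ i, Fintype (M i)]

/-- Lower unipotent matrices. -/
def lowerUni (b : ℤ) : SL(2, ℤ) := ⟨!![1, 0; b, 1], by simp [Matrix.det_fin_two]⟩

theorem act_lowerUni (x : Rows n) (b : ℤ) :
    act x (lowerUni b) = fun i => ((x i).1 + (x i).2 * b, (x i).2) := by
  funext i; simp [act, lowerUni]

theorem act_T_zpow (x : Rows n) (b : ℤ) :
    act x (T ^ b) = fun i => ((x i).1, (x i).1 * b + (x i).2) := by
  funext i; simp [act, coe_T_zpow]

theorem act_mul (x : Rows n) (A B : SL(2, ℤ)) : act x (A * B) = act (act x A) B := by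
  funext i
  simp only [act, Matrix.SpecialLinearGroup.coe_mul, Matrix.mul_apply, Fin.sum_univ_two]
  push_cast
  ext <;> ring

theorem act_one (x : Rows n) : act x 1 = x := by
  funext i; simp [act]

theorem row_S : row n S = fun _ => (1, 0) := by
  funext i; simp [row, S]

/-- Transitivity, with a prescribed set of indices at which the matrix acts trivially. -/
theorem exists_act_eq (𝒟 : LocalDecomp 𝔇 N p n M) {x : Rows n} (hx : IsPrim x) (P : ι → Prop) :
    ∃ A : SL(2, ℤ), ∀ i, (P i → act (fun _ => (1, 0)) A i = x i) ∧
      (¬ P i → ∀ y : Rows n, act y A i = y i) := by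
  classical
  -- The row (1, 0) is taken by `T ^ a * lowerUni b * T ^ e` to (1 + ab, (1 + ab)e + a). One of e =
  -- 0 and e = -1 makes a = x₂ - x₁e a unit, after which b can be solved for. Where the action has
  -- to be trivial, a = b = e = 0.
  have key : ∀ i, ∃ a b e : ZMod (n i), (P i → (1 + a * b, (1 + a * b) * e + a) = x i) ∧
      (¬ P i → a = 0 ∧ b = 0 ∧ e = 0) := by
    intro i
    by_cases hP : P i
    · have main : ∀ a e : ZMod (n i), IsUnit a → (x i).1 * e + a = (x i).2 →
          ∃ a b e : ZMod (n i), (P i → (1 + a * b, (1 + a * b) * e + a) = x i) ∧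
            (¬ P i → a = 0 ∧ b = 0 ∧ e = 0) := by
        intro a e ha he
        refine ⟨a, a⁻¹ * ((x i).1 - 1), e, fun _ => ?_, fun h => absurd hP h⟩
        have : 1 + a * (a⁻¹ * ((x i).1 - 1)) = (x i).1 := by
          rw [← mul_assoc, ZMod.mul_inv_of_unit _ ha]; ring
        rw [this, he]
      by_cases hd : IsUnit (x i).2
      · exact main (x i).2 0 hd (by ring)
      · have hc := (hx i).resolve_right hd
        exact main ((x i).2 + (x i).1) (-1) ((𝒟.L i).isUnit_add hd hc) (by ring)
    · exact ⟨0, 0, 0, fun h => absurd h hP, fun _ => ⟨rfl, rfl, rfl⟩⟩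
  choose a b e h1 h2 using key
  obtain ⟨a', ha⟩ := 𝒟.exists_intCast a
  obtain ⟨b', hb⟩ := 𝒟.exists_intCast b
  obtain ⟨e', he⟩ := 𝒟.exists_intCast e
  refine ⟨T ^ a' * lowerUni b' * T ^ e', fun i => ⟨fun hP => ?_, fun hP y => ?_⟩⟩
  · rw [← h1 i hP, act_mul, act_mul]
    simp [act_T_zpow, act_lowerUni, ha, hb, he]
  · obtain ⟨h3, h4, h5⟩ := h2 i hP
    rw [act_mul, act_mul]
    simp [act_T_zpow, act_lowerUni, ha, hb, he, h3, h4, h5]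

theorem exists_row_eq (𝒟 : LocalDecomp 𝔇 N p n M) {x : Rows n} (hx : IsPrim x) :
    ∃ A : SL(2, ℤ), row n A = x := by
  obtain ⟨A, hA⟩ := 𝒟.exists_act_eq hx fun _ => True
  refine ⟨S * A, ?_⟩
  rw [row_mul, row_S]
  exact funext fun i => (hA i).1 trivial

theorem isPrim_act (𝒟 : LocalDecomp 𝔇 N p n M) {x : Rows n} (hx : IsPrim x) (A : SL(2, ℤ)) :
    IsPrim (act x A) := by
  obtain ⟨B, rfl⟩ := 𝒟.exists_row_eq hx
  rw [← row_mul]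
  exact 𝒟.isPrim_row _

theorem mem_Gamma0_iff (𝒟 : LocalDecomp 𝔇 N p n M) (A : SL(2, ℤ)) :
    A ∈ CongruenceSubgroup.Gamma0 N ↔ ∀ i, (row n A i).1 = 0 := by
  rw [CongruenceSubgroup.Gamma0_mem, ZMod.intCast_zmod_eq_zero_iff_dvd, 𝒟.intCast_dvd_iff]
  rfl

theorem row_mul_of_mem (𝒟 : LocalDecomp 𝔇 N p n M) {A : SL(2, ℤ)}
    (hA : A ∈ CongruenceSubgroup.Gamma0 N) (B : SL(2, ℤ)) :
    row n (A * B) = fun i => ((A 1 1 : ZMod (n i)) * (row n B i).1, (A 1 1 : ZMod (n i)) * (row n B i).2) := by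
  rw [𝒟.mem_Gamma0_iff] at hA
  rw [row_mul]
  funext i
  simp only [act, hA i, zero_mul, zero_add]
  rfl

theorem mul_inv_mem_of_row (𝒟 : LocalDecomp 𝔇 N p n M) {A B : SL(2, ℤ)} (l : ∀ i, ZMod (n i))
    (h : row n A = fun i => (l i * (row n B i).1, l i * (row n B i).2)) :
    A * B⁻¹ ∈ CongruenceSubgroup.Gamma0 N ∧ ∀ i, (((A * B⁻¹) 1 1 : ℤ) : ZMod (n i)) = l i := by
  have h1 : row n (A * B⁻¹) = fun i => (0, l i) := by
    rw [row_mul, h]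
    have h2 : act (row n B) B⁻¹ = fun i => (0, 1) := by
      rw [← row_mul, mul_inv_cancel]
      funext i; simp [row]
    funext i
    have h3 := congrFun h2 i
    simp only [act, Prod.mk.injEq] at h3 ⊢
    exact ⟨by linear_combination l i * h3.1, by linear_combination l i * h3.2⟩
  rw [𝒟.mem_Gamma0_iff]
  exact ⟨fun i => by rw [h1], fun i => congrArg Prod.snd (congrFun h1 i)⟩

/-- The functions `g ∣ A`, indexed by the bottom rows of `A`. -/
noncomputable def rowFun (n : ι → ℕ) (k : ℤ) (g : ℍ → ℂ) : Rows n → ℍ → ℂ :=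
  Function.extend (row n) (fun A : SL(2, ℤ) => g ∣[k] A) 0

/-- Two matrices with the same bottom row modulo N differ on the left by an element of Γ₀(N) with d
= 1 modulo N, on which the character is trivial. -/
theorem rowFun_row (𝒟 : LocalDecomp 𝔇 N p n M) {k : ℤ} {g : ℍ → ℂ}
    (hg : ∀ A ∈ CongruenceSubgroup.Gamma0 N, g ∣[k] A = (𝒟.chi (A 1 1) : ℂ) • g) (A : SL(2, ℤ)) :
    rowFun n k g (row n A) = g ∣[k] A := by
  refine Function.FactorsThrough.extend_apply (fun B C h => ?_) _ _
  obtain ⟨h1, h2⟩ := 𝒟.mul_inv_mem_of_row (A := B) (B := C) (fun _ => 1) (by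
    rw [h]; simp)
  have h3 : (𝒟.chi ((B * C⁻¹) 1 1) : ℂ) = 1 := by
    simp only [chi, h2, map_one, Finset.prod_const_one, Int.cast_one]
  have h4 := congrArg (· ∣[k] C) (hg _ h1)
  simp only [h3, one_smul, ← SlashAction.slash_mul, inv_mul_cancel_right] at h4
  exact h4

theorem rowFun_act (𝒟 : LocalDecomp 𝔇 N p n M) {k : ℤ} {g : ℍ → ℂ}
    (hg : ∀ A ∈ CongruenceSubgroup.Gamma0 N, g ∣[k] A = (𝒟.chi (A 1 1) : ℂ) • g) {x : Rows n}
    (hx : IsPrim x) (A : SL(2, ℤ)) : rowFun n k g (act x A) = rowFun n k g x ∣[k] A := by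
  obtain ⟨B, rfl⟩ := 𝒟.exists_row_eq hx
  rw [← row_mul, 𝒟.rowFun_row hg, 𝒟.rowFun_row hg, SlashAction.slash_mul]

theorem rowFun_smul (𝒟 : LocalDecomp 𝔇 N p n M) {k : ℤ} {g : ℍ → ℂ}
    (hg : ∀ A ∈ CongruenceSubgroup.Gamma0 N, g ∣[k] A = (𝒟.chi (A 1 1) : ℂ) • g) {x : Rows n}
    (hx : IsPrim x) (l : ∀ i, (ZMod (n i))ˣ) :
    rowFun n k g (fun i => (l i * (x i).1, l i * (x i).2)) =
      (∏ i, ((𝒟.L i).χ (l i) : ℂ)) • rowFun n k g x := by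
  obtain ⟨B, rfl⟩ := 𝒟.exists_row_eq hx
  obtain ⟨C, hC⟩ := 𝒟.exists_row_eq (x := fun i => (0, (l i : ZMod (n i))))
    fun i => Or.inr (l i).isUnit
  have hC' : C ∈ CongruenceSubgroup.Gamma0 N := (𝒟.mem_Gamma0_iff C).mpr fun i => by rw [hC]
  have hl : ∀ i, ((C 1 1 : ℤ) : ZMod (n i)) = l i := fun i => congrArg Prod.snd (congrFun hC i)
  have h1 := 𝒟.row_mul_of_mem hC' B
  simp only [hl] at h1
  rw [← h1, 𝒟.rowFun_row hg, SlashAction.slash_mul, hg C hC', ModularForm.SL_smul_slash,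
    𝒟.rowFun_row hg, chi]
  simp only [hl]
  push_cast
  rfl

/-- The slash operator as a linear map. -/
noncomputable def slashLin (k : ℤ) (A : SL(2, ℤ)) : (ℍ → ℂ) →ₗ[ℂ] (ℍ → ℂ) where
  toFun g := g ∣[k] A
  map_add' f g := SlashAction.add_slash k A f g
  map_smul' c f := ModularForm.SL_smul_slash k A f c

variable [DecidableEq ι]

theorem isPrim_update {x : Rows n} (hx : IsPrim x) {i : ι} {c d : ZMod (n i)}
    (h : IsUnit c ∨ IsUnit d) : IsPrim (Function.update x i (c, d)) := by
  intro j
  by_cases hj : j = i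
  · subst hj; simpa using h
  · simpa [hj] using hx j

theorem act_update_of_trivial {A : SL(2, ℤ)} {i : ι} (hA : ∀ y : Rows n, act y A i = y i)
    (x : Rows n) (v : ZMod (n i) × ZMod (n i)) :
    act (Function.update x i v) A = Function.update (act x A) i v := by
  funext j
  by_cases hj : j = i
  · subst hj; rw [hA]; simp
  · simp [act, hj]

theorem rowFun_update_smul (𝒟 : LocalDecomp 𝔇 N p n M) {k : ℤ} {g : ℍ → ℂ}
    (hg : ∀ A ∈ CongruenceSubgroup.Gamma0 N, g ∣[k] A = (𝒟.chi (A 1 1) : ℂ) • g) {x : Rows n}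
    (hx : IsPrim x) {i : ι} {l c d : ZMod (n i)} (hl : IsUnit l) (h : IsUnit c ∨ IsUnit d) :
    rowFun n k g (Function.update x i (l * c, l * d)) =
      ((𝒟.L i).χ l : ℂ) • rowFun n k g (Function.update x i (c, d)) := by
  have h1 := 𝒟.rowFun_smul hg (isPrim_update hx h) (Function.update 1 i hl.unit)
  rw [Finset.prod_eq_single i (fun j _ hj => by simp [hj])
    (fun h => absurd (Finset.mem_univ i) h)] at h1
  simp only [Function.update_self, IsUnit.unit_spec] at h1
  rw [← h1]
  congr 1
  funext j
  by_cases hj : j = i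
  · subst hj; simp
  · simp [hj]

/-- The relation between the functions in the `i`-th direction, given the vanishing of one
Fourier component. -/
theorem sum_rowFun_update (𝒟 : LocalDecomp 𝔇 N p n M) {k : ℤ} {g : ℍ → ℂ}
    (hg : ∀ A ∈ CongruenceSubgroup.Gamma0 N, g ∣[k] A = (𝒟.chi (A 1 1) : ℂ) • g) (i : ι)
    {m : ZMod (n i)} (hm : (𝒟.L i).χ m = -(𝒟.L i).η)
    (h0 : ∑ j : ZMod (n i), addPsi (n i) (-(j * m)) •
      rowFun n k g (Function.update (fun _ => (1, 0)) i (1, j)) = 0)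
    {x : Rows n} (hx : IsPrim x) :
    ∑ j : ZMod (n i), rowFun n k g (Function.update x i (j, 1)) =
      (𝒟.L i).s • rowFun n k g (Function.update x i (1, 0)) := by
  have he : IsPrim (fun _ => (1, 0) : Rows n) := fun _ => Or.inl isUnit_one
  -- With E equal to 1 modulo n i and to 0 modulo the other moduli, `T ^ E` and `lowerUni E` act at
  -- the index i only.
  obtain ⟨E, hE⟩ := 𝒟.exists_intCast (Function.update 0 i 1)
  have hEi : (E : ZMod (n i)) = 1 := by simp [hE]
  have hEj : ∀ j ≠ i, (E : ZMod (n j)) = 0 := fun j hj => by simp [hE, hj]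
  have hT : ∀ v : ZMod (n i) × ZMod (n i), act (Function.update (fun _ => (1, 0)) i v) (T ^ E) =
      Function.update (fun _ => (1, 0) : Rows n) i (v.1, v.1 + v.2) := by
    intro v
    rw [act_T_zpow]
    funext j
    by_cases hj : j = i
    · subst hj; simp [hEi]
    · simp [hj, hEj]
  have hTi : ∀ v : ZMod (n i) × ZMod (n i), act (Function.update (fun _ => (1, 0)) i v) (T ^ (-E)) =
      Function.update (fun _ => (1, 0) : Rows n) i (v.1, v.2 - v.1) := by
    intro v
    rw [act_T_zpow]
    funext j
    by_cases hj : j = i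
    · subst hj; simp [hEi]; ring
    · simp [hj, hEj]
  have hL : ∀ v : ZMod (n i) × ZMod (n i), act (Function.update (fun _ => (1, 0)) i v) (lowerUni E) =
      Function.update (fun _ => (1, 0) : Rows n) i (v.1 + v.2, v.2) := by
    intro v
    rw [act_lowerUni]
    funext j
    by_cases hj : j = i
    · subst hj; simp [hEi]
    · simp [hj]
  have h1 := (𝒟.L i).sum_row_eq
    (fun c d => rowFun n k g (Function.update (fun _ => (1, 0)) i (c, d)))
    (slashLin k (T ^ (-E) * lowerUni E * T ^ (-E))) (slashLin k (T ^ E))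
    -- The product T⁻¹ L T⁻¹, with L lower unipotent, takes (c, d) to (d, -c) and so plays the role
    -- of S at the index i.
    (fun c d hcd => by
      refine Eq.trans ?_ (𝒟.rowFun_act hg (isPrim_update he hcd) _)
      rw [act_mul, act_mul, hTi, hL, hTi]
      congr 3
      · ring
      · ring)
    (fun c d hcd => by
      refine Eq.trans ?_ (𝒟.rowFun_act hg (isPrim_update he hcd) _)
      rw [hT])
    (fun l c d hl hcd => 𝒟.rowFun_update_smul hg he hl hcd) hm h0
  -- The relation holds so far with (1, 0) at the other indices. A matrix that acts trivially at i
  -- and moves these rows to those of x transports it.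
  obtain ⟨A, hA⟩ := 𝒟.exists_act_eq hx fun j => j ≠ i
  have hAi : ∀ y : Rows n, act y A i = y i := (hA i).2 (by simp)
  have h2 : ∀ v : ZMod (n i) × ZMod (n i), (IsUnit v.1 ∨ IsUnit v.2) →
      slashLin k A (rowFun n k g (Function.update (fun _ => (1, 0)) i v)) =
        rowFun n k g (Function.update x i v) := by
    intro v hv
    refine (𝒟.rowFun_act hg (isPrim_update he hv) A).symm.trans ?_
    rw [act_update_of_trivial hAi]
    congr 1
    funext j
    by_cases hj : j = i
    · subst hj; simp
    · simp [hj, (hA j).1 hj]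
  have h3 := congrArg (slashLin k A) h1
  rw [map_sum, map_smul, h2 _ (Or.inl isUnit_one)] at h3
  rw [← h3]
  exact Finset.sum_congr rfl fun j _ => (h2 _ (Or.inr isUnit_one)).symm

theorem sum_piFinset_insert {α : ι → Type*} {V : Type*} [AddCommMonoid V] (Y : ∀ i, Finset (α i))
    (e : ∀ i, α i) {i : ι} {t : Finset ι} (hi : i ∉ t) (F : (∀ i, α i) → V) :
    ∑ x ∈ Fintype.piFinset (fun j => if j ∈ insert i t then Y j else {e j}), F x =
      ∑ x ∈ Fintype.piFinset (fun j => if j ∈ t then Y j else {e j}),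
        ∑ v ∈ Y i, F (Function.update x i v) := by
  rw [← Finset.sum_product']
  symm
  refine Finset.sum_bij' (fun z _ => Function.update z.1 i z.2)
    (fun x _ => (Function.update x i (e i), x i)) ?_ ?_ ?_ ?_ ?_
  · rintro ⟨x, v⟩ h
    rw [Finset.mem_product] at h
    rw [Fintype.mem_piFinset]
    intro j
    have h2 := Fintype.mem_piFinset.mp h.1 j
    by_cases hj : j = i
    · subst hj
      simpa using h.2
    · simpa [hj] using h2
  · intro x h
    rw [Finset.mem_product]
    constructor
    · rw [Fintype.mem_piFinset]
      intro j
      have h2 := Fintype.mem_piFinset.mp h j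
      by_cases hj : j = i
      · subst hj
        simp [hi]
      · simpa [hj] using h2
    · have h2 := Fintype.mem_piFinset.mp h i
      simpa using h2
  · rintro ⟨x, v⟩ h
    rw [Finset.mem_product] at h
    have h2 := Fintype.mem_piFinset.mp h.1 i
    simp only [hi, if_false, Finset.mem_singleton] at h2
    simp [← h2]
  · intro x h
    simp
  · rintro ⟨x, v⟩ h
    rfl

open Classical in
-- The weight is a product over the indices, so the sum is evaluated index by index: `sum_vec_smul`
-- replaces the sum over the rows at one prime by a multiple of the term with (1, 0) there.
theorem sum_isPrim_smul (𝒟 : LocalDecomp 𝔇 N p n M) {k : ℤ} {g : ℍ → ℂ}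
    (hg : ∀ A ∈ CongruenceSubgroup.Gamma0 N, g ∣[k] A = (𝒟.chi (A 1 1) : ℂ) • g)
    (hrel : ∀ i, ∀ x : Rows n, IsPrim x →
      ∑ j : ZMod (n i), rowFun n k g (Function.update x i (j, 1)) =
        (𝒟.L i).s • rowFun n k g (Function.update x i (1, 0))) :
    ∑ x : Rows n with IsPrim x, (∏ i, ∑ y, (𝒟.L i).vec (x i).1 (x i).2 y) • rowFun n k g x =
      (∏ i, (2 * Fintype.card (ZMod (n i))ˣ * (𝒟.L i).s)) • rowFun n k g (row n S) := by
  have he : IsPrim (fun _ => (1, 0) : Rows n) := fun _ => Or.inl isUnit_one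
  let Y : ∀ i, Finset (ZMod (n i) × ZMod (n i)) := fun i =>
    Finset.univ.filter fun v => IsUnit v.1 ∨ IsUnit v.2
  -- The rows in `X t` are free at the indices in t and frozen at (1, 0) elsewhere; the induction is
  -- on t.
  let X : Finset ι → ∀ i, Finset (ZMod (n i) × ZMod (n i)) := fun t i =>
    if i ∈ t then Y i else {(1, 0)}
  have hX : ∀ t, ∀ x ∈ Fintype.piFinset (X t), IsPrim x := by
    intro t x hx i
    have := Fintype.mem_piFinset.mp hx i
    simp only [X] at this
    split_ifs at this with h
    · simpa [Y] using this
    · rw [Finset.mem_singleton] at this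
      rw [this]; exact Or.inl isUnit_one
  have key : ∀ t : Finset ι, ∑ x ∈ Fintype.piFinset (X t),
      (∏ i ∈ t, ∑ y, (𝒟.L i).vec (x i).1 (x i).2 y) • rowFun n k g x =
      (∏ i ∈ t, (2 * Fintype.card (ZMod (n i))ˣ * (𝒟.L i).s)) • rowFun n k g (row n S) := by
    intro t
    induction t using Finset.induction_on with
    | empty =>
      have : Fintype.piFinset (X ∅) = {fun _ => (1, 0)} := by
        simp only [X, Finset.notMem_empty, if_false]
        exact Fintype.piFinset_singleton _
      rw [this, row_S]
      simp
    | insert i t hi ih =>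
      rw [sum_piFinset_insert _ _ hi, Finset.prod_insert hi, mul_smul, ← ih, Finset.smul_sum]
      refine Finset.sum_congr rfl fun x hx => ?_
      have hxp := hX t x hx
      have hxi := Fintype.mem_piFinset.mp hx i
      simp only [X, hi, if_false, Finset.mem_singleton] at hxi
      have h1 : ∀ v, ∏ j ∈ t, ∑ y, (𝒟.L j).vec (Function.update x i v j).1
          (Function.update x i v j).2 y = ∏ j ∈ t, ∑ y, (𝒟.L j).vec (x j).1 (x j).2 y :=
        fun v => Finset.prod_congr rfl fun j hj => by
          have : j ≠ i := fun h => hi (h ▸ hj)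
          rw [Function.update_of_ne this]
      simp only [Finset.prod_insert hi, Function.update_self, h1]
      have h2 := (𝒟.L i).sum_vec_smul (fun c d => rowFun n k g (Function.update x i (c, d)))
        (fun l c d hl hcd => 𝒟.rowFun_update_smul hg hxp hl hcd) (hrel i x hxp)
      rw [← hxi, Function.update_eq_self] at h2
      rw [smul_comm, ← h2, Finset.smul_sum]
      exact Finset.sum_congr rfl fun v _ => by rw [mul_comm, mul_smul]
  convert key Finset.univ using 2
  ext x
  rw [Finset.mem_filter]
  simp [X, Y, Fintype.mem_piFinset, IsPrim]

end WeilForms.LocalDecomp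

/-! ### The map ψ, and φψ = 1 -/

namespace WeilForms.LocalDecomp

open ModularGroup DiscriminantForm
open scoped ModularForm Manifold

variable {D : Type*} [AddCommGroup D] {𝔇 : DiscriminantForm D} {N : ℕ} {ι : Type}
    [Fintype ι] {p n : ι → ℕ} [∀ i, NeZero (n i)] {M : ι → Type*} [∀ i, AddCommGroup (M i)]
    [∀ i, Fintype (M i)]

open Classical in
-- Every primitive row is in exactly one way a family of units times the bottom row of a
-- representative of Γ₀(N)\SL₂(ℤ).
theorem sum_isPrim_eq [DecidableEq ι] (𝒟 : LocalDecomp 𝔇 N p n M) {V : Type*} [AddCommMonoid V] {R : Finset SL(2, ℤ)}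
    (hR : Subgroup.IsComplement (CongruenceSubgroup.Gamma0 N : Set SL(2, ℤ)) (R : Set SL(2, ℤ)))
    (Θ : Rows n → V) (hΘ : ∀ x, IsPrim x → ∀ l : ∀ i, (ZMod (n i))ˣ,
      Θ (fun i => ((l i : ZMod (n i)) * (x i).1, (l i : ZMod (n i)) * (x i).2)) = Θ x) :
    ∑ x : Rows n with IsPrim x, Θ x =
      (∏ i, Fintype.card (ZMod (n i))ˣ) • ∑ A ∈ R, Θ (row n A) := by
  have h1 : (∏ i, Fintype.card (ZMod (n i))ˣ) • ∑ A ∈ R, Θ (row n A) =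
      ∑ z ∈ (Finset.univ : Finset (∀ i, (ZMod (n i))ˣ)) ×ˢ R, Θ (row n z.2) := by
    rw [Finset.sum_product]
    simp only
    rw [Finset.sum_const, Finset.card_univ, Fintype.card_pi]
  rw [h1]
  symm
  refine Finset.sum_nbij
    (fun z => fun i => (z.1 i * (row n z.2 i).1, z.1 i * (row n z.2 i).2)) ?_ ?_ ?_ ?_
  · rintro ⟨l, A⟩ -
    rw [Finset.mem_filter]
    refine ⟨Finset.mem_univ _, fun i => ?_⟩
    simpa using 𝒟.isPrim_row A i
  · rintro ⟨l, A⟩ hA ⟨l', A'⟩ hA' h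
    rw [Finset.mem_coe, Finset.mem_product] at hA hA'
    simp only at h
    have h2 : row n A = fun i => ((((l i)⁻¹ * l' i : (ZMod (n i))ˣ) : ZMod (n i)) * (row n A' i).1,
        (((l i)⁻¹ * l' i : (ZMod (n i))ˣ) : ZMod (n i)) * (row n A' i).2) := by
      funext i
      have := congrFun h i
      simp only [Prod.mk.injEq] at this
      ext
      · push_cast
        rw [mul_assoc, ← this.1, Units.inv_mul_cancel_left]
      · push_cast
        rw [mul_assoc, ← this.2, Units.inv_mul_cancel_left]
    have h3 := (𝒟.mul_inv_mem_of_row _ h2).1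
    have h4 : A = A' := by
      have := hR.1 (a₁ := (⟨A * A'⁻¹, h3⟩, ⟨A', hA'.2⟩)) (a₂ := (⟨1, one_mem _⟩, ⟨A, hA.2⟩))
        (by simp)
      exact (congrArg (fun z => (z.2 : SL(2, ℤ))) this).symm
    subst h4
    have h5 := (𝒟.mul_inv_mem_of_row _ h2).2
    rw [mul_inv_cancel] at h5
    simp only [Prod.mk.injEq, and_true]
    funext i
    have h6 := h5 i
    simp only [Matrix.SpecialLinearGroup.coe_one, Matrix.one_apply_eq, Int.cast_one] at h6
    have h7 : (l i)⁻¹ * l' i = 1 := Units.ext h6.symm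
    rwa [inv_mul_eq_one] at h7
  · intro x hx
    have hx : IsPrim x := by simpa using hx
    obtain ⟨B, rfl⟩ := 𝒟.exists_row_eq hx
    obtain ⟨⟨⟨γ, hγ⟩, ⟨A, hA⟩⟩, h2⟩ := hR.2 B
    simp only at h2
    have hu : ∀ i, IsUnit ((γ 1 1 : ℤ) : ZMod (n i)) := by
      intro i
      refine (𝒟.isPrim_row γ i).resolve_left fun h => ?_
      rw [(𝒟.mem_Gamma0_iff γ).mp hγ i] at h
      exact (𝒟.L i).ne_zero_of_isUnit h rfl
    refine ⟨(fun i => (hu i).unit, A), by simpa using hA, ?_⟩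
    rw [← h2, 𝒟.row_mul_of_mem hγ]
    rfl
  · rintro ⟨l, A⟩ -
    exact (hΘ _ (𝒟.isPrim_row A) l).symm

/-- The local characters are quadratic, hence equal at inverse units. -/
theorem chi_congr (𝒟 : LocalDecomp 𝔇 N p n M) (a d : ℤ) (h : (N : ℤ) ∣ a * d - 1) :
    (𝒟.chi a : ℂ) = 𝒟.chi d := by
  rw [𝒟.intCast_dvd_iff] at h
  have : ∀ i, (𝒟.L i).χ (a : ZMod (n i)) = (𝒟.L i).χ (d : ZMod (n i)) := by
    intro i
    have h1 : (a : ZMod (n i)) * d = 1 := by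
      have := h i
      push_cast at this
      exact sub_eq_zero.mp this
    have hd : IsUnit (d : ZMod (n i)) := IsUnit.of_mul_eq_one_right _ h1
    rw [← (𝒟.L i).chi_inv hd]
    congr 1
    apply hd.mul_right_cancel
    rw [h1, ZMod.inv_mul_of_unit _ hd]
  simp only [chi, this]

section

variable [NeZero N]

theorem slashGL_matW_slash (𝒟 : LocalDecomp 𝔇 N p n M) {k : ℤ} {f : ℍ → ℂ}
    (hf : ∀ A ∈ CongruenceSubgroup.Gamma0 N, f ∣[k] A = (𝒟.chi (A 1 1) : ℂ) • f) :
    ∀ A ∈ CongruenceSubgroup.Gamma0 N,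
      slashGL k f (matW N) ∣[k] A = (𝒟.chi (A 1 1) : ℂ) • slashGL k f (matW N) := fun _ hA =>
  slashGL_matW_slash_of_mem N (χ := fun m => (𝒟.chi m : ℂ)) 𝒟.chi_congr hf hA

/-- The expansion of f|W(N)|S in powers of q^(1/N) has the coefficients of f up to a constant.
Averaging over translations that only affect the index i isolates a class in which they vanish,
which is the hypothesis of `sum_rowFun_update`. -/
theorem sum_rowFun_eq [DecidableEq ι] (𝒟 : LocalDecomp 𝔇 N p n M) {k : ℤ} {f : ℍ → ℂ}
    (hf : ∀ A ∈ CongruenceSubgroup.Gamma0 N, f ∣[k] A = (𝒟.chi (A 1 1) : ℂ) • f) {a : ℤ → ℂ}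
    (ha : HasQExp 1 f a)
    (hv : ∀ i, ∀ m : ℤ, (𝒟.L i).χ (m * cofInv n i) = -(𝒟.L i).η → a m = 0) (i : ι)
    {x : Rows n} (hx : IsPrim x) :
    ∑ j : ZMod (n i), rowFun n k (slashGL k f (matW N)) (Function.update x i (j, 1)) =
        (𝒟.L i).s • rowFun n k (slashGL k f (matW N)) (Function.update x i (1, 0)) := by
  -- A value -η is needed: a nonresidue if η = 1, and m = 1 if η = -1.
  obtain ⟨m, hm⟩ : ∃ m, (𝒟.L i).χ m = -(𝒟.L i).η := by
    rcases (𝒟.L i).eta_eq with h | h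
    · obtain ⟨m, hm⟩ := (𝒟.L i).exists_neg
      exact ⟨m, by rw [hm, h]⟩
    · exact ⟨1, by rw [map_one, h]; rfl⟩
  refine 𝒟.sum_rowFun_update (𝒟.slashGL_matW_slash hf) i hm ?_ hx
  obtain ⟨c, hc⟩ := ZMod.intCast_surjective (cofInv n i)
  have hN : (N : ℂ) ≠ 0 := by exact_mod_cast NeZero.ne N
  have hNn : (N : ℂ) = n i * cof n i := by exact_mod_cast (𝒟.mul_cof i).symm
  let g := slashGL k f (matW N) ∣[k] S
  let b : ℤ → ℂ := fun m => (-1) ^ k * (((N : ℝ) ^ (-((k : ℝ) / 2)) : ℝ) : ℂ) * a m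
  have hg : ∀ τ : ℍ, HasSum (fun m : ℤ => b m *
      Complex.exp (2 * Real.pi * Complex.I * (m / N) * τ)) (g τ) := by
    intro τ
    obtain ⟨τ', rfl⟩ : ∃ τ', dilate N (natCast_pos N) τ' = τ := by
      refine ⟨dilate (N : ℝ)⁻¹ (inv_pos.mpr (natCast_pos N)) τ, ?_⟩
      ext1
      rw [coe_dilate, coe_dilate]
      push_cast
      field_simp
    simp only [g]
    rw [slashGL_matW_slash_S]
    refine ((ha.2 τ').mul_left _).congr_fun fun m => ?_
    simp only [b]
    rw [coe_dilate, mul_assoc]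
    congr 3
    push_cast
    field_simp
  have hu : ∀ l : ℤ, Complex.exp (2 * Real.pi * Complex.I * (l * (cof n i * c : ℤ) / N)) =
      addPsi (n i) ((l * c : ℤ) : ZMod (n i)) := by
    intro l
    rw [addPsi_intCast]
    congr 1
    rw [hNn] at hN ⊢
    have h1 := left_ne_zero_of_mul hN
    have h2 := right_ne_zero_of_mul hN
    push_cast
    field_simp
  -- The integer c inverts the cofactor modulo n i, so this translation takes (1, 0) to (1, j) at i
  -- and fixes the rows at the other indices.
  have hE : ∀ j : ZMod (n i), act (row n S) (T ^ ((cof n i * c : ℤ) * j.val)) =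
      (Function.update (fun _ => (1, 0)) i (1, j) : Rows n) := by
    intro j
    rw [act_T_zpow, row_S]
    funext i'
    by_cases h : i' = i
    · subst h
      have := 𝒟.cof_mul_cofInv i'
      simp only [Int.cast_mul, hc, Int.cast_natCast, one_mul, add_zero, Function.update_self,
        ZMod.natCast_zmod_val, this]
    · simp [h, cof_eq_zero h]
  funext τ
  have h1 := hasSum_average (n i) hg _ _ hu m τ
  have h2 : ∀ l : ℤ, (if ((l * c : ℤ) : ZMod (n i)) = m then
      n i * (b l * Complex.exp (2 * Real.pi * Complex.I * (l / N) * τ)) else 0) = 0 := by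
    intro l
    split_ifs with h
    · rw [Int.cast_mul, hc] at h
      simp [b, hv i l (by rw [h, hm])]
    · rfl
  simp only [h2] at h1
  rw [Finset.sum_apply, Pi.zero_apply, ← h1.unique hasSum_zero]
  refine Finset.sum_congr rfl fun j _ => ?_
  rw [← hE, Pi.smul_apply, 𝒟.rowFun_act (𝒟.slashGL_matW_slash hf) (𝒟.isPrim_row S),
    slash_T_zpow_apply, 𝒟.rowFun_row (𝒟.slashGL_matW_slash hf)]
  rfl

/-- Summation of the components of `∑ (f ∣ W(N) ∣ A) ρ(A⁻¹) e₀`. -/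
theorem sum_row_reps [DecidableEq ι] [Fintype D] (𝒟 : LocalDecomp 𝔇 N p n M) {k : ℤ} {f : ℍ → ℂ}
    (hf : ∀ A ∈ CongruenceSubgroup.Gamma0 N, f ∣[k] A = (𝒟.chi (A 1 1) : ℂ) • f) {a : ℤ → ℂ}
    (ha : HasQExp 1 f a)
    (hv : ∀ i, ∀ m : ℤ, (𝒟.L i).χ (m * cofInv n i) = -(𝒟.L i).η → a m = 0)
    {R : Finset SL(2, ℤ)}
    (hR : Subgroup.IsComplement (CongruenceSubgroup.Gamma0 N : Set SL(2, ℤ)) (R : Set SL(2, ℤ))) :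
    ∑ A ∈ R, (∑ γ, 𝒟.vecs (row n A) γ) • (slashGL k f (matW N) ∣[k] A) =
      (2 ^ Fintype.card ι * ∑ γ, e (𝔇.q γ)) • (slashGL k f (matW N) ∣[k] S) := by
  classical
  have hg := 𝒟.slashGL_matW_slash hf
  have h1 := 𝒟.sum_isPrim_smul hg fun i x hx => 𝒟.sum_rowFun_eq hf ha hv i hx
  have h2 : ∀ x : Rows n, ∏ i, ∑ y, (𝒟.L i).vec (x i).1 (x i).2 y = ∑ γ, 𝒟.vecs x γ := fun x =>
    (𝒟.sum_prod fun i y => (𝒟.L i).vec (x i).1 (x i).2 y).symm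
  simp only [h2] at h1
  rw [𝒟.sum_isPrim_eq hR (fun x => (∑ γ, 𝒟.vecs x γ) • rowFun n k (slashGL k f (matW N)) x) ?_]
    at h1
  · simp only [𝒟.rowFun_row hg] at h1
    have h3 : ((∏ i, Fintype.card (ZMod (n i))ˣ : ℕ) : ℂ) ≠ 0 := by
      rw [Nat.cast_ne_zero]
      exact Finset.prod_ne_zero_iff.mpr fun i _ => Fintype.card_ne_zero
    rw [← Nat.cast_smul_eq_nsmul ℂ] at h1
    apply smul_right_injective _ h3
    simp only
    rw [h1, smul_smul, 𝒟.gauss_eq, Finset.prod_mul_distrib, Finset.prod_mul_distrib,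
      Finset.prod_const, Finset.card_univ]
    push_cast
    congr 1
    ring
  · intro x hx l
    rw [𝒟.rowFun_smul hg hx]
    simp only [𝒟.vecs_smul hx]
    rw [← Finset.mul_sum, smul_smul, mul_right_comm, ← Finset.prod_mul_distrib,
      Finset.prod_congr rfl fun i _ => (𝒟.L i).chi_mul_self (l i).isUnit, Finset.prod_const_one,
      one_mul]

theorem slash_eq_of_row_eq (𝒟 : LocalDecomp 𝔇 N p n M) {k : ℤ} {g : ℍ → ℂ}
    (hg : ∀ A ∈ CongruenceSubgroup.Gamma0 N, g ∣[k] A = (𝒟.chi (A 1 1) : ℂ) • g) {A B : SL(2, ℤ)}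
    (h : row n A = row n B) : g ∣[k] A = g ∣[k] B := by
  rw [← 𝒟.rowFun_row hg, ← 𝒟.rowFun_row hg, h]

theorem slash_periodic (𝒟 : LocalDecomp 𝔇 N p n M) {k : ℤ} {g : ℍ → ℂ}
    (hg : ∀ A ∈ CongruenceSubgroup.Gamma0 N, g ∣[k] A = (𝒟.chi (A 1 1) : ℂ) • g) (A : SL(2, ℤ))
    (τ : ℍ) : (g ∣[k] A) (T ^ (N : ℤ) • τ) = (g ∣[k] A) τ := by
  rw [← slash_T_zpow_apply k N (g ∣[k] A), ← SlashAction.slash_mul]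
  refine congrFun (𝒟.slash_eq_of_row_eq hg ?_) τ
  rw [row_mul, act_T_zpow]
  have : ∀ i, (N : ZMod (n i)) = 0 := fun i => by
    simpa using (𝒟.intCast_dvd_iff N).mp dvd_rfl i
  simp [this]

theorem psi_apply [Fintype D] (𝒟 : LocalDecomp 𝔇 N p n M) {r : ℤ} (hr : 𝔇.HasSignature r)
    (hr2 : Even r) (k : ℤ) (R : Finset SL(2, ℤ)) (f : ℍ → ℂ) (γ : D) :
    (fun τ => psi N r k (𝔇.weilRep hr hr2) R f τ γ) =
      (Complex.I ^ (r / 2) * (((N : ℝ) ^ (((k : ℝ) - 1) / 2) : ℝ) : ℂ)) •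
        ∑ A ∈ R, 𝒟.vecs (row n A) γ • (slashGL k f (matW N) ∣[k] A) := by
  funext τ
  simp only [psi, Pi.smul_apply, Finset.sum_apply, 𝒟.weilRep_inv_single, smul_eq_mul]
  congr 1
  exact Finset.sum_congr rfl fun A _ => mul_comm _ _

/-- The sum over representatives is a multiple of a sum over all primitive rows, because the two
occurrences of the character cancel under scaling. On primitive rows B acts by a permutation, and
ρ(B) takes the vector of the row xB to that of x. -/
theorem psi_slash [Fintype D] (𝒟 : LocalDecomp 𝔇 N p n M) {r : ℤ} (hr : 𝔇.HasSignature r)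
    (hr2 : Even r) {k : ℤ} {f : ℍ → ℂ}
    (hf : ∀ A ∈ CongruenceSubgroup.Gamma0 N, f ∣[k] A = (𝒟.chi (A 1 1) : ℂ) • f)
    {R : Finset SL(2, ℤ)}
    (hR : Subgroup.IsComplement (CongruenceSubgroup.Gamma0 N : Set SL(2, ℤ)) (R : Set SL(2, ℤ)))
    (B : SL(2, ℤ)) (τ : ℍ) :
    (fun γ => ((fun z => psi N r k (𝔇.weilRep hr hr2) R f z γ) ∣[k] B) τ) =
      𝔇.weilRep hr hr2 B (psi N r k (𝔇.weilRep hr hr2) R f τ) := by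
  classical
  have hg := 𝒟.slashGL_matW_slash hf
  let Θ : Rows n → D → ℂ := fun x => rowFun n k (slashGL k f (matW N)) x τ • 𝒟.vecs x
  let Θ' : Rows n → D → ℂ := fun x =>
    rowFun n k (slashGL k f (matW N)) (act x B) τ • 𝒟.vecs x
  have hχ : ∀ l : ∀ i, (ZMod (n i))ˣ,
      (∏ i, ((𝒟.L i).χ (l i) : ℂ)) * ∏ i, ((𝒟.L i).χ (l i) : ℂ) = 1 := by
    intro l
    rw [← Finset.prod_mul_distrib,
      Finset.prod_congr rfl fun i _ => (𝒟.L i).chi_mul_self (l i).isUnit, Finset.prod_const_one]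
  have hΘ := 𝒟.sum_isPrim_eq hR Θ fun x hx l => by
    funext γ
    simp only [Θ, 𝒟.rowFun_smul hg hx, Pi.smul_apply, 𝒟.vecs_smul hx, smul_eq_mul]
    linear_combination rowFun n k (slashGL k f (matW N)) x τ * 𝒟.vecs x γ * hχ l
  have hact : ∀ (x : Rows n) (l : ∀ i, (ZMod (n i))ˣ),
      act (fun i => ((l i : ZMod (n i)) * (x i).1, (l i : ZMod (n i)) * (x i).2)) B =
        fun i => (l i * (act x B i).1, l i * (act x B i).2) := by
    intro x l
    funext i
    simp only [act, Prod.mk.injEq]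
    constructor <;> ring
  have hΘ' := 𝒟.sum_isPrim_eq hR Θ' fun x hx l => by
    funext γ
    simp only [Θ', hact, 𝒟.rowFun_smul hg (𝒟.isPrim_act hx B), Pi.smul_apply, 𝒟.vecs_smul hx,
      smul_eq_mul]
    linear_combination rowFun n k (slashGL k f (matW N)) (act x B) τ * 𝒟.vecs x γ * hχ l
  have hρ : ∀ x : Rows n, IsPrim x → 𝔇.weilRep hr hr2 B (𝒟.vecs (act x B)) = 𝒟.vecs x := by
    intro x hx
    obtain ⟨A, rfl⟩ := 𝒟.exists_row_eq hx
    rw [← row_mul, ← 𝒟.weilRep_inv_single hr hr2, ← 𝒟.weilRep_inv_single hr hr2, mul_inv_rev,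
      map_mul, Module.End.mul_apply, ← Module.End.mul_apply, ← map_mul, mul_inv_cancel, map_one,
      Module.End.one_apply]
  have h3 : ((∏ i, Fintype.card (ZMod (n i))ˣ : ℕ) : ℂ) ≠ 0 := by
    rw [Nat.cast_ne_zero]
    exact Finset.prod_ne_zero_iff.mpr fun i _ => Fintype.card_ne_zero
  have hsum : 𝔇.weilRep hr hr2 B (∑ A ∈ R, Θ (row n A)) = ∑ A ∈ R, Θ' (row n A) := by
    apply smul_right_injective _ h3
    simp only [Nat.cast_smul_eq_nsmul]
    rw [← map_nsmul, ← hΘ, ← hΘ', map_sum]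
    symm
    refine Finset.sum_nbij (fun x => act x B) ?_ ?_ ?_ ?_
    · intro x hx
      rw [Finset.mem_filter] at hx ⊢
      exact ⟨Finset.mem_univ _, 𝒟.isPrim_act hx.2 B⟩
    · intro x _ y _ h
      have := congrArg (act · B⁻¹) h
      simpa only [← act_mul, mul_inv_cancel, act_one] using this
    · intro x hx
      have hx : IsPrim x := by simpa using hx
      refine ⟨act x B⁻¹, by simpa using 𝒟.isPrim_act hx _, ?_⟩
      simp only [← act_mul, inv_mul_cancel, act_one]
    · intro x hx
      rw [Finset.mem_filter] at hx
      simp only [Θ, Θ', map_smul, hρ x hx.2]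
  have h4 : psi N r k (𝔇.weilRep hr hr2) R f τ =
      (Complex.I ^ (r / 2) * (((N : ℝ) ^ (((k : ℝ) - 1) / 2) : ℝ) : ℂ)) •
        ∑ A ∈ R, Θ (row n A) := by
    simp only [psi, Θ, 𝒟.rowFun_row hg, 𝒟.weilRep_inv_single]
  rw [h4, map_smul, hsum]
  funext γ
  rw [𝒟.psi_apply, ModularForm.SL_smul_slash, SlashAction.sum_slash]
  simp only [Pi.smul_apply, Finset.sum_apply, Θ', ← row_mul, 𝒟.rowFun_row hg,
    ModularForm.SL_smul_slash, ← SlashAction.slash_mul, smul_eq_mul]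
  congr 1
  exact Finset.sum_congr rfl fun A _ => mul_comm _ _

theorem psi_mem [Fintype D] (𝒟 : LocalDecomp 𝔇 N p n M) (hN : 𝔇.level = N) {r : ℤ}
    (hr : 𝔇.HasSignature r) (hr2 : Even r) {k : ℤ} {f : ℍ → ℂ} (hd : MDiff f)
    (hf : ∀ A ∈ CongruenceSubgroup.Gamma0 N, f ∣[k] A = (𝒟.chi (A 1 1) : ℂ) • f)
    (hq : ∀ A : SL(2, ℤ), ∃ a, HasQExp N (f ∣[k] A) a)
    {R : Finset SL(2, ℤ)}
    (hR : Subgroup.IsComplement (CongruenceSubgroup.Gamma0 N : Set SL(2, ℤ)) (R : Set SL(2, ℤ))) :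
    psi N r k (𝔇.weilRep hr hr2) R f ∈ vvFormsInv 𝔇 k (𝔇.weilRep hr hr2) := by
  have hg := 𝒟.slashGL_matW_slash hf
  refine ⟨⟨𝒟.psi_slash hr hr2 hf hR, fun γ => ⟨?_, ?_⟩⟩, fun σ hσ τ γ => ?_⟩
  · rw [𝒟.psi_apply]
    refine MDifferentiable.const_smul _ ?_
    have : ∀ s : Finset SL(2, ℤ),
        MDiff (∑ A ∈ s, 𝒟.vecs (row n A) γ • (slashGL k f (matW N) ∣[k] A)) := by
      intro s
      induction s using Finset.induction_on with
      | empty => exact mdifferentiable_const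
      | insert A s hA ih =>
        rw [Finset.sum_insert hA]
        refine MDifferentiable.add ?_ ih
        refine MDifferentiable.const_smul _ ?_
        rw [slashGL_eq k f (det_matW_pos N), ModularForm.SL_slash]
        exact ((hd.slash k _).const_smul _).slash k _
    exact this R
  · rw [𝒟.psi_apply, hN]
    obtain ⟨a, ha⟩ := exists_hasQExp_sum N R
      (g := fun A => 𝒟.vecs (row n A) γ • (slashGL k f (matW N) ∣[k] A)) fun A _ => by
        obtain ⟨a, ha⟩ := exists_hasQExp_slash_matW N hq A (𝒟.slash_periodic hg A)
        exact ⟨_, ha.smul _⟩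
    exact ⟨_, ha.smul _⟩
  · classical
    have h1 : ∀ A : SL(2, ℤ), 𝔇.weilRep hr hr2 A (Pi.single 0 1) (σ γ) =
        𝔇.weilRep hr hr2 A (Pi.single 0 1) γ := by
      intro A
      have h2 := congrFun (𝔇.weilRep_comp_aut hr hr2 hσ A (Pi.single 0 1)) γ
      have h3 : (Pi.single 0 1 : D → ℂ) ∘ σ = Pi.single 0 1 := by
        funext x
        simp [Pi.single_apply]
      rw [h3] at h2
      exact h2.symm
    simp only [psi, Pi.smul_apply, Finset.sum_apply]
    congr 1
    refine Finset.sum_congr rfl fun A _ => ?_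
    congr 1
    convert h1 A⁻¹

/-- The component (ρ(S)F)₀ is a multiple of the sum of all F_γ since (0, γ) = 0; the constants in φ
are chosen so that only the power of 2 remains. -/
theorem phi_apply [Fintype D] (𝒟 : LocalDecomp 𝔇 N p n M) {r : ℤ}
    (hr : 𝔇.HasSignature r) (hr2 : Even r) {k : ℤ} {F : ℍ → D → ℂ}
    (hF : F ∈ vvForms 𝔇 k (𝔇.weilRep hr hr2)) (τ : ℍ) :
    phi N r k F τ = 2 ^ (-(N.primeFactors.card : ℤ)) * ∑ γ, F (dilate N (natCast_pos N) τ) γ := by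
  have h1 := congrFun (hF.1 S (dilate N (natCast_pos N) τ)) 0
  rw [phi, Pi.smul_apply, slashGL_matW_apply, h1, 𝔇.weilRep_S_eq]
  simp only [opS, LinearMap.coe_mk, AddHom.coe_mk]
  have h2 : ∀ β, 𝔇.b 0 β = 0 := fun β => by simp [b, QuadraticMap.polar]
  simp only [h2, neg_zero, e_zero, one_mul, 𝒟.card_eq, smul_eq_mul]
  have h3 : Complex.I ^ (r / 2) * Complex.I ^ (-(r / 2)) = 1 := by
    rw [← zpow_add₀ Complex.I_ne_zero]; simp
  have hN := natCast_pos N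
  have h4 : (N : ℝ) ^ (-(((k : ℝ) - 1) / 2)) * (N : ℝ) ^ ((k : ℝ) / 2) = Real.sqrt N := by
    rw [← Real.rpow_add hN, Real.sqrt_eq_rpow]
    congr 1
    ring
  have h5 : ((Real.sqrt N : ℝ) : ℂ) ≠ 0 := by
    exact_mod_cast (Real.sqrt_pos.mpr hN).ne'
  have h6 : (((N : ℝ) ^ (-(((k : ℝ) - 1) / 2)) : ℝ) : ℂ) * (((N : ℝ) ^ ((k : ℝ) / 2) : ℝ) : ℂ) =
    ((Real.sqrt N : ℝ) : ℂ) := by exact_mod_cast h4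
  have h7 := mul_inv_cancel₀ h5
  set X := ∑ γ, F (dilate N (natCast_pos N) τ) γ
  set u := (((N : ℝ) ^ (-(((k : ℝ) - 1) / 2)) : ℝ) : ℂ)
  set v := (((N : ℝ) ^ ((k : ℝ) / 2) : ℝ) : ℂ)
  set w := (2 : ℂ) ^ (-(N.primeFactors.card : ℤ))
  clear_value X u v w
  linear_combination w * X * (u * v * ((Real.sqrt N : ℝ) : ℂ)⁻¹) * h3 +
    w * X * ((Real.sqrt N : ℝ) : ℂ)⁻¹ * h6 + w * X * h7

theorem phi_psi [DecidableEq ι] [Fintype D] (𝒟 : LocalDecomp 𝔇 N p n M) (hN : 𝔇.level = N)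
    (hω : Fintype.card ι = N.primeFactors.card) {r : ℤ}
    (hr : 𝔇.HasSignature r) (hr2 : Even r) {k : ℤ} (hk : k ≡ r / 2 [ZMOD 2])
    {f : ℍ → ℂ} (hd : MDiff f)
    (hf : ∀ A ∈ CongruenceSubgroup.Gamma0 N, f ∣[k] A = (𝒟.chi (A 1 1) : ℂ) • f)
    (hq : ∀ A : SL(2, ℤ), ∃ a, HasQExp N (f ∣[k] A) a) {a : ℤ → ℂ}
    (ha : HasQExp 1 f a)
    (hv : ∀ i, ∀ m : ℤ, (𝒟.L i).χ (m * cofInv n i) = -(𝒟.L i).η → a m = 0)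
    {R : Finset SL(2, ℤ)}
    (hR : Subgroup.IsComplement (CongruenceSubgroup.Gamma0 N : Set SL(2, ℤ)) (R : Set SL(2, ℤ))) :
    phi N r k (psi N r k (𝔇.weilRep hr hr2) R f) = f := by
  funext τ
  rw [𝒟.phi_apply hr hr2 (𝒟.psi_mem hN hr hr2 hd hf hq hR).1]
  have h1 : ∀ γ, psi N r k (𝔇.weilRep hr hr2) R f (dilate N (natCast_pos N) τ) γ = _ := fun γ =>
    congrFun (𝒟.psi_apply hr hr2 k R f γ) _
  have h2 := congrFun (𝒟.sum_row_reps hf ha hv hR) (dilate N (natCast_pos N) τ)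
  simp only [Finset.sum_apply, Pi.smul_apply, smul_eq_mul, Finset.sum_mul] at h1 h2
  rw [Finset.sum_comm] at h2
  simp only [h1, ← Finset.mul_sum]
  rw [h2, slashGL_matW_slash_S, hr, 𝒟.card_eq, hω]
  have hN' := natCast_pos N
  obtain ⟨h, rfl⟩ := hr2
  have hh : (h + h) / 2 = h := by omega
  rw [hh] at hk ⊢
  have h3 : Complex.exp (2 * Real.pi * Complex.I * (((h + h : ℤ) : ℂ) / 8)) = Complex.I ^ h := by
    conv_rhs => rw [← Complex.exp_pi_div_two_mul_I, ← Complex.exp_int_mul]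
    congr 1
    push_cast
    ring
  -- One factor i^(r/2) comes from ψ, the other from the Gauss sum of D; (-1)^k comes from W(N)S.
  -- They cancel as k and r/2 have the same parity.
  have h4 : Complex.I ^ h * Complex.I ^ h * (-1) ^ k = 1 := by
    rw [← mul_zpow, Complex.I_mul_I, ← zpow_add₀ (by norm_num)]
    refine Even.neg_one_zpow ?_
    rw [Int.modEq_iff_dvd] at hk
    obtain ⟨c, hc⟩ := hk
    exact ⟨k + c, by linarith⟩
  have h5 : (N : ℝ) ^ (((k : ℝ) - 1) / 2) * Real.sqrt N * (N : ℝ) ^ (-((k : ℝ) / 2)) = 1 := by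
    rw [Real.sqrt_eq_rpow, ← Real.rpow_add hN', ← Real.rpow_add hN']
    convert Real.rpow_zero _ using 2
    ring
  have h6 : (((N : ℝ) ^ (((k : ℝ) - 1) / 2) : ℝ) : ℂ) * ((Real.sqrt N : ℝ) : ℂ) *
      (((N : ℝ) ^ (-((k : ℝ) / 2)) : ℝ) : ℂ) = 1 := by exact_mod_cast h5
  have h7 : (2 : ℂ) ^ (-(N.primeFactors.card : ℤ)) * 2 ^ N.primeFactors.card = 1 := by
    rw [zpow_neg, zpow_natCast]
    exact inv_mul_cancel₀ (pow_ne_zero _ two_ne_zero)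
  rw [h3]
  linear_combination f τ * (Complex.I ^ h * Complex.I ^ h * (-1) ^ k) *
    ((((N : ℝ) ^ (((k : ℝ) - 1) / 2) : ℝ) : ℂ) * ((Real.sqrt N : ℝ) : ℂ) *
      (((N : ℝ) ^ (-((k : ℝ) / 2)) : ℝ) : ℂ)) * h7 +
    f τ * (Complex.I ^ h * Complex.I ^ h * (-1) ^ k) * h6 + f τ * h4

end

end WeilForms.LocalDecomp

/-! ### Recovering F from φ(F) -/

namespace WeilForms.LocalDecomp

open ModularGroup DiscriminantForm
open scoped ModularForm Manifold

variable {D : Type*} [AddCommGroup D] {𝔇 : DiscriminantForm D} {N : ℕ} {ι : Type}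
    [Fintype ι] {p n : ι → ℕ} [∀ i, NeZero (n i)] {M : ι → Type*} [∀ i, AddCommGroup (M i)]
    [∀ i, Fintype (M i)]

theorem p_dvd_n (𝒟 : LocalDecomp 𝔇 N p n M) (i : ι) : p i ∣ n i := by
  obtain ⟨k, hk⟩ := (𝒟.L i).eq_pow
  rw [hk]
  exact dvd_pow_self _ (Nat.succ_ne_zero k)

theorem p_injective (𝒟 : LocalDecomp 𝔇 N p n M) : Function.Injective p := by
  intro i j h
  by_contra hij
  have h1 := Nat.dvd_gcd (𝒟.p_dvd_n i) (h ▸ 𝒟.p_dvd_n j : p i ∣ n j)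
  rw [𝒟.coprime hij] at h1
  exact (𝒟.L i).prime.one_lt.ne' (Nat.dvd_one.mp h1)

theorem prime_dvd_iff (𝒟 : LocalDecomp 𝔇 N p n M) {l : ℕ} (hl : l.Prime) :
    l ∣ N ↔ ∃ i, p i = l := by
  rw [← 𝒟.prod_eq, hl.prime.dvd_finsetProd_iff]
  constructor
  · rintro ⟨i, -, h⟩
    obtain ⟨k, hk⟩ := (𝒟.L i).eq_pow
    rw [hk] at h
    exact ⟨i, ((Nat.prime_dvd_prime_iff_eq hl (𝒟.L i).prime).mp (hl.dvd_of_dvd_pow h)).symm⟩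
  · rintro ⟨i, rfl⟩
    exact ⟨i, Finset.mem_univ i, 𝒟.p_dvd_n i⟩

variable [NeZero N]

theorem primeFactors_gcd (𝒟 : LocalDecomp 𝔇 N p n M) (m : ℤ) [DecidablePred fun i => (p i : ℤ) ∣ m] :
    (Int.gcd m N).primeFactors = ({i | (p i : ℤ) ∣ m} : Finset ι).map ⟨p, 𝒟.p_injective⟩ := by
  ext l
  have h0 : Int.gcd m N ≠ 0 := fun h => NeZero.ne N (by
    have := (Int.gcd_eq_zero_iff.mp h).2
    exact_mod_cast this)
  simp only [Nat.mem_primeFactors, Finset.mem_map, Finset.mem_filter, Finset.mem_univ, true_and,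
    Function.Embedding.coeFn_mk]
  have h1 : l ∣ Int.gcd m N ↔ (l : ℤ) ∣ m ∧ l ∣ N := by
    rw [← Int.natCast_dvd_natCast, Int.dvd_coe_gcd_iff, Int.natCast_dvd_natCast]
  rw [h1]
  constructor
  · rintro ⟨hl, ⟨h2, h3⟩, -⟩
    obtain ⟨i, rfl⟩ := (𝒟.prime_dvd_iff hl).mp h3
    exact ⟨i, h2, rfl⟩
  · rintro ⟨i, h2, rfl⟩
    exact ⟨(𝒟.L i).prime, ⟨h2, (𝒟.prime_dvd_iff (𝒟.L i).prime).mpr ⟨i, rfl⟩⟩, h0⟩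

theorem card_primeFactors (𝒟 : LocalDecomp 𝔇 N p n M) :
    N.primeFactors = Finset.univ.map ⟨p, 𝒟.p_injective⟩ := by
  classical
  have := 𝒟.primeFactors_gcd 0
  simpa using this

/-- The local factor 1 + ηχ is 1 if p divides m. Otherwise it is 0 or 2, and 0 is excluded because γ
has this norm. So the representation number has a factor 2 exactly at the primes that s(m) omits. -/
theorem sCoeff_mul_card [DecidableEq ι] (𝒟 : LocalDecomp 𝔇 N p n M) {m : ℤ} {γ : D}
    (h : 𝔇.q γ = ((m / N : ℚ) : AddCircle (1 : ℚ))) :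
    sCoeff N m * Nat.card {β // 𝔇.q β = ((m / N : ℚ) : AddCircle (1 : ℚ))} =
      2 ^ N.primeFactors.card := by
  classical
  have hpos : (Nat.card {β // 𝔇.q β = ((m / N : ℚ) : AddCircle (1 : ℚ))} : ℤ) ≠ 0 := by
    have : Nonempty {β // 𝔇.q β = ((m / N : ℚ) : AddCircle (1 : ℚ))} := ⟨γ, h⟩
    have : Finite D := Finite.of_equiv _ 𝒟.Φ.symm.toEquiv
    rw [Nat.cast_ne_zero]
    exact Nat.card_pos.ne'
  have h1 := 𝒟.card_norm_eq m
  rw [h1, Finset.prod_ne_zero_iff] at hpos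
  have h2 : ∀ i, (1 + (𝒟.L i).η * (𝒟.L i).χ (m * cofInv n i)) =
      if (p i : ℤ) ∣ m then 1 else 2 := by
    intro i
    have hu : IsUnit (m * cofInv n i) ↔ IsUnit (m : ZMod (n i)) := by
      rw [IsUnit.mul_iff, and_iff_left]
      exact IsUnit.of_mul_eq_one_right _ (𝒟.cof_mul_cofInv i)
    split_ifs with hd
    · rw [(𝒟.L i).chi_nonunit, mul_zero, add_zero]
      rw [hu, (𝒟.L i).isUnit_intCast]
      exact not_not.mpr hd
    · have h3 := hpos i (Finset.mem_univ i)
      have key : ∀ x y : ℤ, (x = 1 ∨ x = -1) → (y = 1 ∨ y = -1) → 1 + y * x ≠ 0 → 1 + y * x = 2 := by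
        rintro _ _ (rfl | rfl) (rfl | rfl) <;> norm_num
      exact key _ _ ((𝒟.L i).chi_unit _ (hu.mpr (((𝒟.L i).isUnit_intCast m).mpr hd)))
        (𝒟.L i).eta_eq h3
  have h3 : (sCoeff N m : ℤ) = ∏ i, if (p i : ℤ) ∣ m then 2 else 1 := by
    rw [sCoeff, 𝒟.primeFactors_gcd, Finset.card_map, Finset.prod_ite, Finset.prod_const,
      Finset.prod_const_one, mul_one]
    push_cast
    rfl
  zify
  rw [h1, h3, ← Finset.prod_mul_distrib, 𝒟.card_primeFactors, Finset.card_map, Finset.card_univ]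
  simp only [h2]
  have h4 : ∀ i, ((if (p i : ℤ) ∣ m then 2 else 1) * if (p i : ℤ) ∣ m then 1 else 2 : ℤ) = 2 := by
    intro i; split_ifs <;> rfl
  simp [h4]

theorem coe_div_eq_iff (m l : ℤ) : ((m / N : ℚ) : AddCircle (1 : ℚ)) = ((l / N : ℚ) : AddCircle (1 : ℚ)) ↔
    (m : ZMod N) = l := by
  rw [← toQZ_intCast, ← toQZ_intCast, (toQZ_injective N).eq_iff]

theorem vvForms_T_smul [Fintype D] {r : ℤ} (hr : 𝔇.HasSignature r) (hr2 : Even r) {k : ℤ}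
    {F : ℍ → D → ℂ} (hF : F ∈ vvForms 𝔇 k (𝔇.weilRep hr hr2)) {γ : D} {m : ℤ}
    (hm : 𝔇.q γ = ((m / N : ℚ) : AddCircle (1 : ℚ))) (j : ℕ) (τ : ℍ) :
    F (T ^ (j : ℤ) • τ) γ = addPsi N (j * m) * F τ γ := by
  induction j with
  | zero => simp
  | succ j ih =>
    have h1 := congrFun (hF.1 T (T ^ (j : ℤ) • τ)) γ
    have h2 := slash_T_zpow_apply k 1 (fun z => F z γ) (T ^ (j : ℤ) • τ)
    rw [zpow_one] at h2
    rw [𝔇.weilRep_T_eq, h2, ← mul_smul, ← zpow_one_add] at h1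
    simp only [opT, LinearMap.coe_mk, AddHom.coe_mk] at h1
    rw [Nat.cast_succ, add_comm, h1, ih, hm, ← mul_assoc]
    congr 1
    rw [← toQZ_intCast, ← addPsi_apply, ← AddChar.map_add_eq_mul]
    congr 1
    push_cast
    ring

theorem hasSum_average_one {g : ℍ → ℂ} {a : ℤ → ℂ}
    (hg : ∀ τ : ℍ,
      HasSum (fun n : ℤ => a n * Complex.exp (2 * Real.pi * Complex.I * (n / N) * τ)) (g τ))
    (m : ℤ) (τ : ℍ) :
    HasSum (fun l : ℤ => if (l : ZMod N) = m then
        N * (a l * Complex.exp (2 * Real.pi * Complex.I * (l / N) * τ)) else 0)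
      (∑ j : ZMod N, addPsi N (-(j * m)) * g (T ^ (j.val : ℤ) • τ)) := by
  have := hasSum_average N hg 1 (fun l => (l : ZMod N)) (fun l => by
    rw [addPsi_intCast]; simp) m τ
  simpa using this

/-- F_γ is multiplied by e(q(γ)) under T, so the average that deletes the exponents outside the
class of N q(γ) leaves F_γ unchanged. -/
theorem exists_hasQExp_support [Fintype D] {r : ℤ} (hr : 𝔇.HasSignature r) (hr2 : Even r) {k : ℤ}
    (hN : 𝔇.level = N) {F : ℍ → D → ℂ} (hF : F ∈ vvForms 𝔇 k (𝔇.weilRep hr hr2)) {γ : D} {m : ℤ}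
    (hm : 𝔇.q γ = ((m / N : ℚ) : AddCircle (1 : ℚ))) :
    ∃ a, HasQExp N (fun z => F z γ) a ∧ ∀ l : ℤ, (l : ZMod N) ≠ m → a l = 0 := by
  obtain ⟨a, ⟨m₀, hm₀⟩, ha⟩ := (hF.2 γ).2
  rw [hN] at ha
  refine ⟨fun l => if (l : ZMod N) = m then a l else 0, ⟨⟨m₀, fun l hl => ?_⟩, fun τ => ?_⟩,
    fun l hl => if_neg hl⟩
  · simp [hm₀ l hl]
  · have h1 := (hasSum_average_one ha m τ).mul_left (N : ℂ)⁻¹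
    have hN' : (N : ℂ) ≠ 0 := by exact_mod_cast NeZero.ne N
    have h2 : ∀ j : ZMod N, addPsi N (-(j * m)) * F (T ^ (j.val : ℤ) • τ) γ = F τ γ := by
      intro j
      rw [vvForms_T_smul hr hr2 hF hm, ← mul_assoc, ← AddChar.map_add_eq_mul,
        ZMod.natCast_zmod_val, neg_add_cancel, AddChar.map_zero_eq_one, one_mul]
    simp only [h2, Finset.sum_const, Finset.card_univ, ZMod.card, nsmul_eq_mul] at h1
    rw [inv_mul_cancel_left₀ hN'] at h1
    refine h1.congr_fun fun l => ?_
    simp only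
    split_ifs
    · rw [inv_mul_cancel_left₀ hN']
    · simp

/-- Up to the factor 2^ω(N), the class of m in the expansion of φ(F) is the sum of the F_β with q(β)
= m/N. These are equal by invariance, and their number is 2^ω(N) / s(m). -/
theorem hasSum_component [DecidableEq ι] [Fintype D] (𝒟 : LocalDecomp 𝔇 N p n M) {r : ℤ}
    (hr : 𝔇.HasSignature r) (hr2 : Even r) {k : ℤ} {F : ℍ → D → ℂ}
    (hF : F ∈ vvFormsInv 𝔇 k (𝔇.weilRep hr hr2)) {a : ℤ → ℂ} (ha : HasQExp 1 (phi N r k F) a)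
    {γ : D} {m : ℤ} (hm : 𝔇.q γ = ((m / N : ℚ) : AddCircle (1 : ℚ))) (τ : ℍ) :
    HasSum (fun l : ℤ => if (l : ZMod N) = m then
      sCoeff N m * (a l * Complex.exp (2 * Real.pi * Complex.I * (l / N) * τ)) else 0) (F τ γ) := by
  classical
  have hN' : (N : ℂ) ≠ 0 := by exact_mod_cast NeZero.ne N
  have hg : ∀ τ : ℍ, HasSum (fun l : ℤ => (2 ^ N.primeFactors.card * a l) *
      Complex.exp (2 * Real.pi * Complex.I * (l / N) * τ)) (∑ β, F τ β) := by
    intro τ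
    obtain ⟨τ', rfl⟩ : ∃ τ', dilate N (natCast_pos N) τ' = τ := by
      refine ⟨dilate (N : ℝ)⁻¹ (inv_pos.mpr (natCast_pos N)) τ, ?_⟩
      ext1
      rw [coe_dilate, coe_dilate]
      push_cast
      field_simp
    have h1 := (ha.2 τ').mul_left (2 ^ N.primeFactors.card : ℂ)
    have h2 : (2 ^ N.primeFactors.card : ℂ) ≠ 0 := pow_ne_zero _ two_ne_zero
    rw [𝒟.phi_apply hr hr2 hF.1, zpow_neg, zpow_natCast, mul_inv_cancel_left₀ h2] at h1
    refine h1.congr_fun fun l => ?_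
    rw [coe_dilate, mul_assoc]
    congr 3
    push_cast
    field_simp
  have h1 := hasSum_average_one hg m τ
  choose μ hμ using 𝒟.exists_int_norm
  have h2 : ∀ β, ∑ j : ZMod N, addPsi N (-(j * m)) * F (T ^ (j.val : ℤ) • τ) β =
      if 𝔇.q β = ((m / N : ℚ) : AddCircle (1 : ℚ)) then N * F τ γ else 0 := by
    intro β
    have h3 : ∀ j : ZMod N, addPsi N (-(j * m)) * F (T ^ (j.val : ℤ) • τ) β =
        addPsi N (j * (μ β - m)) * F τ β := by
      intro j
      rw [vvForms_T_smul hr hr2 hF.1 (hμ β), ← mul_assoc, ← AddChar.map_add_eq_mul,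
        ZMod.natCast_zmod_val]
      congr 2
      ring
    simp only [h3, ← Finset.sum_mul, sum_addPsi_mul, sub_eq_zero]
    have h4 : ((μ β : ZMod N) = m) ↔ 𝔇.q β = ((m / N : ℚ) : AddCircle (1 : ℚ)) := by
      rw [hμ, coe_div_eq_iff]
    simp only [h4]
    split_ifs with h5
    -- Elements of equal norm are conjugate under Aut(D), so invariance of F identifies their
    -- components.
    · obtain ⟨σ, hσ, rfl⟩ := 𝒟.exists_isAut (hm.trans h5.symm)
      rw [hF.2 σ hσ]
    · rw [zero_mul]
  have h3 : ∑ j : ZMod N, addPsi N (-(j * m)) * ∑ β, F (T ^ (j.val : ℤ) • τ) β =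
      Nat.card {β // 𝔇.q β = ((m / N : ℚ) : AddCircle (1 : ℚ))} * (N * F τ γ) := by
    simp only [Finset.mul_sum]
    rw [Finset.sum_comm]
    simp only [h2]
    rw [← Finset.sum_filter, Finset.sum_const, nsmul_eq_mul, Nat.card_eq_fintype_card,
      Fintype.card_subtype]
  rw [h3] at h1
  have h4 := 𝒟.sCoeff_mul_card hm
  set c := Nat.card {β // 𝔇.q β = ((m / N : ℚ) : AddCircle (1 : ℚ))}
  have hc : (c : ℂ) ≠ 0 := by
    intro h
    have : c = 0 := by exact_mod_cast h
    rw [this, mul_zero] at h4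
    exact pow_ne_zero _ two_ne_zero h4.symm
  have h4' : (sCoeff N m : ℂ) * c = 2 ^ N.primeFactors.card := by exact_mod_cast h4
  have h5 := h1.mul_left ((c : ℂ) * N)⁻¹
  rw [← mul_assoc (c : ℂ), inv_mul_cancel_left₀ (mul_ne_zero hc hN')] at h5
  refine h5.congr_fun fun l => ?_
  split_ifs
  · rw [← h4']
    field_simp
  · simp

theorem phi_mem [Fintype D] (𝒟 : LocalDecomp 𝔇 N p n M) (hN : 𝔇.level = N) {r : ℤ}
    (hr : 𝔇.HasSignature r) (hr2 : Even r) {k : ℤ} {F : ℍ → D → ℂ}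
    (hF : F ∈ vvForms 𝔇 k (𝔇.weilRep hr hr2)) {χ : ℤ → ℤ} (hχ : ∀ m, χ m = 𝒟.chi m) :
    phi N r k F ∈ weakForms N k χ := by
  classical
  have h0 : ∀ A ∈ CongruenceSubgroup.Gamma0 N,
      (fun z => F z 0) ∣[k] A = (𝒟.chi (A 1 1) : ℂ) • fun z => F z 0 := by
    intro A hA
    funext τ
    have := congrFun (hF.1 A τ) 0
    rw [𝒟.weilRep_apply_zero hr hr2 hA] at this
    exact this
  have hq : ∀ A : SL(2, ℤ), ∃ a, HasQExp N ((fun z => F z 0) ∣[k] A) a := by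
    intro A
    -- F₀|A is a linear combination of the components of F, which gives its expansion at every cusp.
    have h1 : (fun z => F z 0) ∣[k] A =
        ∑ γ, 𝔇.weilRep hr hr2 A (Pi.single γ 1) 0 • fun z => F z γ := by
      funext τ
      refine (congrFun (hF.1 A τ) 0).trans ?_
      conv_lhs => rw [← Finset.univ_sum_single (F τ)]
      rw [map_sum, Finset.sum_apply, Finset.sum_apply]
      refine Finset.sum_congr rfl fun γ _ => ?_
      have : (Pi.single γ (F τ γ) : D → ℂ) = F τ γ • Pi.single γ 1 := by
        rw [← Pi.single_smul, smul_eq_mul, mul_one]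
      rw [this, map_smul]
      simp [mul_comm]
    rw [h1]
    refine exists_hasQExp_sum N _ fun γ _ => ?_
    obtain ⟨a, ha⟩ := (hF.2 γ).2
    rw [hN] at ha
    exact ⟨_, ha.smul _⟩
  have hg := 𝒟.slashGL_matW_slash h0
  refine ⟨?_, fun A hA => ?_, fun A => ?_⟩
  · refine MDifferentiable.const_smul _ ?_
    rw [slashGL_eq _ _ (det_matW_pos N)]
    exact ((hF.2 0).1.slash k _).const_smul _
  · rw [phi, ModularForm.SL_smul_slash, hg A hA, hχ, smul_comm]
  · obtain ⟨a, ha⟩ := exists_hasQExp_slash_matW N hq A (𝒟.slash_periodic hg A)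
    exact ⟨_, by rw [phi, ModularForm.SL_smul_slash]; exact ha.smul _⟩

theorem exists_hasQExp_phi [DecidableEq ι] [Fintype D] (𝒟 : LocalDecomp 𝔇 N p n M)
    (hN : 𝔇.level = N) {r : ℤ} (hr : 𝔇.HasSignature r) (hr2 : Even r) {k : ℤ} {F : ℍ → D → ℂ}
    (hF : F ∈ vvForms 𝔇 k (𝔇.weilRep hr hr2)) :
    ∃ a, HasQExp 1 (phi N r k F) a ∧
      ∀ i, ∀ m : ℤ, (𝒟.L i).χ (m * cofInv n i) = -(𝒟.L i).η → a m = 0 := by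
  have hN' : (N : ℂ) ≠ 0 := by exact_mod_cast NeZero.ne N
  choose μ hμ using 𝒟.exists_int_norm
  choose b hb hb0 using fun γ => exists_hasQExp_support hr hr2 hN hF (hμ γ)
  choose m₀ hm₀ using fun γ => (hb γ).1
  refine ⟨fun l => 2 ^ (-(N.primeFactors.card : ℤ)) * ∑ γ, b γ l, ⟨?_, fun τ => ?_⟩,
    fun i m hm => ?_⟩
  · obtain ⟨c, hc⟩ := (Set.finite_range m₀).bddBelow
    refine ⟨c, fun l hl => ?_⟩
    simp only
    rw [Finset.sum_eq_zero, mul_zero]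
    exact fun γ _ => hm₀ γ l (hl.trans_le (hc ⟨γ, rfl⟩))
  · rw [𝒟.phi_apply hr hr2 hF]
    have h1 := (hasSum_sum (s := Finset.univ) fun γ _ =>
      (hb γ).2 (dilate N (natCast_pos N) τ)).mul_left (2 ^ (-(N.primeFactors.card : ℤ)) : ℂ)
    refine h1.congr_fun fun l => ?_
    rw [mul_assoc, ← Finset.sum_mul]
    congr 3
    rw [coe_dilate]
    push_cast
    field_simp
  · simp only
    rw [Finset.sum_eq_zero, mul_zero]
    intro γ _
    apply hb0
    intro h
    rw [← coe_div_eq_iff, ← hμ] at h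
    -- An element of norm m/N cannot exist: its local representation number at i would be 1 + η(-η)
    -- = 0.
    have h1 := 𝒟.card_norm_eq m
    rw [Finset.prod_eq_zero (Finset.mem_univ i)] at h1
    · have : Nonempty {γ // 𝔇.q γ = ((m / N : ℚ) : AddCircle (1 : ℚ))} := ⟨γ, h.symm⟩
      rw [Nat.cast_eq_zero] at h1
      exact Nat.card_pos.ne' h1
    · rw [hm]
      rcases (𝒟.L i).eta_eq with h | h <;> rw [h] <;> norm_num

end WeilForms.LocalDecomp

/-! ### The isomorphism for an orthogonal sum of local forms -/

namespace WeilForms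

open ModularGroup DiscriminantForm

theorem slashGL_add (k : ℤ) (f g : ℍ → ℂ) (A : GL (Fin 2) ℝ) :
    slashGL k (f + g) A = slashGL k f A + slashGL k g A := by
  funext τ
  simp only [slashGL, Pi.add_apply]
  ring

theorem slashGL_smul (k : ℤ) (c : ℂ) (f : ℍ → ℂ) (A : GL (Fin 2) ℝ) :
    slashGL k (c • f) A = c • slashGL k f A := by
  funext τ
  simp only [slashGL, Pi.smul_apply, smul_eq_mul]
  ring

section

variable {D : Type*} [AddCommGroup D] [Fintype D] (N : ℕ) [NeZero N] (r k : ℤ)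

/-- `phi` as a linear map. -/
noncomputable def phiLin : (ℍ → D → ℂ) →ₗ[ℂ] (ℍ → ℂ) where
  toFun := phi N r k
  map_add' F G := by
    rw [phi, phi, phi, ← smul_add, ← slashGL_add]
    rfl
  map_smul' c F := by
    rw [RingHom.id_apply, phi, phi, smul_comm c, ← slashGL_smul k c fun z => F z 0]
    rfl

theorem phiLin_apply (F : ℍ → D → ℂ) : phiLin N r k F = phi N r k F := rfl

end

namespace LocalDecomp

variable {D : Type*} [AddCommGroup D] {𝔇 : DiscriminantForm D} {N : ℕ} {ι : Type}
    [Fintype ι] {p n : ι → ℕ} [∀ i, NeZero (n i)] {M : ι → Type*} [∀ i, AddCommGroup (M i)]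
    [∀ i, Fintype (M i)]

variable [NeZero N] [DecidableEq ι] [Fintype D]

theorem eq_zero_of_phi_eq_zero (𝒟 : LocalDecomp 𝔇 N p n M) {r : ℤ}
    (hr : 𝔇.HasSignature r) (hr2 : Even r) {k : ℤ} {F : ℍ → D → ℂ}
    (hF : F ∈ vvFormsInv 𝔇 k (𝔇.weilRep hr hr2)) (h : phi N r k F = 0) : F = 0 := by
  funext τ γ
  obtain ⟨m, hm⟩ := 𝒟.exists_int_norm γ
  have h1 := 𝒟.hasSum_component hr hr2 hF (a := 0) (by rw [h]; exact HasQExp.zero 1) hm τ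
  simp only [Pi.zero_apply, zero_mul, mul_zero, ite_self] at h1
  exact h1.unique hasSum_zero

/-- An element of norm m/N has local norm m divided by the cofactor of n i. The value of χ at the
cofactor is the difference between the local sign η and the sign ε_p. -/
theorem chi_eq_neg_iff (𝒟 : LocalDecomp 𝔇 N p n M) {χp : ℕ → ℤ → ℤ} {ε : ℕ → ℤ}
    (hχ : ∀ i, ∀ m : ℤ, χp (p i) m = (𝒟.L i).χ m)
    (hε : ∀ i, ε (p i) = (𝒟.L i).η * (𝒟.L i).χ (cof n i)) (i : ι) (m : ℤ) :
    (𝒟.L i).χ (m * cofInv n i) = -(𝒟.L i).η ↔ χp (p i) m = -ε (p i) := by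
  have h1 : (𝒟.L i).χ (cofInv n i) = (𝒟.L i).χ (cof n i) := (𝒟.L i).chi_inv (𝒟.isUnit_cof i)
  rw [hχ, hε, map_mul, h1]
  rcases (𝒟.L i).chi_unit _ (𝒟.isUnit_cof i) with h2 | h2 <;> rw [h2] <;>
    constructor <;> intro h <;> linarith

theorem prodChi_eq (𝒟 : LocalDecomp 𝔇 N p n M) {χp : ℕ → ℤ → ℤ}
    (hχ : ∀ i, ∀ m : ℤ, χp (p i) m = (𝒟.L i).χ m) (m : ℤ) : prodChi χp N m = 𝒟.chi m := by
  rw [prodChi, 𝒟.card_primeFactors, Finset.prod_map, chi]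
  exact Finset.prod_congr rfl fun i _ => hχ i m

theorem phi_injOn (𝒟 : LocalDecomp 𝔇 N p n M) {r : ℤ}
    (hr : 𝔇.HasSignature r) (hr2 : Even r) {k : ℤ} {F G : ℍ → D → ℂ}
    (hF : F ∈ vvFormsInv 𝔇 k (𝔇.weilRep hr hr2)) (hG : G ∈ vvFormsInv 𝔇 k (𝔇.weilRep hr hr2))
    (h : phi N r k F = phi N r k G) : F = G := by
  refine sub_eq_zero.mp (𝒟.eq_zero_of_phi_eq_zero hr hr2 (sub_mem hF hG) ?_)
  rw [← phiLin_apply, map_sub, phiLin_apply, phiLin_apply, h, sub_self]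

theorem sCoeff_eq (𝒟 : LocalDecomp 𝔇 N p n M) {γ : D} {m l : ℤ}
    (hm : ((m / N : ℚ) : AddCircle (1 : ℚ)) = 𝔇.q γ)
    (hl : ((l / N : ℚ) : AddCircle (1 : ℚ)) = 𝔇.q γ) : sCoeff N m = sCoeff N l := by
  have h1 := 𝒟.sCoeff_mul_card hm.symm
  have h2 := 𝒟.sCoeff_mul_card hl.symm
  rw [← h2, hm, hl] at h1
  refine Nat.eq_of_mul_eq_mul_right ?_ h1
  have : Nonempty {β // 𝔇.q β = 𝔇.q γ} := ⟨γ, rfl⟩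
  exact Nat.card_pos

theorem hasSum_component_subtype (𝒟 : LocalDecomp 𝔇 N p n M) {r : ℤ}
    (hr : 𝔇.HasSignature r) (hr2 : Even r) {k : ℤ} {F : ℍ → D → ℂ}
    (hF : F ∈ vvFormsInv 𝔇 k (𝔇.weilRep hr hr2)) {a : ℤ → ℂ} (ha : HasQExp 1 (phi N r k F) a)
    {γ : D} {m : ℤ} (hm : ((m / N : ℚ) : AddCircle (1 : ℚ)) = 𝔇.q γ) (τ : ℍ) :
    HasSum (fun n : {n : ℤ // ((n / N : ℚ) : AddCircle (1 : ℚ)) = 𝔇.q γ} =>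
      sCoeff N m * (a n * Complex.exp (2 * Real.pi * Complex.I * (n / N) * τ))) (F τ γ) := by
  refine (hasSum_subtype_iff_indicator (f := fun l : ℤ => (sCoeff N m : ℂ) * (a l *
    Complex.exp (2 * Real.pi * Complex.I * (l / N) * τ)))
    (s := {l : ℤ | ((l / N : ℚ) : AddCircle (1 : ℚ)) = 𝔇.q γ})).mpr ?_
  refine (𝒟.hasSum_component hr hr2 hF ha hm.symm τ).congr_fun fun l => ?_
  rw [Set.indicator_apply]
  simp only [Set.mem_ofPred_eq, ← hm, coe_div_eq_iff]

theorem isomorphism (𝒟 : LocalDecomp 𝔇 N p n M) (hN : 𝔇.level = N) {χp : ℕ → ℤ → ℤ} {ε : ℕ → ℤ}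
    (hχ : ∀ i, ∀ m : ℤ, χp (p i) m = (𝒟.L i).χ m)
    (hε : ∀ i, ε (p i) = (𝒟.L i).η * (𝒟.L i).χ (cof n i)) {r : ℤ}
    (hr : 𝔇.HasSignature r) (hr2 : Even r) {k : ℤ} (hk : k ≡ r / 2 [ZMOD 2])
    {R : Finset SL(2, ℤ)}
    (hR : Subgroup.IsComplement (CongruenceSubgroup.Gamma0 N : Set SL(2, ℤ)) (R : Set SL(2, ℤ))) :
    ∃ Φ : vvFormsInv 𝔇 k (𝔇.weilRep hr hr2) ≃ₗ[ℂ] epsForms N k χp ε,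
      (∀ F, (Φ F : ℍ → ℂ) = phi N r k (F : ℍ → D → ℂ)) ∧
      (∀ f, (Φ.symm f : ℍ → D → ℂ) = psi N r k (𝔇.weilRep hr hr2) R (f : ℍ → ℂ)) ∧
      ∀ (f : epsForms N k χp ε) (a : ℤ → ℂ), HasQExp 1 (f : ℍ → ℂ) a →
        ∀ (γ : D) (τ : ℍ),
          HasSum (fun n : {n : ℤ // ((n / N : ℚ) : AddCircle (1 : ℚ)) = 𝔇.q γ} =>
            sCoeff N n * a n * Complex.exp (2 * Real.pi * Complex.I * (n / N) * τ))
            (psi N r k (𝔇.weilRep hr hr2) R (f : ℍ → ℂ) τ γ) ∧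
          ∀ m : ℤ, ((m / N : ℚ) : AddCircle (1 : ℚ)) = 𝔇.q γ →
            ∃ x : ℂ,
              HasSum (fun n : {n : ℤ // ((n / N : ℚ) : AddCircle (1 : ℚ)) = 𝔇.q γ} =>
                a n * Complex.exp (2 * Real.pi * Complex.I * (n / N) * τ)) x ∧
              psi N r k (𝔇.weilRep hr hr2) R (f : ℍ → ℂ) τ γ = sCoeff N m * x := by
  have hχD := 𝒟.prodChi_eq hχ
  have hv := 𝒟.chi_eq_neg_iff hχ hε
  have hψ : ∀ f ∈ epsForms N k χp ε,
      psi N r k (𝔇.weilRep hr hr2) R f ∈ vvFormsInv 𝔇 k (𝔇.weilRep hr hr2) := by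
    rintro f ⟨⟨h1, h2, h3⟩, -⟩
    exact 𝒟.psi_mem hN hr hr2 h1 (fun A hA => by rw [h2 A hA, hχD]) h3 hR
  have hφψ : ∀ f ∈ epsForms N k χp ε, phi N r k (psi N r k (𝔇.weilRep hr hr2) R f) = f := by
    rintro f ⟨⟨h1, h2, h3⟩, a, ha, ha'⟩
    refine 𝒟.phi_psi hN (by rw [𝒟.card_primeFactors, Finset.card_map, Finset.card_univ]) hr hr2 hk
      h1 (fun A hA => by rw [h2 A hA, hχD]) h3 ha (fun i m hm => ?_) hR
    refine ha' (p i) ?_ m ((hv i m).mp hm)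
    rw [𝒟.card_primeFactors]
    exact Finset.mem_map_of_mem _ (Finset.mem_univ i)
  have hφ : ∀ F ∈ vvFormsInv 𝔇 k (𝔇.weilRep hr hr2), phi N r k F ∈ epsForms N k χp ε := by
    intro F hF
    refine ⟨𝒟.phi_mem hN hr hr2 hF.1 hχD, ?_⟩
    obtain ⟨a, ha, ha'⟩ := 𝒟.exists_hasQExp_phi hN hr hr2 hF.1
    refine ⟨a, ha, fun l hl m hm => ?_⟩
    rw [𝒟.card_primeFactors, Finset.mem_map] at hl
    obtain ⟨i, -, rfl⟩ := hl
    exact ha' i m ((hv i m).mpr hm)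
  let φ : vvFormsInv 𝔇 k (𝔇.weilRep hr hr2) →ₗ[ℂ] epsForms N k χp ε :=
    (phiLin N r k).restrict hφ
  -- φψ = 1 gives surjectivity; together with injectivity it makes ψ the two-sided inverse.
  have hbij : Function.Bijective φ := by
    refine ⟨fun F G h => ?_, fun f => ⟨⟨_, hψ f f.2⟩, Subtype.ext (hφψ f f.2)⟩⟩
    exact Subtype.ext (𝒟.phi_injOn hr hr2 F.2 G.2 (congrArg Subtype.val h))
  refine ⟨LinearEquiv.ofBijective φ hbij, fun F => rfl, fun f => ?_, fun f a ha γ τ => ?_⟩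
  · have h1 : (LinearEquiv.ofBijective φ hbij).symm f = ⟨_, hψ f f.2⟩ := by
      rw [LinearEquiv.symm_apply_eq]
      exact (Subtype.ext (hφψ f f.2)).symm
    rw [h1]
  have ha' : HasQExp 1 (phi N r k (psi N r k (𝔇.weilRep hr hr2) R (f : ℍ → ℂ))) a := by
    rwa [hφψ f f.2]
  refine ⟨?_, fun m hm => ?_⟩
  · obtain ⟨m, hm⟩ := 𝒟.exists_int_norm γ
    refine (𝒟.hasSum_component_subtype hr hr2 (hψ f f.2) ha' hm.symm τ).congr_fun fun l => ?_
    rw [mul_assoc, 𝒟.sCoeff_eq l.2 hm.symm]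
  · have h0 : (sCoeff N m : ℂ) ≠ 0 := by
      rw [sCoeff]
      push_cast
      exact pow_ne_zero _ two_ne_zero
    refine ⟨(sCoeff N m : ℂ)⁻¹ * psi N r k (𝔇.weilRep hr hr2) R (f : ℍ → ℂ) τ γ, ?_, ?_⟩
    · refine ((𝒟.hasSum_component_subtype hr hr2 (hψ f f.2) ha' hm τ).mul_left (sCoeff N m : ℂ)⁻¹).congr_fun fun l => ?_
      rw [inv_mul_cancel_left₀ h0]
    · rw [mul_inv_cancel_left₀ h0]

end LocalDecomp

end WeilForms

/-! ### The three types of local forms -/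

namespace WeilForms

namespace LocalForm

/-- Transport of a local form along an isomorphism of groups. -/
def transfer {p n : ℕ} {M M' : Type*} [AddCommGroup M] [Fintype M] [AddCommGroup M'] [Fintype M']
    (L : LocalForm p n M) (f : M' ≃+ M) : LocalForm p n M' where
  prime := L.prime
  eq_pow := L.eq_pow
  Q := fun x => L.Q (f x)
  χ := L.χ
  η := L.η
  chi_unit := L.chi_unit
  eta_eq := L.eta_eq
  polar_add x y z := by simpa using L.polar_add (f x) (f y) (f z)
  map_neg x := by simpa using L.map_neg (f x)
  nondeg x hx := by
    obtain ⟨y, hy⟩ := L.nondeg (f x) (by simpa using hx)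
    exact ⟨f.symm y, by simpa using hy⟩
  card_fiber m := by
    rw [← L.card_fiber m]
    congr 1
    exact Nat.card_congr (f.toEquiv.subtypeEquiv fun _ => Iff.rfl)
  primitive := L.primitive
  exists_neg := L.exists_neg
  exists_isometry x y h := by
    obtain ⟨σ, hσ, h1⟩ := L.exists_isometry _ _ h
    exact ⟨(f.trans σ).trans f.symm, fun z => by simp [hσ], by simp [h1]⟩

/-- The form `a x²` on `ℤ/p`, for an odd prime `p`. -/
def odd (p : ℕ) [Fact p.Prime] (hp : p ≠ 2) (a : ZMod p) (ha : a ≠ 0) : LocalForm p p (ZMod p) where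
  prime := Fact.out
  eq_pow := ⟨0, by simp⟩
  Q x := a * x ^ 2
  χ := quadraticChar (ZMod p)
  η := quadraticChar (ZMod p) a
  chi_unit u hu := quadraticChar_dichotomy hu.ne_zero
  eta_eq := quadraticChar_dichotomy ha
  polar_add x y z := by ring
  map_neg x := by ring
  nondeg x hx := by
    refine ⟨1, ?_⟩
    have h2 : (2 : ZMod p) ≠ 0 := by
      have := Ring.two_ne_zero (R := ZMod p) (by rwa [ZMod.ringChar_zmod_n])
      exact this
    have : a * (x + 1) ^ 2 - a * x ^ 2 - a * 1 ^ 2 = a * 2 * x := by ring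
    rw [this]
    exact mul_ne_zero (mul_ne_zero ha h2) hx
  card_fiber m := by
    have h := quadraticChar_card_sqrts (F := ZMod p) (by rwa [ZMod.ringChar_zmod_n]) (a⁻¹ * m)
    have hinv : quadraticChar (ZMod p) a⁻¹ = quadraticChar (ZMod p) a := by
      have h1 := congrArg (quadraticChar (ZMod p)) (mul_inv_cancel₀ ha)
      rw [map_mul, map_one] at h1
      rcases quadraticChar_dichotomy ha with h2 | h2 <;> rw [h2] at h1 ⊢ <;> linarith
    rw [map_mul, hinv, add_comm] at h
    rw [← h, Nat.card_eq_fintype_card, Fintype.card_subtype]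
    congr 2
    ext x
    simp only [Finset.mem_filter, Finset.mem_univ, true_and, Set.mem_toFinset, Set.mem_ofPred_eq]
    rw [eq_inv_mul_iff_mul_eq₀ ha]
  -- Nothing is to be shown, as ℤ/p is a field.
  primitive j hj hj' := absurd (IsUnit.mk0 j hj) hj'
  exists_neg := quadraticChar_exists_neg_one (by rwa [ZMod.ringChar_zmod_n])
  exists_isometry x y h := by
    have h1 : x ^ 2 = y ^ 2 := mul_left_cancel₀ ha h
    rcases sq_eq_sq_iff_eq_or_eq_neg.mp h1 with rfl | rfl
    · exact ⟨AddEquiv.refl _, fun _ => rfl, rfl⟩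
    · exact ⟨AddEquiv.neg _, fun z => by simp, by simp⟩

/-- The form `c (x² + y²)` on `ℤ/2 × ℤ/2`, with values in `ℤ/4`. -/
def twoTwo (c : ZMod 4) (hc : c = 1 ∨ c = -1) : LocalForm 2 4 (ZMod 2 × ZMod 2) where
  prime := Nat.prime_two
  eq_pow := ⟨1, rfl⟩
  Q x := c * (x.1.val ^ 2 + x.2.val ^ 2)
  χ := ZMod.χ₄
  η := ZMod.χ₄ c
  chi_unit u hu := by
    have h : ∀ u : ZMod 4, ZMod.χ₄ u = 1 ∨ ZMod.χ₄ u = -1 ∨ u * 2 = 0 := by decide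
    rcases h u with h | h | h
    · exact Or.inl h
    · exact Or.inr h
    · exact absurd (hu.mul_right_eq_zero.mp h) (by decide)
  eta_eq := by revert c; decide
  polar_add := by revert c; decide
  map_neg := by revert c; decide
  nondeg := by revert c; decide
  card_fiber := by
    simp only [Nat.card_eq_fintype_card]
    revert c; decide
  primitive j hj hj' := by
    have h : ∀ j : ZMod 4, j ≠ 0 → j * j = 1 ∨ ∃ a, a * j * j = 0 ∧ ZMod.χ₄ (1 + a * j) = -1 := by
      decide
    exact (h j hj).resolve_left fun h => hj' (IsUnit.of_mul_eq_one _ h)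
  exists_neg := by decide
  exists_isometry x y h := by
    -- Elements of equal norm agree up to interchanging the two coordinates.
    have h1 : ∀ x y : ZMod 2 × ZMod 2, c * (x.1.val ^ 2 + x.2.val ^ 2) =
        c * (y.1.val ^ 2 + y.2.val ^ 2) → x = y ∨ x.swap = y := by
      clear h x y; revert c; decide
    rcases h1 x y h with rfl | rfl
    · exact ⟨AddEquiv.refl _, fun _ => rfl, rfl⟩
    · exact ⟨AddEquiv.prodComm, fun z => by simp [add_comm], rfl⟩

theorem mul_self_eq_one_of_assoc : ∀ c d : ZMod 8, d * d = 1 →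
    (c = d ∨ c = 5 * d ∨ c = -d ∨ c = 3 * d) → c * c = 1 := by decide

/-- The form `2 c x² + d y²` on `ℤ/2 × ℤ/4`, with values in `ℤ/8`, and its character. -/
def twoFour (χ : MulChar (ZMod 8) ℤ) (c d : ZMod 8)
    (h : (χ = ZMod.χ₈' ∧ (c = d ∨ c = 5 * d) ∨ χ = ZMod.χ₈ ∧ (c = -d ∨ c = 3 * d)) ∧ d * d = 1) :
    LocalForm 2 8 (ZMod 2 × ZMod 4) where
  prime := Nat.prime_two
  eq_pow := ⟨2, rfl⟩
  Q x := 2 * c * x.1.val ^ 2 + d * x.2.val ^ 2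
  χ := χ
  η := χ d
  chi_unit u hu := by
    have h1 : ∀ u : ZMod 8, ((ZMod.χ₈ u = 1 ∨ ZMod.χ₈ u = -1) ∧ (ZMod.χ₈' u = 1 ∨ ZMod.χ₈' u = -1)) ∨
      u * 4 = 0 := by decide
    rcases h1 u with h1 | h1
    · rcases h.1 with ⟨rfl, -⟩ | ⟨rfl, -⟩
      · exact h1.2
      · exact h1.1
    · exact absurd (hu.mul_right_eq_zero.mp h1) (by decide)
  eta_eq := by
    have h1 : ∀ d : ZMod 8, d * d = 1 → (ZMod.χ₈ d = 1 ∨ ZMod.χ₈ d = -1) ∧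
        (ZMod.χ₈' d = 1 ∨ ZMod.χ₈' d = -1) := by decide
    rcases h.1 with ⟨rfl, -⟩ | ⟨rfl, -⟩
    · exact (h1 d h.2).2
    · exact (h1 d h.2).1
  polar_add := by
    have h1 : ∀ (c : ZMod 8) (x y z : ZMod 2), 2 * c * (x + (y + z)).val ^ 2 - 2 * c * x.val ^ 2 -
        2 * c * (y + z).val ^ 2 = (2 * c * (x + y).val ^ 2 - 2 * c * x.val ^ 2 - 2 * c * y.val ^ 2) +
        (2 * c * (x + z).val ^ 2 - 2 * c * x.val ^ 2 - 2 * c * z.val ^ 2) := by decide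
    have h2 : ∀ (x y z : ZMod 4), (((x + (y + z)).val : ZMod 8) ^ 2 - x.val ^ 2 -
        (y + z).val ^ 2) = ((x + y).val ^ 2 - x.val ^ 2 - y.val ^ 2) +
        ((x + z).val ^ 2 - x.val ^ 2 - z.val ^ 2) := by decide
    intro x y z
    simp only [Prod.fst_add, Prod.snd_add]
    linear_combination h1 c x.1 y.1 z.1 + d * h2 x.2 y.2 z.2
  map_neg := by
    clear h χ; revert c d; decide
  nondeg := by
    have hc : c * c = 1 := by
      refine mul_self_eq_one_of_assoc c d h.2 ?_
      tauto
    have hd := h.2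
    clear h χ; revert c d; decide
  card_fiber := by
    simp only [Nat.card_eq_fintype_card]
    have h1 : ∀ c d : ZMod 8, d * d = 1 → (c = d ∨ c = 5 * d) → ∀ m : ZMod 8,
        (Fintype.card {x : ZMod 2 × ZMod 4 // 2 * c * (x.1.val : ZMod 8) ^ 2 + d * x.2.val ^ 2 = m} : ℤ) =
          1 + ZMod.χ₈' d * ZMod.χ₈' m := by decide
    have h2 : ∀ c d : ZMod 8, d * d = 1 → (c = -d ∨ c = 3 * d) → ∀ m : ZMod 8,
        (Fintype.card {x : ZMod 2 × ZMod 4 // 2 * c * (x.1.val : ZMod 8) ^ 2 + d * x.2.val ^ 2 = m} : ℤ) =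
          1 + ZMod.χ₈ d * ZMod.χ₈ m := by decide
    rcases h.1 with ⟨rfl, h3⟩ | ⟨rfl, h3⟩
    · exact h1 c d h.2 h3
    · exact h2 c d h.2 h3
  primitive j hj hj' := by
    have h1 : ∀ j : ZMod 8, j ≠ 0 → j * j = 1 ∨
        ∃ a, a * j * j = 0 ∧ ZMod.χ₈ (1 + a * j) = -1 ∧ ZMod.χ₈' (1 + a * j) = -1 := by
      decide
    obtain ⟨a, h2, h3, h4⟩ := (h1 j hj).resolve_left fun h => hj' (IsUnit.of_mul_eq_one _ h)
    rcases h.1 with ⟨rfl, -⟩ | ⟨rfl, -⟩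
    · exact ⟨a, h2, h4⟩
    · exact ⟨a, h2, h3⟩
  exists_neg := by
    rcases h.1 with ⟨rfl, -⟩ | ⟨rfl, -⟩ <;> decide
  exists_isometry x y hxy := by
    have hc : c * c = 1 := by
      refine mul_self_eq_one_of_assoc c d h.2 ?_
      tauto
    have hd := h.2
    -- Elements of equal norm agree up to sign.
    have h1 : ∀ x y : ZMod 2 × ZMod 4, 2 * c * x.1.val ^ 2 + d * x.2.val ^ 2 =
        2 * c * (y.1.val : ZMod 8) ^ 2 + d * y.2.val ^ 2 → x = y ∨ -x = y := by
      clear hxy x y h χ; revert c d; decide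
    have h2 : ∀ z : ZMod 2 × ZMod 4, 2 * c * (-z).1.val ^ 2 + d * (-z).2.val ^ 2 =
        2 * c * (z.1.val : ZMod 8) ^ 2 + d * z.2.val ^ 2 := by
      clear hxy x y h χ h1 hc hd; revert c d; decide
    rcases h1 x y hxy with rfl | rfl
    · exact ⟨AddEquiv.refl _, fun _ => rfl, rfl⟩
    · exact ⟨AddEquiv.neg _, h2, rfl⟩

end LocalForm

end WeilForms

/-! ### The primary components of D as local forms -/

namespace WeilForms

/-- Decomposition of a group killed by a product of pairwise coprime integers. -/
theorem exists_equiv_pi_torsion {ι : Type} [Fintype ι] [DecidableEq ι] {m : ι → ℕ}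
    (hm : Pairwise (Function.onFun Nat.Coprime m)) {A : Type*} [AddCommGroup A]
    (hA : ∀ x : A, (∏ i, m i) • x = 0) {H : ι → AddSubgroup A}
    (hH : ∀ i x, x ∈ H i ↔ m i • x = 0) :
    ∃ Φ : A ≃+ ∀ i, H i, ∀ x, x = ∑ i, (Φ x i : A) := by
  -- Integers that represent the idempotents of the product of the ℤ/m i; multiplication by E i is
  -- the projection to the i-th torsion subgroup.
  have hE : ∀ i, ∃ E : ℤ, ∀ j, (E : ZMod (m j)) = if j = i then 1 else 0 := by
    intro i
    obtain ⟨z, hz⟩ := ZMod.intCast_surjective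
      ((ZMod.prodEquivPi m hm).symm fun j => if j = i then 1 else 0)
    refine ⟨z, fun j => ?_⟩
    have := congrFun (congrArg (ZMod.prodEquivPi m hm) hz) j
    rw [ZMod.prodEquivPi_apply, map_intCast, RingEquiv.apply_symm_apply] at this
    exact this
  choose E hE using hE
  have hkill : ∀ (i : ι) (z : ℤ) (x : A), m i • x = 0 → (z : ZMod (m i)) = 0 → z • x = 0 := by
    intro i z x hx hz
    obtain ⟨w, rfl⟩ := (ZMod.intCast_zmod_eq_zero_iff_dvd _ _).mp hz
    rw [mul_comm, mul_smul, natCast_zsmul, hx, smul_zero]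
  let sumHom : (∀ i, H i) →+ A :=
    { toFun := fun y => ∑ i, (y i : A)
      map_zero' := by simp
      map_add' := fun y z => by simp [Finset.sum_add_distrib] }
  have hproj : ∀ (y : ∀ i, H i) (j : ι), E j • sumHom y = y j := by
    intro y j
    change E j • ∑ i, (y i : A) = y j
    rw [Finset.smul_sum, Finset.sum_eq_single j]
    · have := hkill j (E j - 1) (y j) ((hH j _).mp (y j).2) (by simp [hE])
      rwa [sub_smul, one_smul, sub_eq_zero] at this
    · intro i _ hij
      exact hkill i (E j) (y i) ((hH i _).mp (y i).2) (by simp [hE, hij])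
    · exact fun h => absurd (Finset.mem_univ j) h
  have hbij : Function.Bijective sumHom := by
    constructor
    · intro y z h
      funext j
      apply Subtype.ext
      rw [← hproj, ← hproj, h]
    · intro x
      refine ⟨fun i => ⟨E i • x, (hH i _).mpr ?_⟩, ?_⟩
      · have h1 : ((∏ i, m i : ℕ) : ℤ) ∣ m i * E i := by
          push_cast
          refine Finset.prod_dvd_of_coprime (fun j _ j' _ hj => Nat.isCoprime_iff_coprime.mpr (hm hj))
            fun j _ => ?_
          rw [← ZMod.intCast_zmod_eq_zero_iff_dvd]
          push_cast
          rw [hE]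
          split_ifs with h
          · subst h; simp
          · simp
        obtain ⟨w, hw⟩ := h1
        rw [← natCast_zsmul, ← mul_smul, hw, mul_comm, mul_smul, natCast_zsmul, hA, smul_zero]
      · change ∑ i, E i • x = x
        have h1 : ((∏ i, m i : ℕ) : ℤ) ∣ ∑ i, E i - 1 := by
          push_cast
          refine Finset.prod_dvd_of_coprime (fun j _ j' _ hj => Nat.isCoprime_iff_coprime.mpr (hm hj))
            fun j _ => ?_
          rw [← ZMod.intCast_zmod_eq_zero_iff_dvd]
          push_cast
          simp [hE]
        obtain ⟨w, hw⟩ := h1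
        rw [← Finset.sum_smul, eq_add_of_sub_eq hw, add_smul, one_smul, mul_comm, mul_smul,
          natCast_zsmul, hA, smul_zero, zero_add]
  refine ⟨(AddEquiv.ofBijective sumHom hbij).symm, fun x => ?_⟩
  exact ((AddEquiv.ofBijective sumHom hbij).apply_symm_apply x).symm

namespace DiscriminantForm

variable {D : Type*} [AddCommGroup D] (𝔇 : DiscriminantForm D)

theorem b_nsmul_left (m : ℕ) (x y : D) : 𝔇.b (m • x) y = m • 𝔇.b x y :=
  map_nsmul ((𝔇.q.polarBilin).flip y) m x

theorem b_zsmul_left (m : ℤ) (x y : D) : 𝔇.b (m • x) y = m • 𝔇.b x y :=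
  map_zsmul ((𝔇.q.polarBilin).flip y) m x

theorem b_zsmul_right (m : ℤ) (x y : D) : 𝔇.b x (m • y) = m • 𝔇.b x y :=
  map_zsmul (𝔇.q.polarBilin x) m y

theorem b_zero_right (x : D) : 𝔇.b x 0 = 0 := map_zero (𝔇.q.polarBilin x)

theorem b_eq_zero_of_coprime {m m' : ℕ} (h : m.Coprime m') {x y : D} (hx : m • x = 0)
    (hy : m' • y = 0) : 𝔇.b x y = 0 := by
  have h1 : m • 𝔇.b x y = 0 := by rw [← b_nsmul_left, hx, b_comm, b_zero_right]
  have h2 : m' • 𝔇.b x y = 0 := by rw [b_comm, ← b_nsmul_left, hy, b_comm, b_zero_right]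
  rw [← addOrderOf_dvd_iff_nsmul_eq_zero] at h1 h2
  rw [← AddMonoid.addOrderOf_eq_one_iff, ← Nat.dvd_one, ← h]
  exact Nat.dvd_gcd h1 h2

theorem q_sum {ι : Type*} (s : Finset ι) (y : ι → D)
    (h : ∀ i j, i ≠ j → 𝔇.b (y i) (y j) = 0) : 𝔇.q (∑ i ∈ s, y i) = ∑ i ∈ s, 𝔇.q (y i) := by
  classical
  induction s using Finset.induction_on with
  | empty => simp
  | insert i s hi ih =>
    have h1 : 𝔇.b (y i) (∑ j ∈ s, y j) = 0 := by
      refine (map_sum (𝔇.q.polarBilin (y i)) y s).trans (Finset.sum_eq_zero fun j hj => ?_)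
      exact h i j fun hij => hi (hij ▸ hj)
    rw [Finset.sum_insert hi, Finset.sum_insert hi, q_add, ih, h1, add_zero]

/-- Components for different primes are orthogonal, since the values of the bilinear form between
them have order dividing two coprime numbers. -/
theorem exists_primary_equiv [Fintype D] :
    ∃ Φ : D ≃+ ∀ i : {p // p ∈ (Fintype.card D).primeFactors}, AddCommGroup.primaryComponent D i.1,
      ∀ x, 𝔇.q x = ∑ i, 𝔇.q (Φ x i) := by
  classical
  have hC : Fintype.card D ≠ 0 := Fintype.card_ne_zero
  let m : {p // p ∈ (Fintype.card D).primeFactors} → ℕ := fun i =>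
    i.1 ^ (Fintype.card D).factorization i.1
  have hprime : ∀ i : {p // p ∈ (Fintype.card D).primeFactors}, i.1.Prime := fun i =>
    Nat.prime_of_mem_primeFactors i.2
  have hm : Pairwise (Function.onFun Nat.Coprime m) := fun i j hij =>
    Nat.Coprime.pow _ _ ((Nat.coprime_primes (hprime i) (hprime j)).mpr fun h => hij (Subtype.ext h))
  have hprod : ∏ i, m i = Fintype.card D := by
    conv_rhs => rw [← Nat.prod_factorization_pow_eq_self hC]
    rw [Finsupp.prod, Nat.support_factorization]
    exact Finset.prod_coe_sort (Fintype.card D).primeFactors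
      fun p => p ^ (Fintype.card D).factorization p
  have hH : ∀ i x, x ∈ AddCommGroup.primaryComponent D i.1 ↔ m i • x = 0 := by
    intro i x
    rw [AddCommGroup.mem_primaryComponent]
    refine ⟨?_, fun h => ⟨_, h⟩⟩
    rintro ⟨l, hl⟩
    have h1 : addOrderOf x ∣ i.1 ^ l := addOrderOf_dvd_of_nsmul_eq_zero hl
    obtain ⟨t, -, ht⟩ := (Nat.dvd_prime_pow (hprime i)).mp h1
    have h2 : addOrderOf x ∣ Fintype.card D := addOrderOf_dvd_card
    rw [← addOrderOf_dvd_iff_nsmul_eq_zero, ht]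
    rw [ht] at h2
    exact pow_dvd_pow _ (((hprime i).pow_dvd_iff_le_factorization hC).mp h2)
  obtain ⟨Φ, hΦ⟩ := exists_equiv_pi_torsion hm (A := D)
    (fun x => by rw [hprod]; exact card_nsmul_eq_zero) hH
  refine ⟨Φ, fun x => ?_⟩
  conv_lhs => rw [hΦ x]
  refine 𝔇.q_sum _ _ fun i j hij => ?_
  exact 𝔇.b_eq_zero_of_coprime (hm hij) ((hH i _).mp (Φ x i).2) ((hH j _).mp (Φ x j).2)

theorem exists_localForm_of_hom [Fintype D] {p n : ℕ} [NeZero n]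
    [Fintype (AddCommGroup.primaryComponent D p)] {M : Type*} [AddCommGroup M] [Fintype M]
    (L : LocalForm p n M) {f : M →+ D} (hf : Function.Injective f)
    (hr : f.range = AddCommGroup.primaryComponent D p) (hq : ∀ x, 𝔇.q (f x) = toQZ n (L.Q x)) :
    ∃ L' : LocalForm p n (AddCommGroup.primaryComponent D p),
      (∀ x, toQZ n (L'.Q x) = 𝔇.q x) ∧ L'.χ = L.χ ∧ L'.η = L.η := by
  let f' : M ≃+ AddCommGroup.primaryComponent D p :=
    (AddMonoidHom.ofInjective hf).trans (AddEquiv.addSubgroupCongr hr)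
  refine ⟨L.transfer f'.symm, fun x => ?_, rfl, rfl⟩
  obtain ⟨y, rfl⟩ := f'.surjective x
  change toQZ n (L.Q (f'.symm (f' y))) = 𝔇.q (f y)
  rw [f'.symm_apply_apply, hq]

/-- The homomorphism from `ℤ/n` that sends `1` to `γ`. -/
def zmodHom (n : ℕ) {γ : D} (hγ : addOrderOf γ = n) : ZMod n →+ D :=
  ZMod.lift n ⟨zmultiplesHom D γ, by
    simp [← hγ, addOrderOf_nsmul_eq_zero]⟩

theorem zmodHom_intCast {n : ℕ} {γ : D} (hγ : addOrderOf γ = n) (m : ℤ) :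
    zmodHom n hγ m = m • γ := by
  simp [zmodHom]

theorem zmodHom_injective {n : ℕ} {γ : D} (hγ : addOrderOf γ = n) :
    Function.Injective (zmodHom n hγ) := by
  rw [injective_iff_map_eq_zero]
  intro x hx
  obtain ⟨m, rfl⟩ := ZMod.intCast_surjective x
  rw [zmodHom_intCast, ← addOrderOf_dvd_iff_zsmul_eq_zero, hγ] at hx
  exact (ZMod.intCast_zmod_eq_zero_iff_dvd _ _).mpr hx

theorem range_zmodHom {n : ℕ} {γ : D} (hγ : addOrderOf γ = n) :
    (zmodHom n hγ).range = AddSubgroup.zmultiples γ := by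
  ext x
  rw [AddMonoidHom.mem_range, AddSubgroup.mem_zmultiples_iff]
  constructor
  · rintro ⟨y, rfl⟩
    obtain ⟨m, rfl⟩ := ZMod.intCast_surjective y
    exact ⟨m, (zmodHom_intCast hγ m).symm⟩
  · rintro ⟨m, rfl⟩
    exact ⟨m, zmodHom_intCast hγ m⟩

theorem q_zsmul_of_eq_toQZ {n : ℕ} [NeZero n] {γ : D} {u : ZMod n} (h : 𝔇.q γ = toQZ n u) (m : ℤ) :
    𝔇.q (m • γ) = toQZ n (m ^ 2 * u) := by
  rw [QuadraticMap.map_smul, h, ← map_zsmul, zsmul_eq_mul]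
  push_cast
  rw [pow_two]

theorem exists_localForm_odd [Fintype D] {p : ℕ} [hp : Fact p.Prime] (hp2 : p ≠ 2)
    [Fintype (AddCommGroup.primaryComponent D p)] {δ : ℕ → ℤ} (two : TwoPart)
    (h : 𝔇.IsOddJordan p (δ p)) :
    ∃ L : LocalForm p p (AddCommGroup.primaryComponent D p),
      (∀ x, toQZ p (L.Q x) = 𝔇.q x) ∧ (∀ m : ℤ, chiAt two p m = L.χ m) ∧
        ∀ c : ℕ, eps δ two (p * c) p = L.η * L.χ c := by
  obtain ⟨hδ, γ, hγ, hord, a, hq, ha⟩ := h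
  have hchi : ∀ m : ℤ, jacobiSym m p = quadraticChar (ZMod p) m := fun m => by
    rw [← jacobiSym.legendreSym.to_jacobiSym]; rfl
  have ha0 : (a : ZMod p) ≠ 0 := by
    intro h0
    rw [hchi, Int.cast_mul, h0, mul_zero, MulChar.map_zero] at ha
    rcases hδ with h | h <;> rw [h] at ha <;> norm_num at ha
  obtain ⟨L, h1, h2, h3⟩ := 𝔇.exists_localForm_of_hom (LocalForm.odd p hp2 a ha0)
    (zmodHom_injective hord) ((range_zmodHom hord).trans hγ) fun x => by
      obtain ⟨m, rfl⟩ := ZMod.intCast_surjective x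
      rw [zmodHom_intCast, 𝔇.q_zsmul_of_eq_toQZ (hq.trans (toQZ_intCast p a).symm)]
      congr 1
      exact mul_comm _ _
  refine ⟨L, h1, fun m => ?_, fun c => ?_⟩
  · rw [chiAt, if_neg hp2, h2, hchi]; rfl
  · have hp0 : (p : ℤ) ≠ 0 := by exact_mod_cast hp.out.ne_zero
    have hN : (2 * ((p * c : ℕ) : ℤ) / p) = 2 * c := by
      push_cast
      rw [show (2 * (p * c) : ℤ) = p * (2 * c) by ring, Int.mul_ediv_cancel_left _ hp0]
    have h20 : (2 : ZMod p) ≠ 0 := Ring.two_ne_zero (R := ZMod p) (by rwa [ZMod.ringChar_zmod_n])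
    have h22 := quadraticChar_sq_one h20
    rw [eps.eq_def, if_neg hp2, hN, chiAt, if_neg hp2, ← ha, h2, h3, hchi, hchi]
    simp only [LocalForm.odd]
    push_cast
    rw [map_mul, map_mul]
    -- The 2 in ε_p = χ_p(2N/p) δ_p cancels the 2 in δ_p = (2a/p), leaving χ(c) η.
    linear_combination quadraticChar (ZMod p) c * quadraticChar (ZMod p) a * h22

theorem exists_hom_of_isTwoJordanSum {q₁ q₂ : ℕ} [NeZero q₁] [NeZero q₂] {t₁ t₂ : ℤ}
    (h : 𝔇.IsTwoJordanSum q₁ t₁ q₂ t₂) {n : ℕ} [NeZero n] {u₁ u₂ : ZMod n}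
    (h₁ : ((t₁ / (2 * q₁) : ℚ) : AddCircle (1 : ℚ)) = toQZ n u₁)
    (h₂ : ((t₂ / (2 * q₂) : ℚ) : AddCircle (1 : ℚ)) = toQZ n u₂) :
    ∃ f : ZMod q₁ × ZMod q₂ →+ D, Function.Injective f ∧
      f.range = AddCommGroup.primaryComponent D 2 ∧
      ∀ x, 𝔇.q (f x) = toQZ n (x.1.val ^ 2 * u₁ + x.2.val ^ 2 * u₂) := by
  obtain ⟨γ₁, γ₂, ho₁, ho₂, hq₁, hq₂, hb, hinf, hsup⟩ := h
  refine ⟨(zmodHom q₁ ho₁).coprod (zmodHom q₂ ho₂), ?_, ?_, fun x => ?_⟩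
  · rw [injective_iff_map_eq_zero]
    rintro ⟨x, y⟩ h
    rw [AddMonoidHom.coprod_apply] at h
    have h3 : zmodHom q₁ ho₁ x ∈ AddSubgroup.zmultiples γ₁ ⊓ AddSubgroup.zmultiples γ₂ := by
      refine ⟨?_, ?_⟩
      · rw [← range_zmodHom ho₁]; exact ⟨x, rfl⟩
      · rw [← range_zmodHom ho₂, eq_neg_of_add_eq_zero_left h]
        exact ⟨-y, map_neg _ _⟩
    rw [hinf, AddSubgroup.mem_bot] at h3
    rw [h3, zero_add] at h
    exact Prod.ext ((injective_iff_map_eq_zero _).mp (zmodHom_injective ho₁) _ h3)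
      ((injective_iff_map_eq_zero _).mp (zmodHom_injective ho₂) _ h)
  · rw [← hsup, ← range_zmodHom ho₁, ← range_zmodHom ho₂]
    ext z
    simp [AddSubgroup.mem_sup, AddMonoidHom.mem_range]
  · obtain ⟨x, y⟩ := x
    rw [AddMonoidHom.coprod_apply]
    have hx : zmodHom q₁ ho₁ x = (x.val : ℤ) • γ₁ := by
      rw [← zmodHom_intCast ho₁]; simp
    have hy : zmodHom q₂ ho₂ y = (y.val : ℤ) • γ₂ := by
      rw [← zmodHom_intCast ho₂]; simp
    rw [hx, hy, q_add, 𝔇.b_zsmul_left, 𝔇.b_zsmul_right, hb, smul_zero, smul_zero, add_zero,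
      𝔇.q_zsmul_of_eq_toQZ (hq₁.trans h₁), 𝔇.q_zsmul_of_eq_toQZ (hq₂.trans h₂), ← map_add]
    push_cast
    rfl

theorem exists_localForm_twoTwo [Fintype D] [Fintype (AddCommGroup.primaryComponent D 2)] {δ : ℕ → ℤ}
    {t : ℤ} (h : 𝔇.IsTwoJordan (.twoTwo t)) :
    ∃ L : LocalForm 2 4 (AddCommGroup.primaryComponent D 2),
      (∀ x, toQZ 4 (L.Q x) = 𝔇.q x) ∧ (∀ m : ℤ, chiAt (.twoTwo t) 2 m = L.χ m) ∧
        ∀ c : ℕ, eps δ (.twoTwo t) (4 * c) 2 = L.η * L.χ c := by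
  obtain ⟨ht, t₁, t₂, -, -, hs, hχ, h⟩ := h
  obtain ⟨f, hf, hr, hq⟩ := 𝔇.exists_hom_of_isTwoJordanSum h (n := 4) (u₁ := t₁) (u₂ := t₂)
    (by rw [toQZ_intCast]; norm_num) (by rw [toQZ_intCast]; norm_num)
  -- If t₁ + t₂ is ±2 modulo 8 and (2/t₁) = (2/t₂), then t₁ and t₂ are both ±1 modulo 4 with the
  -- same sign, so the form is c(x² + y²) with c = t/2.
  obtain ⟨c, hc, hct, hc₁, hc₂⟩ : ∃ c : ℤ, (c = 1 ∨ c = -1) ∧ t = 2 * c ∧ (t₁ : ZMod 4) = c ∧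
      (t₂ : ZMod 4) = c := by
    have hs' : (t₁ : ZMod 8) + t₂ = t := by
      have := (ZMod.intCast_eq_intCast_iff _ _ 8).mpr hs
      exact_mod_cast this
    have hcast : ∀ x : ℤ, (x : ZMod 4) = ZMod.castHom (by norm_num : 4 ∣ 8) (ZMod 4) (x : ZMod 8) :=
      fun x => (map_intCast _ x).symm
    rw [hcast t₁, hcast t₂]
    have key : ∀ a b : ZMod 8, ZMod.χ₈ a * ZMod.χ₈ b = 1 →
        (a + b = 2 → ZMod.castHom (by norm_num : 4 ∣ 8) (ZMod 4) a = 1 ∧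
          ZMod.castHom (by norm_num : 4 ∣ 8) (ZMod 4) b = 1) ∧
        (a + b = -2 → ZMod.castHom (by norm_num : 4 ∣ 8) (ZMod 4) a = -1 ∧
          ZMod.castHom (by norm_num : 4 ∣ 8) (ZMod 4) b = -1) := by decide
    rcases ht with rfl | rfl
    · refine ⟨1, Or.inl rfl, rfl, ?_⟩
      simpa using (key _ _ hχ).1 (by simpa using hs')
    · refine ⟨-1, Or.inr rfl, rfl, ?_⟩
      simpa using (key _ _ hχ).2 (by simpa using hs')
  have hc' : (c : ZMod 4) = 1 ∨ (c : ZMod 4) = -1 := by rcases hc with h | h <;> simp [h]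
  obtain ⟨L, h1, h2, h3⟩ := 𝔇.exists_localForm_of_hom (LocalForm.twoTwo (c : ZMod 4) hc') hf hr fun x => by
      rw [hq, hc₁, hc₂]
      congr 1
      simp only [LocalForm.twoTwo]
      ring
  refine ⟨L, h1, fun m => ?_, fun d => ?_⟩
  · rw [chiAt, if_pos rfl, h2]; rfl
  · have hN : ((4 * d : ℕ) : ℤ) * t / 8 = c * d := by
      rw [hct]
      push_cast
      rw [show (4 * d * (2 * c) : ℤ) = 8 * (c * d) by ring, Int.mul_ediv_cancel_left _ (by norm_num)]
    rw [eps, if_pos rfl, h2, h3]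
    simp only [hN, TwoPart.chi, LocalForm.twoTwo]
    push_cast
    rw [map_mul]

theorem exists_localForm_twoFour [Fintype D] [Fintype (AddCommGroup.primaryComponent D 2)]
    {δ : ℕ → ℤ} {t₁ t₂ : ℤ} (h : 𝔇.IsTwoJordan (.twoFour t₁ t₂)) :
    ∃ L : LocalForm 2 8 (AddCommGroup.primaryComponent D 2),
      (∀ x, toQZ 8 (L.Q x) = 𝔇.q x) ∧ (∀ m : ℤ, chiAt (.twoFour t₁ t₂) 2 m = L.χ m) ∧
        ∀ c : ℕ, eps δ (.twoFour t₁ t₂) (8 * c) 2 = L.η * L.χ c := by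
  obtain ⟨ht₁, ht₂, h⟩ := h
  obtain ⟨f, hf, hr, hq⟩ := 𝔇.exists_hom_of_isTwoJordanSum h (n := 8) (u₁ := (2 * t₁ : ℤ)) (u₂ := t₂)
    (by rw [toQZ_intCast]; congr 1; push_cast; ring) (by rw [toQZ_intCast]; norm_num)
  obtain ⟨χ, hχ, hχ'⟩ : ∃ χ : MulChar (ZMod 8) ℤ,
      (∀ m : ℤ, TwoPart.chi (.twoFour t₁ t₂) m = χ m) ∧
      ((χ = ZMod.χ₈' ∧ ((t₁ : ZMod 8) = t₂ ∨ (t₁ : ZMod 8) = 5 * t₂) ∨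
        χ = ZMod.χ₈ ∧ ((t₁ : ZMod 8) = -t₂ ∨ (t₁ : ZMod 8) = 3 * t₂)) ∧
        (t₂ : ZMod 8) * t₂ = 1) := by
    -- The odd numbers t₁ and t₂ agree modulo 4 precisely if t₁ is t₂ or 5t₂ modulo 8; otherwise t₁
    -- is -t₂ or 3t₂.
    by_cases h4 : ZMod.χ₄ ((t₁ * t₂ : ℤ) : ZMod 4) = 1
    · refine ⟨ZMod.χ₈', fun m => by simp only [TwoPart.chi, if_pos h4], ?_⟩
      revert h4
      rcases ht₁ with rfl | rfl <;> rcases ht₂ with rfl | rfl | rfl | rfl <;> decide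
    · refine ⟨ZMod.χ₈, fun m => by simp only [TwoPart.chi, if_neg h4], ?_⟩
      revert h4
      rcases ht₁ with rfl | rfl <;> rcases ht₂ with rfl | rfl | rfl | rfl <;> decide
  obtain ⟨L, h1, h2, h3⟩ := 𝔇.exists_localForm_of_hom (LocalForm.twoFour χ t₁ t₂ hχ') hf hr
    fun x => by
      rw [hq]
      congr 1
      simp only [LocalForm.twoFour]
      push_cast
      ring
  refine ⟨L, h1, fun m => ?_, fun d => ?_⟩
  · rw [chiAt, if_pos rfl, h2]; exact hχ m
  · have hN : t₂ * ((8 * d : ℕ) : ℤ) / 8 = t₂ * d := by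
      push_cast
      rw [show (t₂ * (8 * d) : ℤ) = 8 * (t₂ * d) by ring, Int.mul_ediv_cancel_left _ (by norm_num)]
    rw [eps, if_pos rfl, h2, h3]
    simp only [hN, hχ, LocalForm.twoFour]
    push_cast
    rw [map_mul]

theorem exists_localForm [Fintype D] {δ : ℕ → ℤ} {two : TwoPart} (hD : 𝔇.HasJordanType δ two) {p : ℕ}
    (hp : p ∈ (Fintype.card D).primeFactors) [Fintype (AddCommGroup.primaryComponent D p)] :
    ∃ (n : ℕ) (_ : NeZero n) (L : LocalForm p n (AddCommGroup.primaryComponent D p)),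
      (∀ x, toQZ n (L.Q x) = 𝔇.q x) ∧ (∀ m : ℤ, chiAt two p m = L.χ m) ∧
        ∀ c : ℕ, eps δ two (n * c) p = L.η * L.χ c := by
  have hpp : Fact p.Prime := ⟨Nat.prime_of_mem_primeFactors hp⟩
  -- By Cauchy's theorem the component is nontrivial, which excludes the trivial Jordan types.
  have hne : AddCommGroup.primaryComponent D p ≠ ⊥ := by
    intro h
    obtain ⟨x, hx⟩ := exists_prime_addOrderOf_dvd_card p (Nat.dvd_of_mem_primeFactors hp)
    have h1 : x ∈ AddCommGroup.primaryComponent D p :=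
      AddCommGroup.mem_primaryComponent.mpr ⟨1, by rw [pow_one, ← hx, addOrderOf_nsmul_eq_zero]⟩
    rw [h, AddSubgroup.mem_bot] at h1
    rw [h1, addOrderOf_zero] at hx
    exact hpp.out.one_lt.ne hx
  by_cases hp2 : p = 2
  · subst hp2
    have h2 := hD.2
    match two, h2 with
    | .triv, h2 => exact absurd h2 hne
    | .twoTwo t, h2 => exact ⟨4, inferInstance, 𝔇.exists_localForm_twoTwo h2⟩
    | .twoFour t₁ t₂, h2 => exact ⟨8, inferInstance, 𝔇.exists_localForm_twoFour h2⟩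
  · exact ⟨p, inferInstance, 𝔇.exists_localForm_odd hp2 two
      ((hD.1 p hpp.out hp2).resolve_left hne)⟩

end DiscriminantForm

namespace LocalDecomp

variable {D : Type*} [AddCommGroup D] {𝔇 : DiscriminantForm D} {N : ℕ} {ι : Type}
    [Fintype ι] {p n : ι → ℕ} [∀ i, NeZero (n i)] {M : ι → Type*} [∀ i, AddCommGroup (M i)]
    [∀ i, Fintype (M i)]

/-- Each local form takes a unit value: some unit u has χ(u) = η, and it is represented 1 + η² = 2
times. An integer that annihilates q is therefore divisible by every n i. -/
theorem level_eq (𝒟 : LocalDecomp 𝔇 N p n M) : 𝔇.level = N := by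
  classical
  have hN0 : 0 < N := by
    rw [← 𝒟.prod_eq]
    exact Finset.prod_pos fun i _ => Nat.pos_of_ne_zero (NeZero.ne _)
  have h1 : ∀ γ, N • 𝔇.q γ = 0 := by
    intro γ
    rw [𝒟.q_eq, Finset.smul_sum]
    refine Finset.sum_eq_zero fun i _ => ?_
    rw [← map_nsmul, nsmul_eq_mul]
    have : (N : ZMod (n i)) = 0 := by simpa using (𝒟.intCast_dvd_iff N).mp dvd_rfl i
    rw [this, zero_mul, map_zero]
  refine le_antisymm (Nat.sInf_le ⟨hN0, h1⟩) ?_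
  refine le_csInf ⟨N, hN0, h1⟩ ?_
  rintro m ⟨hm0, hm⟩
  refine Nat.le_of_dvd hm0 ?_
  rw [← Int.natCast_dvd_natCast, 𝒟.intCast_dvd_iff]
  intro i
  obtain ⟨u, hu⟩ : ∃ u, (𝒟.L i).χ u = (𝒟.L i).η := by
    rcases (𝒟.L i).eta_eq with h | h
    · exact ⟨1, by rw [map_one, h]⟩
    · obtain ⟨u, hu⟩ := (𝒟.L i).exists_neg
      exact ⟨u, by rw [hu, h]⟩
  have hη : (𝒟.L i).η * (𝒟.L i).η = 1 := by
    rcases (𝒟.L i).eta_eq with h | h <;> rw [h] <;> norm_num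
  have hunit : IsUnit u := by
    by_contra h
    rw [(𝒟.L i).chi_nonunit h] at hu
    rw [← hu] at hη
    norm_num at hη
  have h2 := (𝒟.L i).card_fiber u
  rw [hu, hη] at h2
  have h3 : Nat.card {x // (𝒟.L i).Q x = u} ≠ 0 := by
    intro h
    rw [h] at h2
    norm_num at h2
  obtain ⟨⟨x, hx⟩⟩ := (Nat.card_ne_zero.mp h3).1
  have h4 := hm (𝒟.Φ.symm (Pi.single i x))
  rw [𝒟.q_eq, Finset.sum_eq_single i, AddEquiv.apply_symm_apply, Pi.single_eq_same, hx, ← map_nsmul,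
    nsmul_eq_mul] at h4
  · have h5 := toQZ_injective _ (h4.trans (map_zero _).symm)
    rw [Int.cast_natCast]
    exact hunit.mul_left_eq_zero.mp h5
  · intro j _ hj
    rw [AddEquiv.apply_symm_apply, Pi.single_eq_of_ne hj, (𝒟.L j).Q_zero, map_zero]
  · exact fun h => absurd (Finset.mem_univ i) h

end LocalDecomp

end WeilForms

theorem theorem3p3 {D : Type*} [AddCommGroup D] [Fintype D] (𝔇 : DiscriminantForm D)
    (δ : ℕ → ℤ) (two : TwoPart) (hD : 𝔇.HasJordanType δ two)
    (N : ℕ) [NeZero N] (hN : 𝔇.level = N)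
    (r : ℤ) (hr : 𝔇.HasSignature r) (hr2 : Even r)
    (k : ℤ) (hk : k ≡ r / 2 [ZMOD 2])
    (R : Finset SL(2, ℤ))
    (hR : Subgroup.IsComplement (CongruenceSubgroup.Gamma0 N : Set SL(2, ℤ)) (R : Set SL(2, ℤ))) :
    ∃ Φ : vvFormsInv 𝔇 k (𝔇.weilRep hr hr2) ≃ₗ[ℂ] epsForms N k (chiAt two) (eps δ two N),
      (∀ F, (Φ F : ℍ → ℂ) = phi N r k (F : ℍ → D → ℂ)) ∧
      (∀ f, (Φ.symm f : ℍ → D → ℂ) = psi N r k (𝔇.weilRep hr hr2) R (f : ℍ → ℂ)) ∧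
      ∀ (f : epsForms N k (chiAt two) (eps δ two N)) (a : ℤ → ℂ), HasQExp 1 (f : ℍ → ℂ) a →
        ∀ (γ : D) (τ : ℍ),
          HasSum (fun n : {n : ℤ // ((n / N : ℚ) : AddCircle (1 : ℚ)) = 𝔇.q γ} =>
            sCoeff N n * a n * Complex.exp (2 * Real.pi * Complex.I * (n / N) * τ))
            (psi N r k (𝔇.weilRep hr hr2) R (f : ℍ → ℂ) τ γ) ∧
          ∀ m : ℤ, ((m / N : ℚ) : AddCircle (1 : ℚ)) = 𝔇.q γ →
            ∃ x : ℂ,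
              HasSum (fun n : {n : ℤ // ((n / N : ℚ) : AddCircle (1 : ℚ)) = 𝔇.q γ} =>
                a n * Complex.exp (2 * Real.pi * Complex.I * (n / N) * τ)) x ∧
              psi N r k (𝔇.weilRep hr hr2) R (f : ℍ → ℂ) τ γ = sCoeff N m * x := by
  classical
  obtain ⟨Φ, hΦ⟩ := 𝔇.exists_primary_equiv
  let _ : ∀ i : {p // p ∈ (Fintype.card D).primeFactors},
    Fintype (AddCommGroup.primaryComponent D i.1) := fun i => Fintype.ofFinite _
  choose n hn L hL hχ hε using fun i : {p // p ∈ (Fintype.card D).primeFactors} =>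
    𝔇.exists_localForm hD i.2
  have hcop : Pairwise (Function.onFun Nat.Coprime n) := by
    intro i j hij
    obtain ⟨a, ha⟩ := (L i).eq_pow
    obtain ⟨b, hb⟩ := (L j).eq_pow
    rw [Function.onFun, ha, hb]
    exact Nat.Coprime.pow _ _ ((Nat.coprime_primes (L i).prime (L j).prime).mpr
      fun h => hij (Subtype.ext h))
  let 𝒟 : LocalDecomp 𝔇 (∏ i, n i) (fun i => i.1) n
      (fun i => AddCommGroup.primaryComponent D i.1) :=
    { L := L
      Φ := Φ
      q_eq := fun x => by rw [hΦ]; exact Finset.sum_congr rfl fun i _ => (hL i _).symm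
      coprime := hcop
      prod_eq := rfl }
  obtain rfl : ∏ i, n i = N := 𝒟.level_eq.symm.trans hN
  -- The local formula for ε_p is applied with N = n i times its cofactor.
  exact 𝒟.isomorphism hN hχ (fun i => by rw [← hε, 𝒟.mul_cof]) hr hr2 hk hR
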